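/- Setting (dimension one). Let $\mathbb T=\mathbb R/\mathbb Z$ and $\Gamma_n=\{0,\tfrac1n,\dots,\tfrac{n-1}n\}$. Let $\mathcal B$ be a system of intervals $[a,a+h)\subseteq[0,1]$, $0<h\le1$, that is $m$-regular for some integer $m\ge2$, i.e. it contains all intervals $[\ell m^{-j},(\ell+1)m^{-j})$ with integers $j\ge0$, $0\le\ell<m^j$. For $y\in\mathbb R^{\Gamma_n}$ put $$\|y\|_{\mathcal B}=\sup_{B\in\mathcal B}\frac1{\sqrt{\#(\Gamma_n\cap B)}}\Bigl|\sum_{x\in\Gamma_n\cap B}y(x)\Bigr|$$ (terms with $\Gamma_n\cap B=\emptyset$ being $0$), and let $\|\omega\|_{\mathcal B^*}=\max\{\sum_{x\in\Gamma_n}\omega(x)v(x):\|v\|_{\mathcal B}\le1\}$ be the dual norm. For an integer $k\ge1$ let $H^k_0(\mathbb T)$ be the space of mean-zero functions in the $L^2$-Sobolev space of order $k$, with norm $\|D^k\cdot\|_{L^2}$, let $S_n\colon H^k_0(\mathbb T)\to\mathbb R^{\Gamma_n}$ be the sampling operator $g\mapsto(g(x))_{x\in\Gamma_n}$, and let $S_n^*$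 be its adjoint, defined by $\sum_{x\in\Gamma_n}g(x)\omega(x)=\int_{\mathbb T}D^kg\,D^kS_n^*\omega\,dx$ for all $g\in H^k_0(\mathbb T)$. The multiscale distance function of $f$ is $$d_n(t)=\min_{\|\omega\|_{\mathcal B^*}\le t}\|D^kS_n^*\omega-D^kf\|_{L^2},\qquad t\ge0.$$ For $\sigma>0$ and $1\le p,p'\le\infty$, let $B^{\sigma,p'}_{p,0}(\mathbb T)$ be the space of mean-zero $f\in L^p(\mathbb T)$ for which, with an integer $\rho>\sigma$ and $\varpi_\rho(f;t)_p=\sup_{|h|\le t}\|D^\rho_{h,+}f\|_{L^p}$, where $D_{h,+}f=f(\cdot+h)-f$, the quantity $\int_0^1\bigl(t^{-\sigma}\varpi_\rho(f;t)_p\bigr)^{p'}\frac{dt}t$ (for $p'=\infty$: $\operatorname{ess\,sup}_{t>0}t^{-\sigma}\varpi_\rho(f;t)_p$) is finite. Let $W^{\sigma,p}_0(\mathbb T)$ be the mean-zero Sobolev space (the Sobolev–Slobodeckij space for non-integer $\sigma$). **Proposition.** Let $\mathcal B$ be $m$-regular, let $r\ge\frac12$, let $k$ be an integer, let $s$ be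 real with $1\le s\le k$, and let $1\le p\le\infty$. Let $f\in B^{k+s,p'}_{p,0}(\mathbb T)$ for some $1\le p'\le\infty$, or let $f\in W^{k+s,p}_0(\mathbb T)$. Then, as $n\to\infty$, $$\min_{t\ge0}\bigl(d_n(t)+(\log n)^{r/2}t^{1/2}\bigr)=O\bigl(n^{-\mu}(\log n)^{2r\mu}\bigr),\qquad \mu=\frac{s-\bigl(\frac1p-\frac12\bigr)_+}{2s+2k+1-2\bigl(\frac1p-\frac12\bigr)_+},$$ where $x_+=\max\{x,0\}$; the minimum over $t$ exists for every $n\ge2$. -/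

import Mathlib

open Filter Asymptotics MeasureTheory
open scoped NNReal ENNReal

noncomputable section

namespace Multiscale

/-! ### Intervals, the multiresolution norm and its dual (one-dimensional case) -/

/-- A one-dimensional cube: `[a, a + h) ⊆ [0, 1]` with `0 < h ≤ 1`. -/
def IsCube (B : Set ℝ) : Prop :=
  ∃ a h : ℝ, 0 < h ∧ h ≤ 1 ∧ B = Set.Ico a (a + h) ∧ B ⊆ Set.Icc 0 1

/-- `𝓑` is an `m`-regular system of cubes: it consists of cubes, and it contains all
intervals `[ℓ m⁻ʲ, (ℓ + 1) m⁻ʲ)` (those inside `[0, 1]`, i.e. `ℓ < mʲ`). -/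
structure IsRegular (m : ℕ) (𝓑 : Set (Set ℝ)) : Prop where
  two_le : 2 ≤ m
  isCube : ∀ B ∈ 𝓑, IsCube B
  mem : ∀ j ℓ : ℕ, ℓ < m ^ j →
    Set.Ico ((ℓ : ℝ) / (m : ℝ) ^ j) (((ℓ : ℝ) + 1) / (m : ℝ) ^ j) ∈ 𝓑

open Classical in
/-- The indices `i` of the grid points `i / n ∈ Γₙ ∩ B`, where `Γₙ = {0, 1/n, …, (n-1)/n}`. -/
def gridIn (n : ℕ) (B : Set ℝ) : Finset (Fin n) :=
  Finset.univ.filter fun i => (i : ℝ) / (n : ℝ) ∈ B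

/-- The multiresolution norm on `ℝ^Γₙ`. The supremum is over finitely many distinct values;
a cube without grid points contributes `0 / 0 = 0`. -/
def mrNorm (𝓑 : Set (Set ℝ)) (n : ℕ) (y : Fin n → ℝ) : ℝ :=
  ⨆ B : 𝓑, |∑ i ∈ gridIn n B, y i| / √((gridIn n B).card : ℝ)

/-- The dual of the multiresolution norm, with value `∞` if the supremum is infinite (which
does not happen when the multiresolution norm is a norm). -/
def mrDualNorm (𝓑 : Set (Set ℝ)) (n : ℕ) (ω : Fin n → ℝ) : ℝ≥0∞ :=
  ⨆ (v : Fin n → ℝ) (_ : mrNorm 𝓑 n v ≤ 1), ENNReal.ofReal (∑ i, ω i * v i)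

/-! ### Function spaces on the torus `ℝ / ℤ` -/

/-- `g` is the `j`-th weak derivative of `f` on the torus. The test functions are the smooth
`1`-periodic functions. -/
structure HasWeakDeriv (j : ℕ) (f g : UnitAddCircle → ℝ) : Prop where
  integrable : Integrable f
  integrable_deriv : Integrable g
  integral_eq : ∀ φ : ℝ → ℝ, ContDiff ℝ ((⊤ : ℕ∞) : WithTop ℕ∞) φ → Function.Periodic φ 1 →
    ∫ x in (0 : ℝ)..1, f (x : UnitAddCircle) * iteratedDeriv j φ x =
      (-1) ^ j * ∫ x in (0 : ℝ)..1, g (x : UnitAddCircle) * φ x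

/-- Mean-zero Sobolev space `W₀^{m,p}(𝕋)` of integer order `m`. -/
structure MemSobolevNat (m : ℕ) (p : ℝ≥0∞) (f : UnitAddCircle → ℝ) : Prop where
  memLp : MemLp f p
  mean_zero : ∫ x, f x = 0
  deriv : ∀ j ≤ m, ∃ g, HasWeakDeriv j f g ∧ MemLp g p

/-- The Slobodeckij seminorm
`(∫∫ |g x - g y|^p / |x - y|^(1 + θ p) dx dy)^(1/p)`, `0 < θ < 1`; for `p = ∞` this is
`ess sup |g x - g y| / |x - y|^θ`. Here `|x - y|` is the distance on the torus. -/
def slobodeckij (θ : ℝ) (p : ℝ≥0∞) (g : UnitAddCircle → ℝ) : ℝ≥0∞ :=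
  eLpNorm (fun z : UnitAddCircle × UnitAddCircle =>
    (g z.1 - g z.2) / ‖z.1 - z.2‖ ^ (θ + (p⁻¹).toReal)) p (volume.prod volume)

/-- Mean-zero Sobolev space `W₀^{σ,p}(𝕋)` of real order `σ ≥ 0`: the usual space for integer
`σ`, and the Sobolev–Slobodeckij space otherwise. -/
structure MemSobolev (σ : ℝ) (p : ℝ≥0∞) (f : UnitAddCircle → ℝ) : Prop where
  floor : MemSobolevNat ⌊σ⌋₊ p f
  frac : σ ≠ (⌊σ⌋₊ : ℝ) →
    ∃ g, HasWeakDeriv ⌊σ⌋₊ f g ∧ slobodeckij (σ - (⌊σ⌋₊ : ℝ)) p g < ∞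

/-- The `ρ`-th modulus of smoothness `sup_{|h| ≤ t} ‖D_{h,+}^ρ f‖_{L^p}`. -/
def modulus (ρ : ℕ) (p : ℝ≥0∞) (f : UnitAddCircle → ℝ) (t : ℝ) : ℝ≥0∞ :=
  ⨆ (h : ℝ) (_ : |h| ≤ t), eLpNorm ((fwdDiff (h : UnitAddCircle))^[ρ] f) p volume

/-- The Besov seminorm `|f|_{σ,p,p',ρ}`. -/
def besovSeminorm (σ : ℝ) (p p' : ℝ≥0∞) (ρ : ℕ) (f : UnitAddCircle → ℝ) : ℝ≥0∞ :=
  if p' = ∞ then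
    essSup (fun t : ℝ => ENNReal.ofReal (t ^ (-σ)) * modulus ρ p f t)
      (volume.restrict (Set.Ioi 0))
  else
    (∫⁻ t in Set.Ioo (0 : ℝ) 1,
      (ENNReal.ofReal (t ^ (-σ)) * modulus ρ p f t) ^ p'.toReal * ENNReal.ofReal (1 / t)) ^
        (1 / p'.toReal)

/-- Mean-zero Besov space `B_{p,0}^{σ,p'}(𝕋)`. Different `ρ > σ` give equivalent norms, so
that "some `ρ`" and "every `ρ`" define the same space. -/
structure MemBesov (σ : ℝ) (p p' : ℝ≥0∞) (f : UnitAddCircle → ℝ) : Prop where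
  memLp : MemLp f p
  mean_zero : ∫ x, f x = 0
  seminorm : ∃ ρ : ℕ, σ < ρ ∧ besovSeminorm σ p p' ρ f < ∞

/-! ### The adjoint of the sampling operator and the multiscale distance function -/

/-- The homogeneous Sobolev norm `‖D^k v‖_{L²}`, with value `∞` if `v` has no `k`-th weak
derivative. -/
def homNorm (k : ℕ) (v : UnitAddCircle → ℝ) : ℝ≥0∞ :=
  ⨅ (g : UnitAddCircle → ℝ) (_ : HasWeakDeriv k v g), eLpNorm g 2 volume

/-- `u = Sₙ^* ω`, where `Sₙ : H₀^k(𝕋) → ℝ^Γₙ` is the sampling operator: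
`u ∈ H₀^k(𝕋)` and `∑_{x ∈ Γₙ} g(x) ω(x) = ∫ D^k g D^k u` for all `g ∈ H₀^k(𝕋)`
(elements of `H₀^k(𝕋)` are sampled through their continuous representatives). -/
structure IsSamplingAdjoint (k n : ℕ) (ω : Fin n → ℝ) (u : UnitAddCircle → ℝ) : Prop where
  mem : MemSobolevNat k 2 u
  inner_eq : ∀ g : UnitAddCircle → ℝ, Continuous g → MemSobolevNat k 2 g →
    ∀ gk uk : UnitAddCircle → ℝ, HasWeakDeriv k g gk → HasWeakDeriv k u uk →
      ∑ i : Fin n, g (((i : ℝ) / (n : ℝ) : ℝ) : UnitAddCircle) * ω i = ∫ x, gk x * uk x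

/-- The multiscale distance function
`dₙ(t) = min {‖Sₙ^* ω - f‖_{H₀^k} : ‖ω‖_{𝓑^*} ≤ t}`. -/
def distFun (𝓑 : Set (Set ℝ)) (k n : ℕ) (f : UnitAddCircle → ℝ) (t : ℝ≥0) : ℝ≥0∞ :=
  ⨅ (ω : Fin n → ℝ) (_ : mrDualNorm 𝓑 n ω ≤ (t : ℝ≥0∞))
    (u : UnitAddCircle → ℝ) (_ : IsSamplingAdjoint k n ω u), homNorm k (u - f)

/-- `(1/p - 1/2)₊`. -/
def excess (p : ℝ≥0∞) : ℝ := max ((p⁻¹).toReal - 1 / 2) 0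

/-- The exponent `μ = (s - (1/p - 1/2)₊) / (2s + 2k + 1 - 2 (1/p - 1/2)₊)`. -/
def rateExp (k : ℕ) (s : ℝ) (p : ℝ≥0∞) : ℝ :=
  (s - excess p) / (2 * s + 2 * k + 1 - 2 * excess p)

end Multiscale

end

noncomputable section

namespace Multiscale

open scoped ComplexConjugate Real
open AddCircle

/-! Write `e = excess p` and `s' = s - e`, so that the exponent is `μ = s' / (2s' + 2k + 1)`. The
regularity of `f` enters only through the decay of its Fourier blocks: the sum of `|f^(l)|²` over
`m^j ≤ |l| < m^(j+1)` is `O(m^(-2j(k+s')))`. This is `MemBesov.block_bound` and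
`MemSobolev.block_bound`. The loss `e` for `p < 2` comes from `sum_sq_fc_le`, which bounds `N`
Fourier coefficients of an `L^p` function in `ℓ²`.

The minimum is bounded by testing with one vector. For a cutoff `M = m^J ≤ n/2`, sample on the grid
the part of `(-1)^k D^{2k} f` with frequencies below `M`, and divide by `n` (`approxGrid`). In
Fourier terms the adjoint of sampling divides the discrete transform of `ω` by `|2πl|^{2k}`
(`IsSamplingAdjoint.fc_eq`). Orthogonality of characters on the grid makes the reconstruction exact
at frequencies below `M` and zero at the remaining frequencies below `n/2`. The error therefore
consists of the tail of `f`, of size `M^(-s')`, and of aliases beyond `n/2`, of size at most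
`M^(1/2+k-s') n^(-(k-1/2))` (`exists_adjErr_le`).

The dual norm of this vector is `O(n^(-1/2) M^(1/2+k-s'))` (`mrDualNorm_trigPoly_le` with
`exists_sum_sqrt_le`). The reason is multiscale: if the multiresolution norm of `v` is at most one,
regularity of the system controls the sum of `v` over every `m`-adic cell, so by Cauchy–Schwarz a
function constant on the cells of level `j` pairs with `v` to at most `m^(j/2)` times its `ℓ²` norm.
A trigonometric polynomial with frequencies of size `m^j₀` is telescoped through its cell averages
from level `j₀` down to single grid points. The increments decay like `m^(-j)` by a Poincaré
inequality, which beats the growth `m^(j/2)`.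

Balancing `M^(-s')` against `(log n)^(r/2) (n^(-1/2) M^(1/2+k-s'))^(1/2)` gives `M^(2s'+2k+1) = n
(log n)^(-2r)`, hence the rate (`rate_arith`). The alias term is then never dominant. Existence of
the minimum is separate: the functional is lower semicontinuous and coercive in `ω`
(`exists_isLeast`). -/

/-! ### Fourier coefficients of real functions on the circle. -/

theorem volume_eq_haar : (volume : Measure UnitAddCircle) = haarAddCircle := by
  rw [show (volume : Measure UnitAddCircle) = ENNReal.ofReal 1 • haarAddCircle from rfl]; simp

instance : IsProbabilityMeasure (volume : Measure UnitAddCircle) := ⟨by simp⟩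

/-- The Fourier coefficients of a real function on the unit circle. -/
def fc (F : UnitAddCircle → ℝ) (l : ℤ) : ℂ := fourierCoeff (fun x => (F x : ℂ)) l

theorem fc_eq_integral (F : UnitAddCircle → ℝ) (l : ℤ) :
    fc F l = ∫ x : UnitAddCircle, fourier (-l) x * (F x : ℂ) := by
  simp only [fc, fourierCoeff, volume_eq_haar, smul_eq_mul]

theorem norm_fourier_apply (l : ℤ) (x : UnitAddCircle) : ‖(fourier l x : ℂ)‖ = 1 :=
  Circle.norm_coe _

theorem fourier_mul_integrable {F : UnitAddCircle → ℝ} (hF : Integrable F) (l : ℤ) :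
    Integrable fun x : UnitAddCircle => fourier l x * (F x : ℂ) := by
  refine hF.ofReal.bdd_mul (c := 1) (fourier l).continuous.aestronglyMeasurable ?_
  exact Eventually.of_forall fun x => (norm_fourier_apply l x).le

theorem fc_congr_ae {F G : UnitAddCircle → ℝ} (h : F =ᵐ[volume] G) : fc F = fc G := by
  funext l
  rw [fc_eq_integral, fc_eq_integral]
  exact integral_congr_ae (by filter_upwards [h] with x hx; rw [hx])

theorem fc_sub {F G : UnitAddCircle → ℝ} (hF : Integrable F) (hG : Integrable G) (l : ℤ) :
    fc (fun x => F x - G x) l = fc F l - fc G l := by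
  simp only [fc_eq_integral]
  rw [← integral_sub (fourier_mul_integrable hF _) (fourier_mul_integrable hG _)]
  simp only [Complex.ofReal_sub, mul_sub]

theorem fc_neg (F : UnitAddCircle → ℝ) (l : ℤ) : fc F (-l) = conj (fc F l) := by
  rw [fc_eq_integral, fc_eq_integral, ← integral_conj]
  congr 1; funext x
  rw [map_mul, Complex.conj_ofReal, ← fourier_neg]

theorem fc_zero_eq (F : UnitAddCircle → ℝ) : fc F 0 = ((∫ x, F x : ℝ) : ℂ) := by
  rw [fc_eq_integral, ← integral_complex_ofReal]; simp

theorem norm_fc_le (F : UnitAddCircle → ℝ) (l : ℤ) : ‖fc F l‖ ≤ ∫ x, |F x| := by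
  rw [fc_eq_integral]
  refine (norm_integral_le_integral_norm _).trans_eq ?_
  congr 1; funext x
  rw [norm_mul, norm_fourier_apply, one_mul, Complex.norm_real, Real.norm_eq_abs]

theorem fc_translate (F : UnitAddCircle → ℝ) (h : UnitAddCircle) (l : ℤ) :
    fc (fun x => F (x + h)) l = fourier l h * fc F l := by
  simp only [fc_eq_integral]
  rw [← integral_const_mul, ← integral_add_right_eq_self
    (fun x : UnitAddCircle => (fourier l h : ℂ) * (fourier (-l) x * (F x : ℂ))) h]
  congr 1; funext x
  have : (fourier (-l) (x + h) : ℂ) = fourier (-l) x * fourier (-l) h := by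
    simp [smul_add, toCircle_add]
  rw [this]
  have h1 : (fourier l h : ℂ) * fourier (-l) h = 1 := by
    rw [← fourier_add]; simp
  linear_combination (-(fourier (-l) x : ℂ) * (F (x + h) : ℂ)) * h1

theorem coe_toLp_ofReal {F : UnitAddCircle → ℝ} (hF : MemLp F 2) :
    MemLp (fun x => (F x : ℂ)) 2 (haarAddCircle : Measure UnitAddCircle) := by
  rw [← volume_eq_haar]; exact hF.ofReal

theorem hasSum_fc_mul {F G : UnitAddCircle → ℝ} (hF : MemLp F 2) (hG : MemLp G 2) :
    HasSum (fun l => conj (fc F l) * fc G l) ((∫ x, F x * G x : ℝ) : ℂ) := by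
  have h := (fourierBasis (T := (1 : ℝ))).hasSum_inner_mul_inner
    (coe_toLp_ofReal hF).toLp (coe_toLp_ofReal hG).toLp
  have h2 : inner ℂ (coe_toLp_ofReal hF).toLp (coe_toLp_ofReal hG).toLp
      = ((∫ x, F x * G x : ℝ) : ℂ) := by
    rw [L2.inner_def, ← integral_complex_ofReal, volume_eq_haar]
    refine integral_congr_ae ?_
    filter_upwards [(coe_toLp_ofReal hF).coeFn_toLp, (coe_toLp_ofReal hG).coeFn_toLp] with x h1 h2
    rw [h1, h2]; simp [mul_comm]
  rw [h2] at h
  have h3 : ∀ {F : UnitAddCircle → ℝ} (hF : MemLp F 2) (l : ℤ),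
      inner ℂ (fourierBasis (T := (1 : ℝ)) l) (coe_toLp_ofReal hF).toLp = fc F l := by
    intro F hF l
    rw [← HilbertBasis.repr_apply_apply, fourierBasis_repr]
    exact congrFun (fourierCoeff_congr_ae (coe_toLp_ofReal hF).coeFn_toLp) l
  have h4 : (fun l => conj (fc F l) * fc G l) = fun l =>
      inner ℂ (coe_toLp_ofReal hF).toLp (fourierBasis (T := (1 : ℝ)) l) *
        inner ℂ (fourierBasis (T := (1 : ℝ)) l) (coe_toLp_ofReal hG).toLp := by
    funext l; rw [h3 hG, ← h3 hF, inner_conj_symm]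
  rw [h4]; exact h

theorem hasSum_fc_sq {F : UnitAddCircle → ℝ} (hF : MemLp F 2) :
    HasSum (fun l => ‖fc F l‖ ^ 2) (∫ x, F x ^ 2) := by
  have h := hasSum_fc_mul hF hF
  rw [← Complex.hasSum_ofReal]
  convert h using 2 with l
  · rw [Complex.conj_mul']; push_cast; rfl
  · simp only [sq]

theorem eLpNorm_two_eq {F : UnitAddCircle → ℝ} (hF : MemLp F 2) :
    eLpNorm F 2 volume = ENNReal.ofReal (√(∑' l, ‖fc F l‖ ^ 2)) := by
  rw [(hasSum_fc_sq hF).tsum_eq, hF.eLpNorm_eq_integral_rpow_norm (by norm_num) (by norm_num)]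
  simp [Real.sqrt_eq_rpow]

theorem exists_fc_eq (b : ℤ → ℂ) (hb : ∀ l, b (-l) = conj (b l))
    (hs : Summable fun l => ‖b l‖ ^ 2) :
    ∃ F : UnitAddCircle → ℝ, MemLp F 2 ∧ ∀ l, fc F l = b l := by
  have hmem : Memℓp b 2 := by
    rw [memℓp_gen_iff (by norm_num)]; simpa using hs
  set U := (fourierBasis (T := (1 : ℝ))).repr.symm ⟨b, hmem⟩ with hU
  have hUb : ∀ l, fourierCoeff U l = b l := by
    intro l
    rw [← fourierBasis_repr, hU]; simp
  have hUL : MemLp U 2 (volume : Measure UnitAddCircle) := by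
    rw [volume_eq_haar]; exact Lp.memLp U
  -- The symmetry of `b` gives `U` and its conjugate the same coefficients, so their average, the
  -- real part, keeps them.
  refine ⟨fun x => (U x).re, hUL.re, fun l => ?_⟩
  have hint : Integrable U (volume : Measure UnitAddCircle) := hUL.integrable (by norm_num)
  have hI : ∀ l : ℤ, Integrable fun x : UnitAddCircle => fourier l x * U x := fun l =>
    hint.bdd_mul (c := 1) (fourier l).continuous.aestronglyMeasurable
      (Eventually.of_forall fun x => (norm_fourier_apply l x).le)
  have h1 : ∀ l, ∫ x : UnitAddCircle, fourier (-l) x * U x = b l := by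
    intro l; rw [← hUb, fourierCoeff, volume_eq_haar]; rfl
  have h2 : ∫ x : UnitAddCircle, fourier (-l) x * conj (U x) = b l := by
    have := congrArg conj (h1 (-l))
    rw [← integral_conj, hb, Complex.conj_conj] at this
    rw [← this]
    congr 1; funext x
    rw [map_mul, ← fourier_neg]; simp
  have hI2 : Integrable fun x : UnitAddCircle => fourier (-l) x * conj (U x) := by
    refine (Complex.conjLIE.toContinuousLinearEquiv.toContinuousLinearMap.integrable_comp
      (hI l)).congr (Eventually.of_forall fun x => ?_)
    change conj (fourier l x * U x) = fourier (-l) x * conj (U x)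
    rw [map_mul, fourier_neg]
  rw [fc_eq_integral]
  calc ∫ x : UnitAddCircle, fourier (-l) x * (((U x).re : ℝ) : ℂ)
      = ∫ x : UnitAddCircle, (1 / 2 : ℂ) * (fourier (-l) x * U x + fourier (-l) x * conj (U x)) := by
        congr 1; funext x
        rw [Complex.re_eq_add_conj]; ring
    _ = b l := by
        rw [integral_const_mul, integral_add (hI _) hI2, h1, h2]; ring

/-- Integration against `H` is a functional continuous in the sup norm, and trigonometric
polynomials are dense in the continuous functions. -/
theorem integral_mul_eq_zero_of_fc_eq_zero {H : UnitAddCircle → ℝ} (hH : Integrable H)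
    (h : ∀ l, fc H l = 0) (φ : C(UnitAddCircle, ℂ)) : ∫ x, φ x * (H x : ℂ) = 0 := by
  have hint : ∀ φ : C(UnitAddCircle, ℂ), Integrable fun x => φ x * (H x : ℂ) := fun φ =>
    hH.ofReal.bdd_mul (c := ‖φ‖) φ.continuous.aestronglyMeasurable
      (Eventually.of_forall fun x => φ.norm_coe_le_norm x)
  let Λ : C(UnitAddCircle, ℂ) →ₗ[ℂ] ℂ :=
    { toFun := fun φ => ∫ x, φ x * (H x : ℂ)
      map_add' := fun φ ψ => by
        rw [← integral_add (hint φ) (hint ψ)]; simp only [ContinuousMap.add_apply, add_mul]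
      map_smul' := fun c φ => by
        simp only [ContinuousMap.smul_apply, smul_eq_mul, mul_assoc, integral_const_mul,
          RingHom.id_apply] }
  have hΛ : Continuous Λ := by
    refine (Λ.mkContinuous (∫ x, |H x|) fun φ => ?_).continuous
    change ‖∫ x, φ x * (H x : ℂ)‖ ≤ _
    refine (norm_integral_le_integral_norm _).trans ?_
    rw [mul_comm, ← integral_const_mul]
    refine integral_mono (hint φ).norm (hH.abs.const_mul _) fun x => ?_
    dsimp only
    rw [norm_mul, Complex.norm_real, Real.norm_eq_abs]
    exact mul_le_mul_of_nonneg_right (φ.norm_coe_le_norm x) (abs_nonneg _)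
  have hclosed : IsClosed (Λ.ker : Set C(UnitAddCircle, ℂ)) :=
    isClosed_singleton.preimage hΛ
  have hspan : Submodule.span ℂ (Set.range (fourier (T := (1 : ℝ)))) ≤ Λ.ker := by
    rw [Submodule.span_le]
    rintro _ ⟨l, rfl⟩
    change ∫ x : UnitAddCircle, fourier l x * (H x : ℂ) = 0
    rw [← h (-l), fc_eq_integral, neg_neg]
  have htop := Submodule.topologicalClosure_minimal _ hspan hclosed
  rw [span_fourier_closure_eq_top] at htop
  exact htop (Submodule.mem_top (x := φ))

/-- Uniqueness is needed in `L¹`, where Parseval is unavailable. The positive and negative parts of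
the difference define finite measures that agree on continuous functions, hence coincide. -/
theorem ae_eq_of_fc_eq {F G : UnitAddCircle → ℝ} (hF : Integrable F) (hG : Integrable G)
    (h : ∀ l, fc F l = fc G l) : F =ᵐ[volume] G := by
  set H : UnitAddCircle → ℝ := fun x => F x - G x with hHdef
  have hH : Integrable H := hF.sub hG
  have hfc : ∀ l, fc H l = 0 := fun l => by rw [fc_sub hF hG, h, sub_self]
  have hfin : ∀ {K : UnitAddCircle → ℝ}, Integrable K →
      IsFiniteMeasure (volume.withDensity fun x => ENNReal.ofReal (K x)) := fun hK =>
    isFiniteMeasure_withDensity_ofReal hK.2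
  have hHn : Integrable fun x => -H x := hH.neg
  have h1 := hfin hH
  have h2 : IsFiniteMeasure (volume.withDensity fun x => ENNReal.ofReal (-H x)) := hfin hH.neg
  have hm1 := hH.1.aemeasurable.ennreal_ofReal
  have hm2 : AEMeasurable fun x => ENNReal.ofReal (-H x) := hH.neg.1.aemeasurable.ennreal_ofReal
  have hi : ∀ {K : UnitAddCircle → ℝ} (φ : BoundedContinuousFunction UnitAddCircle ℝ),
      Integrable K → Integrable fun x => (ENNReal.ofReal (K x)).toReal • φ x := by
    intro K φ hK
    simp only [ENNReal.toReal_ofReal']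
    exact hK.pos_part.mul_bdd (c := ‖φ‖) φ.continuous.aestronglyMeasurable
      (Eventually.of_forall fun x => φ.norm_coe_le_norm x)
  have hm : (volume.withDensity fun x => ENNReal.ofReal (H x)) =
      volume.withDensity fun x => ENNReal.ofReal (-H x) := by
    refine ext_of_forall_integral_eq_of_IsFiniteMeasure fun φ => ?_
    rw [integral_withDensity_eq_integral_toReal_smul₀ hm1
        (Eventually.of_forall fun _ => ENNReal.ofReal_lt_top),
      integral_withDensity_eq_integral_toReal_smul₀ hm2
        (Eventually.of_forall fun _ => ENNReal.ofReal_lt_top), ← sub_eq_zero,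
      ← integral_sub (hi φ hH) (hi φ hHn)]
    · have := integral_mul_eq_zero_of_fc_eq_zero hH hfc
        ⟨fun x => (φ x : ℂ), Complex.continuous_ofReal.comp φ.continuous⟩
      rw [← Complex.ofReal_inj, ← integral_complex_ofReal, Complex.ofReal_zero, ← this]
      congr 1; funext x
      simp only [ContinuousMap.coe_mk, smul_eq_mul, ENNReal.toReal_ofReal', ← Complex.ofReal_mul,
        ← sub_mul, max_zero_sub_eq_self, mul_comm]
  have h3 := (withDensity_eq_iff hm1 hm2 hH.lintegral_lt_top.ne).1 hm
  filter_upwards [h3] with x hx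
  have : H x = 0 := by
    have h4 := congrArg ENNReal.toReal hx
    simp only [ENNReal.toReal_ofReal'] at h4
    rcases le_total 0 (H x) with h5 | h5
    · rw [max_eq_left h5, max_eq_right (by linarith)] at h4; exact h4
    · rw [max_eq_right h5, max_eq_left (by linarith)] at h4; linarith
  simp only [hHdef] at this; linarith

/-! ### Weak derivatives as Fourier multipliers. -/

/-- The symbol `2 π i l` of the derivative. -/
def symb (l : ℤ) : ℂ := 2 * π * Complex.I * l

theorem conj_symb (l : ℤ) : conj (symb l) = -symb l := by
  simp only [symb, map_mul, Complex.conj_ofReal, Complex.conj_I, map_intCast, map_ofNat]; ring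

theorem symb_neg (l : ℤ) : symb (-l) = -symb l := by simp [symb]

theorem symb_zero : symb 0 = 0 := by simp [symb]

theorem norm_symb (l : ℤ) : ‖symb l‖ = 2 * π * |(l : ℝ)| := by
  simp [symb, abs_of_pos Real.pi_pos]

theorem symb_ne_zero {l : ℤ} (hl : l ≠ 0) : symb l ≠ 0 := by simp [symb, hl]

/-- The real trigonometric function `x ↦ Re (c e^{2 π i l x})`. -/
def trig (c : ℂ) (l : ℤ) (x : UnitAddCircle) : ℝ := (c * fourier l x).re

theorem trig_coe (c : ℂ) (l : ℤ) (x : ℝ) :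
    trig c l (x : UnitAddCircle) = (c * Complex.exp (symb l * x)).re := by
  rw [trig, fourier_coe_apply]; simp [symb]

theorem continuous_trig (c : ℂ) (l : ℤ) : Continuous (trig c l) :=
  Complex.continuous_re.comp (continuous_const.mul (fourier l).continuous)

theorem hasDerivAt_trig (c : ℂ) (l : ℤ) (x : ℝ) :
    HasDerivAt (fun x : ℝ => trig c l (x : UnitAddCircle)) (trig (c * symb l) l x) x := by
  simp only [trig_coe]
  have h1 : HasDerivAt (fun y : ℂ => c * Complex.exp (symb l * y))
      (c * (Complex.exp (symb l * x) * (symb l * 1))) (x : ℂ) :=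
    (((hasDerivAt_id _).const_mul (symb l)).cexp).const_mul c
  convert h1.real_of_complex using 2
  ring

theorem iteratedDeriv_trig (j : ℕ) (c : ℂ) (l : ℤ) :
    iteratedDeriv j (fun x : ℝ => trig c l (x : UnitAddCircle)) =
      fun x : ℝ => trig (c * symb l ^ j) l (x : UnitAddCircle) := by
  induction j with
  | zero => simp
  | succ j ih =>
    rw [iteratedDeriv_succ, ih]
    funext x
    rw [(hasDerivAt_trig _ l x).deriv, pow_succ, mul_assoc]

theorem contDiff_trig (c : ℂ) (l : ℤ) {n : WithTop ℕ∞} :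
    ContDiff ℝ n (fun x : ℝ => trig c l (x : UnitAddCircle)) := by
  simp only [trig_coe]
  have : ContDiff ℝ n fun x : ℝ => c * Complex.exp (symb l * x) :=
    contDiff_const.mul ((contDiff_const.mul Complex.ofRealCLM.contDiff).cexp)
  exact Complex.reCLM.contDiff.comp this

theorem periodic_coe (F : UnitAddCircle → ℝ) :
    Function.Periodic (fun x : ℝ => F (x : UnitAddCircle)) 1 := fun x => by
  simp only [AddCircle.coe_add, AddCircle.coe_period, add_zero]

theorem intervalIntegral_coe (F : UnitAddCircle → ℝ) :
    ∫ x in (0 : ℝ)..1, F (x : UnitAddCircle) = ∫ x, F x := by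
  have := UnitAddCircle.intervalIntegral_preimage 0 F
  rwa [zero_add] at this

theorem integral_mul_trig {F : UnitAddCircle → ℝ} (hF : Integrable F) (c : ℂ) (l : ℤ) :
    ∫ x, F x * trig c l x = (c * fc F (-l)).re := by
  rw [fc_eq_integral, neg_neg, ← integral_const_mul]
  have h1 : Integrable fun x : UnitAddCircle => c * (fourier l x * (F x : ℂ)) :=
    (fourier_mul_integrable hF l).const_mul c
  have h2 := integral_re h1
  simp only [RCLike.re_eq_complex_re] at h2
  rw [← h2]
  congr 1; funext x
  rw [trig, ← mul_assoc, Complex.re_mul_ofReal, mul_comm]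

/-- Test functions are real; letting the phase `c` vary recovers complex coefficients from them. -/
theorem eq_of_forall_re_mul {z w : ℂ} (h : ∀ c : ℂ, (c * z).re = (c * w).re) : z = w := by
  apply Complex.ext
  · simpa using h 1
  · simpa using h (-Complex.I)

theorem HasWeakDeriv.fc_eq {j : ℕ} {f g : UnitAddCircle → ℝ} (h : HasWeakDeriv j f g) (l : ℤ) :
    fc g l = symb l ^ j * fc f l := by
  have key : symb (-l) ^ j * fc f (- -l) = (-1) ^ j * fc g (- -l) := by
    refine eq_of_forall_re_mul fun c => ?_
    have h1 := h.integral_eq (fun x : ℝ => trig c (-l) (x : UnitAddCircle)) (contDiff_trig c (-l))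
      (periodic_coe _)
    rw [iteratedDeriv_trig, intervalIntegral_coe (fun x => f x * trig (c * symb (-l) ^ j) (-l) x),
      intervalIntegral_coe (fun x => g x * trig c (-l) x), integral_mul_trig h.integrable,
      integral_mul_trig h.integrable_deriv] at h1
    rw [← mul_assoc, h1, mul_left_comm]
    have : ((-1 : ℂ) ^ j) = (((-1 : ℝ) ^ j : ℝ) : ℂ) := by push_cast; rfl
    rw [this, Complex.re_ofReal_mul]
  rw [neg_neg, symb_neg, neg_pow, mul_assoc] at key
  exact (mul_left_cancel₀ (pow_ne_zero _ (by norm_num)) key).symm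

theorem fc_eq_intervalIntegral (F : UnitAddCircle → ℝ) (l : ℤ) :
    fc F l = ∫ x in (0 : ℝ)..1, fourier (-l) (x : UnitAddCircle) * (F x : ℂ) := by
  rw [fc, fourierCoeff_eq_intervalIntegral _ _ 0]; simp

/-- Integration by parts over one period; the boundary terms cancel by periodicity. -/
theorem fc_eq_symb_mul_of_hasDerivAt {Φ Ψ : UnitAddCircle → ℝ}
    (h : ∀ x : ℝ, HasDerivAt (fun x : ℝ => Φ (x : UnitAddCircle)) (Ψ x) x)
    (hΨ : Continuous fun x : ℝ => Ψ (x : UnitAddCircle)) (l : ℤ) :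
    fc Ψ l = symb l * fc Φ l := by
  rw [fc_eq_intervalIntegral, fc_eq_intervalIntegral]
  have hd : ∀ x : ℝ, HasDerivAt (fun y : ℝ => (fourier (-l) (y : UnitAddCircle) : ℂ))
      (-symb l * fourier (-l) (x : UnitAddCircle)) x := by
    intro x
    have := hasDerivAt_fourier_neg 1 l x
    convert this using 1
    simp [symb]
  have hcont : Continuous fun y : ℝ => (fourier (-l) (y : UnitAddCircle) : ℂ) :=
    (fourier (-l)).continuous.comp (AddCircle.continuous_mk' 1)
  have := intervalIntegral.integral_mul_deriv_eq_deriv_mul (a := 0) (b := 1)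
    (fun x _ => hd x) (fun x _ => (h x).ofReal_comp)
    ((continuous_const.mul hcont).intervalIntegrable _ _)
    ((Complex.continuous_ofReal.comp hΨ).intervalIntegrable _ _)
  rw [this]
  have h1 : ((1 : ℝ) : UnitAddCircle) = ((0 : ℝ) : UnitAddCircle) := by
    simp
  rw [h1, sub_self, zero_sub, ← intervalIntegral.integral_const_mul,
    ← intervalIntegral.integral_neg]
  congr 1; funext x; ring

theorem continuous_of_comp_coe {F : UnitAddCircle → ℝ}
    (h : Continuous fun x : ℝ => F (x : UnitAddCircle)) : Continuous F :=
  continuous_coinduced_dom.2 h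

theorem memLp_of_continuous {F : UnitAddCircle → ℝ} (h : Continuous F) (p : ℝ≥0∞) : MemLp F p :=
  h.memLp_of_hasCompactSupport (HasCompactSupport.of_compactSpace F)

/-- Parseval turns both sides of the defining identity into sums over frequencies. The sign `(-1)^j`
is produced by conjugating the purely imaginary symbol. -/
theorem hasWeakDeriv_of_fc_eq {j : ℕ} {f g : UnitAddCircle → ℝ} (hf : MemLp f 2) (hg : MemLp g 2)
    (h : ∀ l, fc g l = symb l ^ j * fc f l) : HasWeakDeriv j f g := by
  refine ⟨hf.integrable (by norm_num), hg.integrable (by norm_num), fun φ hφ hper => ?_⟩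
  have hperi : ∀ i, Function.Periodic (iteratedDeriv i φ) 1 := by
    intro i
    induction i with
    | zero => simpa using hper
    | succ i ih =>
      intro x
      rw [iteratedDeriv_succ]
      have : (fun y => iteratedDeriv i φ (y + 1)) = iteratedDeriv i φ := funext ih
      rw [← deriv_comp_add_const, this]
  let Φ : ℕ → UnitAddCircle → ℝ := fun i => (hperi i).lift
  have hΦ : ∀ i (x : ℝ), Φ i x = iteratedDeriv i φ x := fun i x => (hperi i).lift_coe x
  have hcont : ∀ i, Continuous (iteratedDeriv i φ) := fun i =>
    hφ.continuous_iteratedDeriv i (by exact_mod_cast le_top)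
  have hΦc : ∀ i, Continuous (Φ i) := fun i =>
    continuous_of_comp_coe (by simp only [hΦ]; exact hcont i)
  have hfc : ∀ i l, fc (Φ i) l = symb l ^ i * fc (Φ 0) l := by
    intro i l
    induction i with
    | zero => simp
    | succ i ih =>
      rw [pow_succ', mul_assoc, ← ih]
      refine fc_eq_symb_mul_of_hasDerivAt (fun x => ?_) (by simp only [hΦ]; exact hcont _) l
      simp only [hΦ]
      rw [iteratedDeriv_succ]
      exact ((hφ.differentiable_iteratedDeriv i (by exact_mod_cast WithTop.coe_lt_top _)) x).hasDerivAt
  have h1 := hasSum_fc_mul hf (memLp_of_continuous (hΦc j) 2)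
  have h2 := (hasSum_fc_mul hg (memLp_of_continuous (hΦc 0) 2)).mul_left ((-1 : ℂ) ^ j)
  have h3 : (fun l => conj (fc f l) * fc (Φ j) l) =
      fun l => (-1 : ℂ) ^ j * (conj (fc g l) * fc (Φ 0) l) := by
    funext l
    rw [hfc j, h, map_mul, map_pow, conj_symb, neg_pow]
    have : ((-1 : ℂ) ^ j) * (-1) ^ j = 1 := by rw [← mul_pow]; norm_num
    linear_combination (-(conj (fc f l) * symb l ^ j * fc (Φ 0) l)) * this
  rw [h3] at h1
  have h4 := h1.unique h2
  have h5 : ∫ x, f x * Φ j x = (-1) ^ j * ∫ x, g x * Φ 0 x := by exact_mod_cast h4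
  rw [← intervalIntegral_coe, ← intervalIntegral_coe] at h5
  simpa only [hΦ, iteratedDeriv_zero] using h5

/-- For `p < 2` the function is not given in `L²`; it is identified with the `L²` function having
the same coefficients. -/
theorem memLp_two_of_fc {F : UnitAddCircle → ℝ} (hF : Integrable F)
    (h : Summable fun l => ‖fc F l‖ ^ 2) : MemLp F 2 := by
  obtain ⟨G, hG, hGF⟩ := exists_fc_eq (fc F) (fc_neg F) h
  exact hG.ae_eq (ae_eq_of_fc_eq (hG.integrable (by norm_num)) hF hGF)

/-! ### Decay of the Fourier blocks of Besov and Sobolev functions. -/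

theorem sum_sq_fc_le_integral {F : UnitAddCircle → ℝ} (hF : MemLp F 2) (S : Finset ℤ) :
    ∑ l ∈ S, ‖fc F l‖ ^ 2 ≤ ∫ x, F x ^ 2 :=
  sum_le_hasSum S (fun _ _ => by positivity) (hasSum_fc_sq hF)

/-- Split `F` by truncation at height `t`. The bounded part is handled by Bessel's inequality, the
remainder by the `L¹` bound on each of at most `N` coefficients. -/
theorem sum_sq_fc_le_rpow {F : UnitAddCircle → ℝ} (hF : Integrable F) {q A N : ℝ} (hq1 : 1 ≤ q)
    (hq2 : q ≤ 2) (hI : Integrable fun x => |F x| ^ q) (hA : 0 < A)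
    (hFA : ∫ x, |F x| ^ q ≤ A ^ q) (S : Finset ℤ) (hN : 0 < N) (hS : (S.card : ℝ) ≤ N) :
    ∑ l ∈ S, ‖fc F l‖ ^ 2 ≤ 4 * N ^ (2 / q - 1) * A ^ 2 := by
  have hq0 : 0 < q := by linarith
  -- This height balances the two contributions: both become multiples of `t² / N`.
  set t : ℝ := N ^ (1 / q) * A with ht
  have ht0 : 0 < t := by positivity
  let F₁ : UnitAddCircle → ℝ := fun x => max (-t) (min (F x) t)
  have hF₁m : AEStronglyMeasurable F₁ :=
    (continuous_const.max (continuous_id.min continuous_const)).comp_aestronglyMeasurable hF.1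
  have hF₁t : ∀ x, |F₁ x| ≤ t := fun x => abs_le.2
    ⟨le_max_left _ _, max_le (by linarith) (min_le_right _ _)⟩
  have hF₁L : ∀ p, MemLp F₁ p := fun p =>
    MemLp.of_bound hF₁m t (Eventually.of_forall fun x => hF₁t x)
  have hF₁i : Integrable F₁ := (hF₁L 1).integrable le_rfl
  have hF₁F : ∀ x, |F₁ x| ≤ |F x| := by
    intro x
    simp only [F₁]
    rcases le_total (F x) t with h | h
    · rw [min_eq_left h]
      rcases le_total (-t) (F x) with h' | h'
      · rw [max_eq_right h']
      · rw [max_eq_left h', abs_of_neg (by linarith), abs_of_neg (by linarith)]; linarith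
    · rw [min_eq_right h, max_eq_right (by linarith), abs_of_pos ht0, abs_of_pos (by linarith)]
      exact h
  have h1 : ∫ x, F₁ x ^ 2 ≤ t ^ (2 - q) * A ^ q := by
    refine le_trans ?_ (mul_le_mul_of_nonneg_left hFA (by positivity))
    rw [← integral_const_mul]
    refine integral_mono (hF₁L 2).integrable_sq (hI.const_mul _) fun x => ?_
    dsimp only
    rw [← sq_abs, ← Real.rpow_natCast, show ((2 : ℕ) : ℝ) = (2 - q) + q by push_cast; ring,
      Real.rpow_add_of_nonneg (abs_nonneg _) (by linarith) hq0.le]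
    exact mul_le_mul (Real.rpow_le_rpow (abs_nonneg _) (hF₁t x) (by linarith))
      (Real.rpow_le_rpow (abs_nonneg _) (hF₁F x) hq0.le) (by positivity) (by positivity)
  have h2 : ∫ x, |F x - F₁ x| ≤ t ^ (1 - q) * A ^ q := by
    refine le_trans ?_ (mul_le_mul_of_nonneg_left hFA (by positivity))
    rw [← integral_const_mul]
    refine integral_mono (hF.sub hF₁i).abs (hI.const_mul _) fun x => ?_
    dsimp only
    rcases le_or_gt |F x| t with h | h
    · obtain ⟨h', h''⟩ := abs_le.1 h
      have : F₁ x = F x := by simp only [F₁]; rw [min_eq_left h'', max_eq_right h']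
      rw [this, sub_self, abs_zero]; positivity
    · have h3 : |F x - F₁ x| ≤ |F x| := by
        simp only [F₁]
        rcases lt_abs.1 h with h' | h'
        · rw [min_eq_right h'.le, max_eq_right (by linarith), abs_of_pos (by linarith),
            abs_of_pos (by linarith)]; linarith
        · rw [min_eq_left (by linarith), max_eq_left (by linarith), abs_of_neg (by linarith),
            abs_of_neg (by linarith)]; linarith
      refine h3.trans ?_
      have hpos : 0 < |F x| := ht0.trans h
      calc |F x| = |F x| ^ (1 - q) * |F x| ^ q := by
            rw [← Real.rpow_add hpos]; simp
        _ ≤ _ := mul_le_mul_of_nonneg_right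
            (Real.rpow_le_rpow_of_nonpos ht0 h.le (by linarith)) (by positivity)
  have h3 : ∀ l, ‖fc F l‖ ^ 2 ≤ 2 * ‖fc F₁ l‖ ^ 2 + 2 * (t ^ (1 - q) * A ^ q) ^ 2 := by
    intro l
    have h4 : fc F l = fc F₁ l + fc (fun x => F x - F₁ x) l := by
      rw [fc_sub hF hF₁i]; ring
    have h5 := (norm_fc_le (fun x => F x - F₁ x) l).trans h2
    have h6 : ‖fc F l‖ ≤ ‖fc F₁ l‖ + t ^ (1 - q) * A ^ q := by
      rw [h4]; exact (norm_add_le _ _).trans (by gcongr)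
    calc ‖fc F l‖ ^ 2 ≤ (‖fc F₁ l‖ + t ^ (1 - q) * A ^ q) ^ 2 := by gcongr
      _ ≤ _ := by nlinarith [sq_nonneg (‖fc F₁ l‖ - t ^ (1 - q) * A ^ q)]
  have hNq : t ^ q = N * A ^ q := by
    rw [ht, Real.mul_rpow (by positivity) hA.le, ← Real.rpow_mul hN.le, one_div_mul_cancel hq0.ne',
      Real.rpow_one]
  have hAq : A ^ q = t ^ q * N⁻¹ := by rw [hNq]; field_simp
  have ht2 : t ^ 2 * N⁻¹ = N ^ (2 / q - 1) * A ^ 2 := by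
    rw [ht, mul_pow, ← Real.rpow_natCast (N ^ (1 / q)), ← Real.rpow_mul hN.le, Real.rpow_sub hN,
      Real.rpow_one]
    push_cast; rw [one_div_mul_eq_div]; ring
  have e1 : t ^ (2 - q) * A ^ q = t ^ 2 * N⁻¹ := by
    rw [hAq, ← mul_assoc, ← Real.rpow_add ht0, sub_add_cancel, Real.rpow_ofNat]
  have e2 : t ^ (1 - q) * A ^ q = t * N⁻¹ := by
    rw [hAq, ← mul_assoc, ← Real.rpow_add ht0, sub_add_cancel, Real.rpow_one]
  calc ∑ l ∈ S, ‖fc F l‖ ^ 2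
      ≤ ∑ l ∈ S, (2 * ‖fc F₁ l‖ ^ 2 + 2 * (t ^ (1 - q) * A ^ q) ^ 2) :=
        Finset.sum_le_sum fun l _ => h3 l
    _ = 2 * ∑ l ∈ S, ‖fc F₁ l‖ ^ 2 + S.card * (2 * (t * N⁻¹) ^ 2) := by
        rw [Finset.sum_add_distrib, ← Finset.mul_sum, Finset.sum_const, nsmul_eq_mul, e2]
    _ ≤ 2 * (t ^ 2 * N⁻¹) + N * (2 * (t * N⁻¹) ^ 2) := by
        have := (sum_sq_fc_le_integral (hF₁L 2) S).trans (h1.trans_eq e1)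
        gcongr
    _ = 4 * N ^ (2 / q - 1) * A ^ 2 := by
        rw [mul_assoc 4, ← ht2]; field_simp; ring

/-- On a probability space exponents above 2 may be lowered to 2, which is why only the positive
part of `1/p - 1/2` appears. -/
theorem sum_sq_fc_le {p : ℝ≥0∞} (hp : 1 ≤ p) {F : UnitAddCircle → ℝ}
    (hF : AEStronglyMeasurable F) {A N : ℝ} (hA : 0 < A) (hFA : eLpNorm F p ≤ ENNReal.ofReal A)
    (S : Finset ℤ) (hN : 0 < N) (hS : (S.card : ℝ) ≤ N) :
    ∑ l ∈ S, ‖fc F l‖ ^ 2 ≤ 4 * N ^ (2 * excess p) * A ^ 2 := by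
  set q : ℝ≥0∞ := min p 2 with hq
  have hq1 : 1 ≤ q := le_min hp (by norm_num)
  have hq2 : q ≤ 2 := min_le_right _ _
  have hqt : q ≠ ∞ := (hq2.trans_lt (by norm_num)).ne
  have hq1' : 1 ≤ q.toReal := by
    simpa using ENNReal.toReal_mono hqt hq1
  have hq2' : q.toReal ≤ 2 := by
    simpa using ENNReal.toReal_mono (by norm_num) hq2
  have hFq : eLpNorm F q ≤ ENNReal.ofReal A :=
    (eLpNorm_le_eLpNorm_of_exponent_le (min_le_left _ _) hF).trans hFA
  have hmem : MemLp F q := ⟨hF, hFq.trans_lt ENNReal.ofReal_lt_top⟩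
  have hq0 : q ≠ 0 := (zero_lt_one.trans_le hq1).ne'
  have hint := hmem.integrable_norm_rpow hq0 hqt
  have he : 2 / q.toReal - 1 = 2 * excess p := by
    rcases le_total p 2 with h | h
    · have hqp : q = p := min_eq_left h
      rw [hqp] at hq1' hq2' ⊢
      rw [excess, max_eq_left, ENNReal.toReal_inv]
      · ring
      · rw [ENNReal.toReal_inv, sub_nonneg, one_div]
        exact inv_anti₀ (by linarith) hq2'
    · have hqp : q = 2 := min_eq_right h
      rw [hqp, excess, max_eq_right]
      · norm_num
      · have : (p⁻¹).toReal ≤ ((2 : ℝ≥0∞)⁻¹).toReal :=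
          ENNReal.toReal_mono (by norm_num) (ENNReal.inv_le_inv.2 h)
        rw [ENNReal.toReal_inv] at this
        norm_num at this ⊢
        linarith
  rw [← he]
  refine sum_sq_fc_le_rpow (hmem.integrable hq1) hq1' hq2' hint hA ?_ S hN hS
  rw [hmem.eLpNorm_eq_integral_rpow_norm hq0 hqt, ENNReal.ofReal_le_ofReal_iff hA.le] at hFq
  have h0 : 0 ≤ ∫ x, |F x| ^ q.toReal := integral_nonneg fun x => by positivity
  have := Real.rpow_le_rpow (by positivity) hFq (by linarith : 0 ≤ q.toReal)
  simp only [Real.norm_eq_abs] at this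
  rwa [← Real.rpow_mul h0, inv_mul_cancel₀ (by linarith), Real.rpow_one] at this

/-- The frequencies `l` with `m ^ j ≤ |l| < m ^ (j + 1)`. -/
def block (m j : ℕ) : Finset ℤ :=
  (Finset.Ioo (-(m : ℤ) ^ (j + 1)) ((m : ℤ) ^ (j + 1))).filter fun l => (m : ℤ) ^ j ≤ |l|

theorem mem_block {m j : ℕ} {l : ℤ} :
    l ∈ block m j ↔ (m : ℤ) ^ j ≤ |l| ∧ |l| < (m : ℤ) ^ (j + 1) := by
  rw [block, Finset.mem_filter, Finset.mem_Ioo, ← abs_lt, and_comm]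

theorem neg_mem_block {m j : ℕ} {l : ℤ} : -l ∈ block m j ↔ l ∈ block m j := by
  simp [mem_block]

theorem le_of_mem_block {m j : ℕ} {l : ℤ} (h : l ∈ block m j) : (m : ℝ) ^ j ≤ |(l : ℝ)| := by
  exact_mod_cast (mem_block.1 h).1

theorem lt_of_mem_block {m j : ℕ} {l : ℤ} (h : l ∈ block m j) :
    |(l : ℝ)| < (m : ℝ) ^ (j + 1) := by
  exact_mod_cast (mem_block.1 h).2

theorem card_block_le (m j : ℕ) : ((block m j).card : ℝ) ≤ 2 * m * (m : ℝ) ^ j := by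
  have h1 : (block m j).card ≤ _ := Finset.card_filter_le _ _
  rw [Int.card_Ioo] at h1
  have h2 : ((block m j).card : ℤ) ≤ 2 * m * (m : ℤ) ^ j := by
    rw [pow_succ] at h1
    have : (0 : ℤ) ≤ (m : ℤ) ^ j * m := by positivity
    have h3 : (2 : ℤ) * m * (m : ℤ) ^ j = 2 * ((m : ℤ) ^ j * m) := by ring
    omega
  exact_mod_cast h2

/-- A common frame for three choices of `F`: an iterated difference of `f`, a derivative of `f`, and
a difference of a derivative. Here `α` measures the smallness of `F` in `L^p` and `β` the growth of
its multiplier on the block. -/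
theorem block_bound_of_multiplier {m : ℕ} (hm : 2 ≤ m) {p : ℝ≥0∞} (hp : 1 ≤ p)
    {f : UnitAddCircle → ℝ} {α β A c : ℝ} (hA : 0 < A) (hc : 0 < c)
    (h : ∀ j : ℕ, ∃ F : UnitAddCircle → ℝ, AEStronglyMeasurable F ∧
      eLpNorm F p ≤ ENNReal.ofReal (A * ((m : ℝ) ^ j) ^ (-α)) ∧
      ∀ l ∈ block m j, c * ((m : ℝ) ^ j) ^ β * ‖fc f l‖ ≤ ‖fc F l‖) :
    ∃ C : ℝ, 0 < C ∧ ∀ j, ∑ l ∈ block m j, ‖fc f l‖ ^ 2 ≤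
      C * ((m : ℝ) ^ j) ^ (-(2 * (α + β - excess p))) := by
  have hm0 : (0 : ℝ) < m := by exact_mod_cast (by omega : 0 < m)
  refine ⟨4 * (2 * m) ^ (2 * excess p) * A ^ 2 / c ^ 2, by positivity, fun j => ?_⟩
  obtain ⟨F, hF, hFA, hl⟩ := h j
  set N : ℝ := (m : ℝ) ^ j with hNdef
  have hN : 0 < N := by positivity
  have h1 := sum_sq_fc_le hp hF (by positivity) hFA (block m j) (by positivity : 0 < 2 * m * N)
    (card_block_le m j)
  have h2 : (c * N ^ β) ^ 2 * ∑ l ∈ block m j, ‖fc f l‖ ^ 2 ≤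
      4 * (2 * m * N) ^ (2 * excess p) * (A * N ^ (-α)) ^ 2 := by
    refine le_trans ?_ h1
    rw [Finset.mul_sum]
    refine Finset.sum_le_sum fun l hlb => ?_
    rw [← mul_pow]
    exact pow_le_pow_left₀ (by positivity) (hl l hlb) 2
  have h3 : 0 < (c * N ^ β) ^ 2 := by positivity
  rw [← le_div_iff₀' h3] at h2
  refine h2.trans_eq ?_
  rw [Real.mul_rpow (by positivity) hN.le, mul_pow, mul_pow,
    show -(2 * (α + β - excess p)) = 2 * excess p + (-α) + (-α) - β - β by ring,
    Real.rpow_sub hN, Real.rpow_sub hN, Real.rpow_add hN, Real.rpow_add hN]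
  field_simp

theorem exists_real_rep (h : UnitAddCircle) : ∃ x : ℝ, (x : UnitAddCircle) = h ∧ |x| = ‖h‖ := by
  induction h using QuotientAddGroup.induction_on with
  | H y =>
    refine ⟨y - round y, ?_, (UnitAddCircle.norm_eq).symm⟩
    have h1 : ((round y : ℝ) : UnitAddCircle) = 0 :=
      (AddCircle.coe_eq_zero_iff 1).2 ⟨round y, by simp⟩
    rw [AddCircle.coe_sub, h1, sub_zero]

theorem le_norm_fourier_sub_one (l : ℤ) (h : UnitAddCircle) (hl : |(l : ℝ)| * ‖h‖ ≤ 1 / 2) :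
    4 * (|(l : ℝ)| * ‖h‖) ≤ ‖(fourier l h : ℂ) - 1‖ := by
  obtain ⟨x, rfl, hx⟩ := exists_real_rep h
  rw [← hx, ← abs_mul] at hl ⊢
  have h1 : (fourier l (x : UnitAddCircle) : ℂ) =
      Complex.exp (Complex.I * ((2 * π * (l * x) : ℝ) : ℂ)) := by
    rw [fourier_coe_apply]; congr 1; push_cast; ring
  rw [h1, Complex.norm_exp_I_mul_ofReal_sub_one, norm_mul, Real.norm_eq_abs, Real.norm_eq_abs,
    abs_two, show 2 * π * (l * x) / 2 = π * (l * x) by ring]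
  have h2 : |Real.sin (π * (l * x))| = Real.sin (π * |l * x|) := by
    rw [Real.abs_sin_eq_sin_abs_of_abs_le_pi, abs_mul, abs_of_pos Real.pi_pos]
    rw [abs_mul, abs_of_pos Real.pi_pos]
    nlinarith [Real.pi_pos]
  have h3 := Real.mul_le_sin (x := π * |l * x|) (by positivity) (by nlinarith [Real.pi_pos])
  rw [h2]
  have h4 : 2 / π * (π * |l * x|) = 2 * |l * x| := by field_simp
  linarith

/-- Shifts of this size keep `|l| ‖h‖` between `1/(4m)` and `1/2` throughout the block, so the
difference multiplier stays away from its zeros. -/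
theorem inv_le_norm_fourier_sub_one {m : ℕ} (hm : 2 ≤ m) {j : ℕ} {l : ℤ} (hl : l ∈ block m j)
    {h : UnitAddCircle} (h1 : 1 / (4 * m * (m : ℝ) ^ j) ≤ ‖h‖)
    (h2 : ‖h‖ ≤ 2 * (1 / (4 * m * (m : ℝ) ^ j))) :
    (m : ℝ)⁻¹ ≤ ‖(fourier l h : ℂ) - 1‖ := by
  have hm0 : (0 : ℝ) < m := by exact_mod_cast (by omega : 0 < m)
  have hl1 := le_of_mem_block hl
  have hl2 := (lt_of_mem_block hl).le
  refine le_trans ?_ (le_norm_fourier_sub_one l h ?_)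
  · calc (m : ℝ)⁻¹ = 4 * ((m : ℝ) ^ j * (1 / (4 * m * (m : ℝ) ^ j))) := by field_simp
      _ ≤ _ := by gcongr
  · calc |(l : ℝ)| * ‖h‖ ≤ (m : ℝ) ^ (j + 1) * (2 * (1 / (4 * m * (m : ℝ) ^ j))) := by gcongr
      _ = 1 / 2 := by rw [pow_succ]; field_simp; norm_num

theorem integrable_translate {F : UnitAddCircle → ℝ} (hF : Integrable F) (h : UnitAddCircle) :
    Integrable fun x => F (x + h) :=
  hF.comp_add_right h

theorem integrable_fwdDiff_iterate {F : UnitAddCircle → ℝ} (hF : Integrable F)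
    (h : UnitAddCircle) (ρ : ℕ) : Integrable ((fwdDiff h)^[ρ] F) := by
  induction ρ with
  | zero => simpa
  | succ ρ ih =>
    rw [Function.iterate_succ_apply']
    exact (integrable_translate ih h).sub ih

theorem fc_fwdDiff_iterate {F : UnitAddCircle → ℝ} (hF : Integrable F)
    (h : UnitAddCircle) (ρ : ℕ) (l : ℤ) :
    fc ((fwdDiff h)^[ρ] F) l = (fourier l h - 1) ^ ρ * fc F l := by
  induction ρ with
  | zero => simp
  | succ ρ ih =>
    rw [Function.iterate_succ_apply']
    have hi := integrable_fwdDiff_iterate hF h ρ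
    have := fc_sub (integrable_translate hi h) hi l
    rw [fc_translate, ih] at this
    rw [pow_succ', mul_assoc, sub_mul, one_mul, ← this]
    rfl

theorem modulus_mono (ρ : ℕ) (p : ℝ≥0∞) (f : UnitAddCircle → ℝ) {t t' : ℝ} (h : t ≤ t') :
    modulus ρ p f t ≤ modulus ρ p f t' :=
  iSup_mono fun _ => iSup_const_mono fun h' => h'.trans h

theorem eLpNorm_le_modulus (ρ : ℕ) (p : ℝ≥0∞) (f : UnitAddCircle → ℝ) {t : ℝ} (ht : 0 ≤ t) :
    eLpNorm ((fwdDiff (t : UnitAddCircle))^[ρ] f) p volume ≤ modulus ρ p f t :=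
  le_iSup₂_of_le t (abs_of_nonneg ht).le le_rfl

/-- Every Besov space embeds in the one with `p' = ∞`: the modulus is monotone, so its value at `t`
is controlled by its values on `(t, 2t)`, an interval of positive measure for `du/u`. -/
theorem exists_modulus_le {σ : ℝ} (hσ : 0 ≤ σ) {p p' : ℝ≥0∞} (hp' : 1 ≤ p') {ρ : ℕ}
    {f : UnitAddCircle → ℝ} (h : besovSeminorm σ p p' ρ f < ∞) :
    ∃ A : ℝ, 0 < A ∧ ∀ t, 0 < t → t ≤ 1 / 2 → modulus ρ p f t ≤ ENNReal.ofReal (A * t ^ σ) := by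
  obtain ⟨S, hS, hSt⟩ : ∃ S : ℝ≥0∞, S < ∞ ∧ ∀ t : ℝ, 0 < t → t ≤ 1 / 2 →
      ENNReal.ofReal ((2 * t) ^ (-σ)) * modulus ρ p f t ≤ S := by
    have key : ∀ t u : ℝ, 0 < t → u ∈ Set.Ioo t (2 * t) →
        ENNReal.ofReal ((2 * t) ^ (-σ)) * modulus ρ p f t ≤
          ENNReal.ofReal (u ^ (-σ)) * modulus ρ p f u := fun t u ht hu =>
      mul_le_mul' (ENNReal.ofReal_le_ofReal (Real.rpow_le_rpow_of_nonpos (ht.trans hu.1) hu.2.le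
        (by linarith))) (modulus_mono _ _ _ hu.1.le)
    by_cases hp : p' = ∞
    · rw [besovSeminorm, if_pos hp] at h
      refine ⟨_, h, fun t ht _ => ?_⟩
      have h1 := ae_restrict_of_ae_restrict_of_subset (s := Set.Ioo t (2 * t))
        (fun u hu => ht.trans hu.1) (ENNReal.ae_le_essSup (μ := volume.restrict (Set.Ioi 0))
          fun t : ℝ => ENNReal.ofReal (t ^ (-σ)) * modulus ρ p f t)
      have h2 := h1.and (ae_restrict_mem measurableSet_Ioo)
      have : NeBot (ae (volume.restrict (Set.Ioo t (2 * t)))) := by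
        rw [ae_neBot, Ne, Measure.restrict_eq_zero, Real.volume_Ioo, ENNReal.ofReal_eq_zero]
        linarith
      obtain ⟨u, hu, hmem⟩ := h2.exists
      exact (key t u ht hmem).trans hu
    · rw [besovSeminorm, if_neg hp] at h
      have hq : 0 < p'.toReal := ENNReal.toReal_pos (zero_lt_one.trans_le hp').ne' hp
      set I := ∫⁻ t in Set.Ioo (0 : ℝ) 1,
        (ENNReal.ofReal (t ^ (-σ)) * modulus ρ p f t) ^ p'.toReal * ENNReal.ofReal (1 / t) with hI
      have hIfin : I < ∞ := (ENNReal.rpow_lt_top_iff_of_pos (by positivity)).1 h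
      refine ⟨(2 * I) ^ (1 / p'.toReal),
        (ENNReal.rpow_lt_top_iff_of_pos (by positivity)).2 (ENNReal.mul_lt_top (by simp) hIfin),
        fun t ht ht2 => ?_⟩
      set X := ENNReal.ofReal ((2 * t) ^ (-σ)) * modulus ρ p f t
      have h1 : X ^ p'.toReal * ENNReal.ofReal (1 / (2 * t)) * ENNReal.ofReal t ≤ I := by
        calc X ^ p'.toReal * ENNReal.ofReal (1 / (2 * t)) * ENNReal.ofReal t
            = ∫⁻ _ in Set.Ioo t (2 * t), X ^ p'.toReal * ENNReal.ofReal (1 / (2 * t)) := by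
              rw [setLIntegral_const, Real.volume_Ioo]; congr 2; ring
          _ ≤ ∫⁻ u in Set.Ioo t (2 * t), (ENNReal.ofReal (u ^ (-σ)) * modulus ρ p f u) ^ p'.toReal *
                ENNReal.ofReal (1 / u) := by
              refine setLIntegral_mono' measurableSet_Ioo fun u hu => mul_le_mul' ?_ ?_
              · exact ENNReal.rpow_le_rpow (key t u ht hu) hq.le
              · exact ENNReal.ofReal_le_ofReal (one_div_le_one_div_of_le (ht.trans hu.1) hu.2.le)
          _ ≤ I := lintegral_mono_set fun u hu => ⟨ht.trans hu.1, by linarith [hu.2]⟩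
      rw [mul_assoc, ← ENNReal.ofReal_mul (by positivity),
        show 1 / (2 * t) * t = 2⁻¹ by field_simp, ENNReal.ofReal_inv_of_pos (by norm_num),
        ← div_eq_mul_inv, ENNReal.div_le_iff (by simp) (by simp)] at h1
      rw [one_div, ENNReal.le_rpow_inv_iff hq]
      simpa [mul_comm] using h1
  refine ⟨2 ^ σ * (S.toReal + 1), by positivity, fun t ht ht2 => ?_⟩
  have h2 := hSt t ht ht2
  have hpos : 0 < (2 * t) ^ (-σ) := by positivity
  rw [mul_comm, ← ENNReal.le_div_iff_mul_le (Or.inl (ENNReal.ofReal_pos.2 hpos).ne')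
    (Or.inl ENNReal.ofReal_ne_top)] at h2
  refine h2.trans ?_
  rw [← ENNReal.ofReal_toReal hS.ne, ← ENNReal.ofReal_div_of_pos hpos]
  refine ENNReal.ofReal_le_ofReal ?_
  rw [Real.rpow_neg (by positivity), div_inv_eq_mul, Real.mul_rpow (by norm_num) ht.le,
    ENNReal.toReal_ofReal ENNReal.toReal_nonneg]
  nlinarith [(by positivity : 0 < 2 ^ σ * t ^ σ)]

/-- The Slobodeckij seminorm controls differences only on average over the shift. Restricting to a
shell of shifts of size about `η` and averaging yields one good shift. The exponent is lowered to
`min p 2` so that the average is an integral even for `p = ∞`. -/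
theorem eLpNorm_exists_translate_le {p : ℝ≥0∞} (hp : 1 ≤ p) {θ : ℝ} (hθ : 0 ≤ θ)
    {g : UnitAddCircle → ℝ} (hg : Measurable g) (hS : slobodeckij θ p g < ∞) :
    ∃ A : ℝ, 0 < A ∧ ∀ η, 0 < η → η ≤ 1 / 4 → ∃ h : UnitAddCircle, η ≤ ‖h‖ ∧ ‖h‖ ≤ 2 * η ∧
      eLpNorm (fun x => g (x + h) - g x) (min p 2) ≤ ENNReal.ofReal (A * η ^ θ) := by
  set q : ℝ≥0∞ := min p 2 with hq
  have hq1 : 1 ≤ q := le_min hp (by norm_num)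
  have hqt : q ≠ ∞ := ((min_le_right p 2).trans_lt (by norm_num)).ne
  have hq0 : q ≠ 0 := (zero_lt_one.trans_le hq1).ne'
  have hqr : 0 < q.toReal := ENNReal.toReal_pos hq0 hqt
  set κ : ℝ := θ + (p⁻¹).toReal with hκ
  have hκ0 : 0 ≤ κ := by positivity
  set S := slobodeckij θ p g with hSdef
  let D : UnitAddCircle × UnitAddCircle → ℝ := fun z => g (z.1 + z.2) - g z.2
  let Ψ : UnitAddCircle × UnitAddCircle → ℝ := fun z => D z / ‖z.1‖ ^ κ
  have hD : Measurable D := (hg.comp measurable_add).sub (hg.comp measurable_snd)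
  have hΨS : eLpNorm Ψ p (volume.prod volume) = S := by
    have hmeas : Measurable fun z : UnitAddCircle × UnitAddCircle =>
        (g z.1 - g z.2) / ‖z.1 - z.2‖ ^ κ :=
      ((hg.comp measurable_fst).sub (hg.comp measurable_snd)).div
        ((measurable_norm.comp measurable_sub).pow_const κ)
    rw [hSdef, slobodeckij, ← eLpNorm_comp_measurePreserving hmeas.aestronglyMeasurable
      (measurePreserving_add_prod (volume : Measure UnitAddCircle) volume)]
    congr 1; funext z
    simp only [Function.comp, Ψ, D, add_sub_cancel_right]
  refine ⟨2 ^ θ * (S.toReal + 1), by positivity, fun η hη hη4 => ?_⟩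
  set H : Set UnitAddCircle := Metric.closedBall 0 (2 * η) \ Metric.closedBall 0 η with hH
  have hHm : MeasurableSet H := Metric.isClosed_closedBall.measurableSet.diff
    Metric.isClosed_closedBall.measurableSet
  have hHvol : volume H = ENNReal.ofReal (2 * η) := by
    rw [hH, measure_sdiff (Metric.closedBall_subset_closedBall (by linarith))
      Metric.isClosed_closedBall.measurableSet.nullMeasurableSet (measure_ne_top _ _),
      AddCircle.volume_closedBall, AddCircle.volume_closedBall, min_eq_right (by linarith),
      min_eq_right (by linarith), ← ENNReal.ofReal_sub _ (by linarith)]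
    congr 1; ring
  have hmemH : ∀ h ∈ H, η ≤ ‖h‖ ∧ ‖h‖ ≤ 2 * η := by
    intro h hh
    simp only [hH, Set.mem_sdiff, mem_closedBall_zero_iff, not_le] at hh
    exact ⟨hh.2.le, hh.1⟩
  have h2η : 0 < 2 * η := by positivity
  set ν : Measure (UnitAddCircle × UnitAddCircle) := (volume.restrict H).prod volume with hν
  have hνuniv : ν Set.univ = ENNReal.ofReal (2 * η) := by
    rw [hν, ← Set.univ_prod_univ, Measure.prod_prod, Measure.restrict_apply_univ, hHvol]; simp
  have hνle : ν ≤ volume.prod volume := by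
    rw [hν, Measure.restrict_prod_eq_prod_univ]; exact Measure.restrict_le_self
  have hνmem : ∀ᵐ z ∂ν, z.1 ∈ H := by
    rw [hν, Measure.restrict_prod_eq_prod_univ]
    filter_upwards [ae_restrict_mem (hHm.prod MeasurableSet.univ)] with z hz using hz.1
  have h1 : eLpNorm D p ν ≤ ENNReal.ofReal ((2 * η) ^ κ) * S := by
    rw [← hΨS]
    refine (eLpNorm_le_mul_eLpNorm_of_ae_le_mul ?_ p).trans
      (mul_le_mul_right (eLpNorm_mono_measure _ hνle) _)
    filter_upwards [hνmem] with z hz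
    obtain ⟨hz1, hz2⟩ := hmemH _ hz
    have hz0 : 0 < ‖z.1‖ := hη.trans_le hz1
    have hzκ : 0 < ‖z.1‖ ^ κ := by positivity
    simp only [Ψ, norm_div, Real.norm_of_nonneg hzκ.le]
    rw [mul_div_assoc', le_div_iff₀ hzκ, mul_comm]
    gcongr
  -- Lowering the exponent on a measure of mass `2η` costs `(2η)^(1/q - 1/p)`, which replaces the
  -- `1/p` in `κ` by `1/q`. Averaging over the shell later removes that factor.
  have h2 : eLpNorm D q ν ≤ ENNReal.ofReal ((2 * η) ^ (θ + 1 / q.toReal)) * S := by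
    refine (eLpNorm_le_eLpNorm_mul_rpow_measure_univ (min_le_left p 2)
      hD.aestronglyMeasurable).trans ?_
    rw [hνuniv]
    refine (mul_le_mul_left h1 _).trans_eq ?_
    rw [ENNReal.ofReal_rpow_of_pos h2η, mul_right_comm, ← ENNReal.ofReal_mul (by positivity),
      ← Real.rpow_add h2η]
    congr 3
    rw [hκ, ENNReal.toReal_inv, one_div p.toReal]; ring
  let I : UnitAddCircle → ℝ≥0∞ := fun h => ∫⁻ y, ‖D (h, y)‖ₑ ^ q.toReal
  have hDq : Measurable fun z => ‖D z‖ₑ ^ q.toReal := hD.enorm.pow_const _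
  have h3 : ∫⁻ h in H, I h = eLpNorm D q ν ^ q.toReal := by
    rw [eLpNorm_eq_lintegral_rpow_enorm_toReal hq0 hqt, ← ENNReal.rpow_mul,
      one_div_mul_cancel hqr.ne', ENNReal.rpow_one, hν, lintegral_prod _ hDq.aemeasurable]
  obtain ⟨h, hhH, hh⟩ := exists_le_setLAverage (μ := volume) (s := H) (f := I)
    (by rw [hHvol]; simpa using hη) (measure_ne_top _ _)
    (hDq.lintegral_prod_right').aemeasurable
  refine ⟨h, (hmemH h hhH).1, (hmemH h hhH).2, ?_⟩
  have h4 : eLpNorm (fun x => g (x + h) - g x) q volume = I h ^ (1 / q.toReal) := by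
    rw [eLpNorm_eq_lintegral_rpow_enorm_toReal hq0 hqt]
    simp only [I, D, add_comm h]
  rw [setLAverage_eq, h3, hHvol] at hh
  rw [h4]
  calc I h ^ (1 / q.toReal)
      ≤ (eLpNorm D q ν ^ q.toReal / ENNReal.ofReal (2 * η)) ^ (1 / q.toReal) := by gcongr
    _ = eLpNorm D q ν / ENNReal.ofReal ((2 * η) ^ (1 / q.toReal)) := by
        rw [ENNReal.div_rpow_of_nonneg _ _ (by positivity), ← ENNReal.rpow_mul,
          mul_one_div_cancel hqr.ne', ENNReal.rpow_one, ENNReal.ofReal_rpow_of_pos h2η]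
    _ ≤ ENNReal.ofReal ((2 * η) ^ (θ + 1 / q.toReal)) * S /
          ENNReal.ofReal ((2 * η) ^ (1 / q.toReal)) := by gcongr
    _ = ENNReal.ofReal ((2 * η) ^ θ * S.toReal) := by
        rw [← ENNReal.ofReal_toReal hS.ne, ← ENNReal.ofReal_mul (by positivity),
          ← ENNReal.ofReal_div_of_pos (by positivity), Real.rpow_add h2η]
        congr 1
        rw [ENNReal.toReal_ofReal ENNReal.toReal_nonneg]
        field_simp
    _ ≤ _ := by
        refine ENNReal.ofReal_le_ofReal ?_
        rw [Real.mul_rpow (by norm_num) hη.le]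
        nlinarith [(by positivity : 0 < 2 ^ θ * η ^ θ)]

theorem MemBesov.block_bound {m : ℕ} (hm : 2 ≤ m) {σ : ℝ} (hσ : 0 ≤ σ) {p p' : ℝ≥0∞} (hp : 1 ≤ p)
    (hp' : 1 ≤ p') {f : UnitAddCircle → ℝ} (hf : MemBesov σ p p' f) :
    ∃ C : ℝ, 0 < C ∧ ∀ j, ∑ l ∈ block m j, ‖fc f l‖ ^ 2 ≤
      C * ((m : ℝ) ^ j) ^ (-(2 * (σ - excess p))) := by
  have hm0 : (0 : ℝ) < m := by exact_mod_cast (by omega : 0 < m)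
  have hm1 : (1 : ℝ) ≤ m := by exact_mod_cast (by omega : 1 ≤ m)
  obtain ⟨ρ, -, hρ⟩ := hf.seminorm
  obtain ⟨A, hA, hmod⟩ := exists_modulus_le hσ hp' hρ
  have hfi : Integrable f := hf.memLp.integrable hp
  have := block_bound_of_multiplier (m := m) hm hp (f := f) (α := σ) (β := 0)
    (A := A * (1 / (4 * m)) ^ σ) (c := ((m : ℝ)⁻¹) ^ ρ) (by positivity) (by positivity) fun j => ?_
  · simpa using this
  set N : ℝ := (m : ℝ) ^ j with hN
  have hN1 : 1 ≤ N := one_le_pow₀ hm1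
  set η : ℝ := 1 / (4 * m * N) with hη
  have hη0 : 0 < η := by positivity
  have hη1 : η ≤ 1 / 4 := by
    refine one_div_le_one_div_of_le (by norm_num) ?_
    nlinarith [mul_le_mul hm1 hN1 zero_le_one hm0.le]
  have hηn : ‖(η : UnitAddCircle)‖ = η := by
    rw [UnitAddCircle.norm_eq, show round η = 0 by rw [round_eq_zero_iff]; constructor <;> linarith]
    simp [abs_of_pos hη0]
  refine ⟨(fwdDiff (η : UnitAddCircle))^[ρ] f, (integrable_fwdDiff_iterate hfi _ _).1, ?_, ?_⟩
  · refine (eLpNorm_le_modulus ρ p f hη0.le).trans ((hmod η hη0 (by linarith)).trans_eq ?_)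
    congr 1
    rw [hη, ← div_div, Real.div_rpow (by positivity) (by positivity), Real.rpow_neg (by positivity)]
    ring
  · intro l hl
    rw [fc_fwdDiff_iterate hfi, norm_mul, norm_pow, Real.rpow_zero, mul_one]
    gcongr
    exact inv_le_norm_fourier_sub_one hm hl hηn.ge (by rw [hηn]; linarith)

/-- For integer `σ` the top derivative is itself the multiplier. Otherwise a translate of the
derivative of order `⌊σ⌋` is subtracted, supplying the fractional part of the decay. -/
theorem MemSobolev.block_bound {m : ℕ} (hm : 2 ≤ m) {σ : ℝ} (hσ : 0 ≤ σ) {p : ℝ≥0∞} (hp : 1 ≤ p)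
    {f : UnitAddCircle → ℝ} (hf : MemSobolev σ p f) :
    ∃ C : ℝ, 0 < C ∧ ∀ j, ∑ l ∈ block m j, ‖fc f l‖ ^ 2 ≤
      C * ((m : ℝ) ^ j) ^ (-(2 * (σ - excess p))) := by
  have hm0 : (0 : ℝ) < m := by exact_mod_cast (by omega : 0 < m)
  have hm1 : (1 : ℝ) ≤ m := by exact_mod_cast (by omega : 1 ≤ m)
  have hsymb : ∀ (i j : ℕ) (l : ℤ), l ∈ block m j →
      ((m : ℝ) ^ j) ^ (i : ℝ) ≤ ‖symb l ^ i‖ := by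
    intro i j l hl
    rw [norm_pow, Real.rpow_natCast, norm_symb]
    refine pow_le_pow_left₀ (by positivity) ((le_of_mem_block hl).trans ?_) i
    nlinarith [Real.pi_gt_three, abs_nonneg (l : ℝ)]
  by_cases hint : σ = (⌊σ⌋₊ : ℝ)
  · obtain ⟨g, hg, hgp⟩ := hf.floor.deriv ⌊σ⌋₊ le_rfl
    have := block_bound_of_multiplier (m := m) hm hp (f := f) (α := 0) (β := σ)
      (A := (eLpNorm g p volume).toReal + 1) (c := 1) (by positivity) (by positivity) fun j => ?_
    · simpa using this
    refine ⟨g, hgp.1, ?_, fun l hl => ?_⟩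
    · rw [neg_zero, Real.rpow_zero, mul_one]
      refine (ENNReal.ofReal_toReal hgp.2.ne).ge.trans (ENNReal.ofReal_le_ofReal (by linarith))
    · rw [hg.fc_eq, norm_mul, one_mul]
      gcongr
      rw [hint]
      simpa using hsymb ⌊σ⌋₊ j l hl
  · obtain ⟨g₀, hg₀, hg₀S⟩ := hf.frac hint
    set θ : ℝ := σ - (⌊σ⌋₊ : ℝ) with hθ
    have hθ0 : 0 ≤ θ := sub_nonneg.2 (Nat.floor_le hσ)
    -- A Borel representative is needed for Fubini and the change of variables on the product.
    set g := hg₀.integrable_deriv.1.mk g₀ with hgdef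
    have hgm : Measurable g := hg₀.integrable_deriv.1.stronglyMeasurable_mk.measurable
    have hge : g₀ =ᵐ[volume] g := hg₀.integrable_deriv.1.ae_eq_mk
    have hgS : slobodeckij θ p g < ∞ := by
      convert hg₀S using 1
      refine eLpNorm_congr_ae ?_
      filter_upwards [Measure.quasiMeasurePreserving_fst.ae hge,
        Measure.quasiMeasurePreserving_snd.ae hge] with z h1 h2
      rw [h1, h2]
    have hgi : Integrable g := hg₀.integrable_deriv.congr hge
    have hgfc : ∀ l, fc g l = symb l ^ ⌊σ⌋₊ * fc f l := fun l => by
      rw [← fc_congr_ae hge, hg₀.fc_eq]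
    obtain ⟨A, hA, hex⟩ := eLpNorm_exists_translate_le hp hθ0 hgm hgS
    have hq1 : 1 ≤ min p 2 := le_min hp (by norm_num)
    have := block_bound_of_multiplier (m := m) hm hq1 (f := f) (α := θ) (β := ⌊σ⌋₊)
      (A := A * (1 / (4 * m)) ^ θ) (c := (m : ℝ)⁻¹) (by positivity) (by positivity) fun j => ?_
    · have hexc : excess (min p 2) = excess p := by
        rcases le_total p 2 with h | h
        · rw [min_eq_left h]
        · rw [min_eq_right h, excess, excess, max_eq_right, max_eq_right]
          · have : (p⁻¹).toReal ≤ ((2 : ℝ≥0∞)⁻¹).toReal :=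
              ENNReal.toReal_mono (by norm_num) (ENNReal.inv_le_inv.2 h)
            norm_num at this ⊢
            linarith
          · norm_num
      simpa [hexc, hθ] using this
    set N : ℝ := (m : ℝ) ^ j with hN
    have hN1 : 1 ≤ N := one_le_pow₀ hm1
    set η : ℝ := 1 / (4 * m * N) with hη
    have hη0 : 0 < η := by positivity
    have hη1 : η ≤ 1 / 4 := by
      refine one_div_le_one_div_of_le (by norm_num) ?_
      nlinarith [mul_le_mul hm1 hN1 zero_le_one hm0.le]
    obtain ⟨h, h1, h2, h3⟩ := hex η hη0 hη1
    have hti := integrable_translate hgi h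
    refine ⟨fun x => g (x + h) - g x, (hti.sub hgi).1, h3.trans_eq ?_, fun l hl => ?_⟩
    · congr 1
      rw [hη, ← div_div, Real.div_rpow (by positivity) (by positivity),
        Real.rpow_neg (by positivity)]
      ring
    · rw [fc_sub hti hgi, fc_translate, ← sub_one_mul, norm_mul, hgfc, norm_mul, ← mul_assoc]
      gcongr
      · exact inv_le_norm_fourier_sub_one hm hl h1 h2
      · exact hsymb ⌊σ⌋₊ j l hl

/-! ### The multiresolution norm and averages over `m`-adic cells. -/

theorem abs_sum_gridIn_div_le (n : ℕ) (B : Set ℝ) (y : Fin n → ℝ) :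
    |∑ i ∈ gridIn n B, y i| / √((gridIn n B).card : ℝ) ≤ ∑ i, |y i| := by
  have h1 : |∑ i ∈ gridIn n B, y i| ≤ ∑ i, |y i| :=
    (Finset.abs_sum_le_sum_abs _ _).trans
      (Finset.sum_le_univ_sum_of_nonneg fun i => abs_nonneg _)
  rcases Nat.eq_zero_or_pos (gridIn n B).card with h | h
  · rw [h]; simpa using Finset.sum_nonneg fun i _ => abs_nonneg (y i)
  · refine (div_le_self (abs_nonneg _) ?_).trans h1
    rw [Real.one_le_sqrt]; exact_mod_cast h

theorem div_sqrt_le_mrNorm {𝓑 : Set (Set ℝ)} {B : Set ℝ} (hB : B ∈ 𝓑) (n : ℕ) (y : Fin n → ℝ) :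
    |∑ i ∈ gridIn n B, y i| / √((gridIn n B).card : ℝ) ≤ mrNorm 𝓑 n y :=
  le_ciSup (f := fun B : 𝓑 => |∑ i ∈ gridIn n B, y i| / √((gridIn n B).card : ℝ))
    ⟨∑ i, |y i|, by rintro _ ⟨B, rfl⟩; exact abs_sum_gridIn_div_le n B y⟩ ⟨B, hB⟩

theorem abs_sum_gridIn_le {𝓑 : Set (Set ℝ)} {B : Set ℝ} (hB : B ∈ 𝓑) {n : ℕ} {v : Fin n → ℝ}
    (hv : mrNorm 𝓑 n v ≤ 1) : |∑ i ∈ gridIn n B, v i| ≤ √((gridIn n B).card : ℝ) := by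
  have h := (div_sqrt_le_mrNorm hB n v).trans hv
  rcases Nat.eq_zero_or_pos (gridIn n B).card with h0 | h0
  · rw [Finset.card_eq_zero.1 h0]; simp
  · have : 0 < √((gridIn n B).card : ℝ) := Real.sqrt_pos.2 (by exact_mod_cast h0)
    rwa [div_le_one this] at h

theorem mrDualNorm_le_iff {𝓑 : Set (Set ℝ)} {n : ℕ} {ω : Fin n → ℝ} {a : ℝ} (ha : 0 ≤ a) :
    mrDualNorm 𝓑 n ω ≤ ENNReal.ofReal a ↔ ∀ v, mrNorm 𝓑 n v ≤ 1 → ∑ i, ω i * v i ≤ a := by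
  simp only [mrDualNorm, iSup_le_iff, ENNReal.ofReal_le_ofReal_iff ha]

/-- The index of the `m`-adic interval of level `j` that contains the grid point `i / n`. -/
def cell (m n j : ℕ) (i : Fin n) : ℕ := i * m ^ j / n

theorem cell_lt {m n j : ℕ} (hm : 0 < m) (i : Fin n) : cell m n j i < m ^ j := by
  have hn : 0 < n := i.pos
  rw [cell, Nat.div_lt_iff_lt_mul hn, mul_comm (m ^ j)]
  exact Nat.mul_lt_mul_of_pos_right i.2 (pow_pos hm j)

theorem cell_eq_iff {m n j ℓ : ℕ} (hm : 0 < m) (i : Fin n) :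
    cell m n j i = ℓ ↔
      (i : ℝ) / n ∈ Set.Ico ((ℓ : ℝ) / (m : ℝ) ^ j) (((ℓ : ℝ) + 1) / (m : ℝ) ^ j) := by
  have hn : 0 < n := i.pos
  have hn' : (0 : ℝ) < n := by exact_mod_cast hn
  have hM : (0 : ℝ) < (m : ℝ) ^ j := by positivity
  rw [cell, Set.mem_Ico, div_le_div_iff₀ hM hn', div_lt_div_iff₀ hn' hM, Nat.div_eq_iff hn]
  have h1 : (ℓ : ℝ) * n ≤ i * (m : ℝ) ^ j ↔ ℓ * n ≤ i * m ^ j := by norm_cast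
  have h2 : (i : ℝ) * (m : ℝ) ^ j < (ℓ + 1) * n ↔ i * m ^ j < (ℓ + 1) * n := by norm_cast
  rw [h1, h2, add_mul, one_mul]
  omega

theorem gridIn_eq {m : ℕ} (hm : 0 < m) (n j ℓ : ℕ) :
    gridIn n (Set.Ico ((ℓ : ℝ) / (m : ℝ) ^ j) (((ℓ : ℝ) + 1) / (m : ℝ) ^ j)) =
      Finset.univ.filter fun i => cell m n j i = ℓ := by
  ext i
  simp only [gridIn, Finset.mem_filter, Finset.mem_univ, true_and, cell_eq_iff hm]

theorem abs_sum_cell_le {m : ℕ} {𝓑 : Set (Set ℝ)} (h𝓑 : IsRegular m 𝓑) {n j ℓ : ℕ}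
    (hℓ : ℓ < m ^ j) {v : Fin n → ℝ} (hv : mrNorm 𝓑 n v ≤ 1) :
    |∑ i with cell m n j i = ℓ, v i| ≤
      √((Finset.univ.filter fun i : Fin n => cell m n j i = ℓ).card : ℝ) := by
  have hm : 0 < m := by have := h𝓑.two_le; omega
  simpa only [gridIn_eq hm] using abs_sum_gridIn_le (h𝓑.mem j ℓ hℓ) hv

/-- On each cell the sum of `v` is at most the root of its number of grid points. Cauchy–Schwarz
over the `m^j` cells then produces the factor `m^(j/2)`. -/
theorem sum_mul_le_of_cell {m : ℕ} {𝓑 : Set (Set ℝ)} (h𝓑 : IsRegular m 𝓑) {n : ℕ} (j : ℕ)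
    (ζ : ℕ → ℝ) {v : Fin n → ℝ} (hv : mrNorm 𝓑 n v ≤ 1) :
    ∑ i, ζ (cell m n j i) * v i ≤ √((m : ℝ) ^ j) * √(∑ i : Fin n, ζ (cell m n j i) ^ 2) := by
  have hm : 0 < m := by have := h𝓑.two_le; omega
  have hmaps : ∀ i ∈ (Finset.univ : Finset (Fin n)), cell m n j i ∈ Finset.range (m ^ j) :=
    fun i _ => Finset.mem_range.2 (cell_lt hm i)
  rw [← Finset.sum_fiberwise_of_maps_to hmaps, ← Finset.sum_fiberwise_of_maps_to hmaps]
  calc ∑ ℓ ∈ Finset.range (m ^ j), ∑ i with cell m n j i = ℓ, ζ (cell m n j i) * v i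
      ≤ ∑ ℓ ∈ Finset.range (m ^ j), 1 * (|ζ ℓ| *
          √((Finset.univ.filter fun i : Fin n => cell m n j i = ℓ).card : ℝ)) := by
        refine Finset.sum_le_sum fun ℓ hℓ => ?_
        have h1 : ∑ i with cell m n j i = ℓ, ζ (cell m n j i) * v i =
            ζ ℓ * ∑ i with cell m n j i = ℓ, v i := by
          rw [Finset.mul_sum]
          refine Finset.sum_congr rfl fun i hi => ?_
          rw [(Finset.mem_filter.1 hi).2]
        rw [h1, one_mul]
        refine (le_abs_self _).trans ?_
        rw [abs_mul]
        exact mul_le_mul_of_nonneg_left (abs_sum_cell_le h𝓑 (Finset.mem_range.1 hℓ) hv)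
          (abs_nonneg _)
    _ ≤ _ := by
        refine (Real.sum_mul_le_sqrt_mul_sqrt _ _ _).trans_eq ?_
        congr 2
        · simp
        · refine Finset.sum_congr rfl fun ℓ _ => ?_
          rw [mul_pow, sq_abs, Real.sq_sqrt (Nat.cast_nonneg _), mul_comm, ← nsmul_eq_mul,
            ← Finset.sum_const]
          refine Finset.sum_congr rfl fun i hi => ?_
          rw [(Finset.mem_filter.1 hi).2]

/-- The average of `y` over the grid points in the `m`-adic interval of level `j` and index `ℓ`. -/
def cellMean (m n j : ℕ) (y : Fin n → ℝ) (ℓ : ℕ) : ℝ :=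
  (∑ i with cell m n j i = ℓ, y i) / ((Finset.univ.filter fun i : Fin n => cell m n j i = ℓ).card : ℝ)

theorem sum_cell_sub_sq_eq {m n j : ℕ} (y : Fin n → ℝ) (ℓ : ℕ) (c : ℝ) :
    ∑ i with cell m n j i = ℓ, (y i - c) ^ 2 =
      (∑ i with cell m n j i = ℓ, (y i - cellMean m n j y ℓ) ^ 2) +
        ((Finset.univ.filter fun i : Fin n => cell m n j i = ℓ).card : ℝ) *
          (cellMean m n j y ℓ - c) ^ 2 := by
  set S := Finset.univ.filter fun i : Fin n => cell m n j i = ℓ with hS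
  -- On an empty cell the average is `0 / 0 = 0`, and both sides vanish.
  have h1 : (S.card : ℝ) * cellMean m n j y ℓ = ∑ i ∈ S, y i := by
    rcases Nat.eq_zero_or_pos S.card with h | h
    · rw [Finset.card_eq_zero.1 h]; simp
    · rw [cellMean, ← hS]; field_simp
  have h2 : ∀ c : ℝ, ∑ i ∈ S, (y i - c) ^ 2 =
      ∑ i ∈ S, y i ^ 2 - 2 * c * ∑ i ∈ S, y i + S.card * c ^ 2 := by
    intro c
    rw [← nsmul_eq_mul, ← Finset.sum_const, Finset.mul_sum, ← Finset.sum_sub_distrib,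
      ← Finset.sum_add_distrib]
    exact Finset.sum_congr rfl fun i _ => by ring
  rw [h2, h2, ← h1]; ring

theorem sum_sub_cellMean_sq_le {m n j : ℕ} (y : Fin n → ℝ) (c : ℕ → ℝ) :
    ∑ i, (y i - cellMean m n j y (cell m n j i)) ^ 2 ≤ ∑ i, (y i - c (cell m n j i)) ^ 2 := by
  have hmaps : ∀ i ∈ (Finset.univ : Finset (Fin n)),
      cell m n j i ∈ Finset.univ.image (cell m n j) := fun i hi => Finset.mem_image_of_mem _ hi
  rw [← Finset.sum_fiberwise_of_maps_to hmaps, ← Finset.sum_fiberwise_of_maps_to hmaps]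
  refine Finset.sum_le_sum fun ℓ _ => ?_
  have h1 : ∀ c : ℕ → ℝ, ∑ i with cell m n j i = ℓ, (y i - c (cell m n j i)) ^ 2 =
      ∑ i with cell m n j i = ℓ, (y i - c ℓ) ^ 2 := fun c =>
    Finset.sum_congr rfl fun i hi => by rw [(Finset.mem_filter.1 hi).2]
  rw [h1, h1, sum_cell_sub_sq_eq y ℓ (c ℓ)]
  have : 0 ≤ ((Finset.univ.filter fun i : Fin n => cell m n j i = ℓ).card : ℝ) *
          (cellMean m n j y ℓ - c ℓ) ^ 2 := by positivity
  linarith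

/-- Averaging is an orthogonal projection in `ℓ²`, hence a contraction after subtracting a cellwise
constant function. -/
theorem sum_cellMean_sub_sq_le {m n j : ℕ} (y : Fin n → ℝ) (c : ℕ → ℝ) :
    ∑ i, (cellMean m n j y (cell m n j i) - c (cell m n j i)) ^ 2 ≤
      ∑ i, (y i - c (cell m n j i)) ^ 2 := by
  have hmaps : ∀ i ∈ (Finset.univ : Finset (Fin n)),
      cell m n j i ∈ Finset.univ.image (cell m n j) := fun i hi => Finset.mem_image_of_mem _ hi
  rw [← Finset.sum_fiberwise_of_maps_to hmaps, ← Finset.sum_fiberwise_of_maps_to hmaps]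
  refine Finset.sum_le_sum fun ℓ _ => ?_
  have h1 : ∑ i with cell m n j i = ℓ, (y i - c (cell m n j i)) ^ 2 =
      ∑ i with cell m n j i = ℓ, (y i - c ℓ) ^ 2 :=
    Finset.sum_congr rfl fun i hi => by rw [(Finset.mem_filter.1 hi).2]
  have h2 : ∑ i with cell m n j i = ℓ,
      (cellMean m n j y (cell m n j i) - c (cell m n j i)) ^ 2 =
        ((Finset.univ.filter fun i : Fin n => cell m n j i = ℓ).card : ℝ) *
          (cellMean m n j y ℓ - c ℓ) ^ 2 := by
    rw [← nsmul_eq_mul, ← Finset.sum_const]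
    exact Finset.sum_congr rfl fun i hi => by rw [(Finset.mem_filter.1 hi).2]
  rw [h1, h2, sum_cell_sub_sq_eq y ℓ (c ℓ)]
  have : 0 ≤ ∑ i with cell m n j i = ℓ, (y i - cellMean m n j y ℓ) ^ 2 :=
    Finset.sum_nonneg fun _ _ => sq_nonneg _
  linarith

theorem cell_eq_cell_succ_div {m n j : ℕ} (hm : 0 < m) (i : Fin n) :
    cell m n j i = cell m n (j + 1) i / m := by
  rw [cell, cell, Nat.div_div_eq_div_mul, pow_succ, ← mul_assoc, Nat.mul_div_mul_right _ _ hm]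

theorem cell_injective {m n j : ℕ} (h : n ≤ m ^ j) : Function.Injective (cell m n j) := by
  intro i i' hii
  by_contra hne
  wlog hlt : i < i' generalizing i i'
  · exact this hii.symm (Ne.symm hne) (lt_of_le_of_ne (not_lt.1 hlt) (Ne.symm hne))
  have h1 : (i : ℕ) + 1 ≤ i' := hlt
  have h2 : (i : ℕ) * m ^ j + n ≤ i' * m ^ j := by nlinarith
  have h3 : cell m n j i + 1 ≤ cell m n j i' := by
    rw [cell, cell, ← Nat.add_div_right _ i.pos]
    exact Nat.div_le_div_right h2
  omega

theorem cellMean_eq_self {m n j : ℕ} (h : n ≤ m ^ j) (y : Fin n → ℝ) (i : Fin n) :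
    cellMean m n j y (cell m n j i) = y i := by
  have h1 : (Finset.univ.filter fun i' : Fin n => cell m n j i' = cell m n j i) = {i} := by
    ext i'; simp [(cell_injective h).eq_iff]
  rw [cellMean, h1]; simp

/-- Telescoping: at level `L` the cells are single points, so `y` equals its averages. The increment
from level `j` to `j + 1` is constant on cells of level `j + 1` and is the projection of `y` minus
its level-`j` average. -/
theorem sum_mul_le_of_levels {m : ℕ} {𝓑 : Set (Set ℝ)} (h𝓑 : IsRegular m 𝓑) {n j₀ L : ℕ}
    (hjL : j₀ ≤ L) (hL : n ≤ m ^ L) (y : Fin n → ℝ) {v : Fin n → ℝ} (hv : mrNorm 𝓑 n v ≤ 1) :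
    ∑ i, y i * v i ≤ √((m : ℝ) ^ j₀) * √(∑ i, y i ^ 2) +
      ∑ j ∈ Finset.Ico j₀ L, √((m : ℝ) ^ (j + 1)) *
        √(∑ i, (y i - cellMean m n j y (cell m n j i)) ^ 2) := by
  have hm : 0 < m := by have := h𝓑.two_le; omega
  let a : ℕ → ℝ := fun j => ∑ i, cellMean m n j y (cell m n j i) * v i
  have h1 : ∑ i, y i * v i = a j₀ + ∑ j ∈ Finset.Ico j₀ L, (a (j + 1) - a j) := by
    rw [Finset.sum_Ico_sub _ hjL, add_sub_cancel]
    exact Finset.sum_congr rfl fun i _ => by rw [cellMean_eq_self hL]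
  rw [h1]
  refine add_le_add ?_ (Finset.sum_le_sum fun j _ => ?_)
  · refine (sum_mul_le_of_cell h𝓑 j₀ (cellMean m n j₀ y) hv).trans ?_
    refine mul_le_mul_of_nonneg_left (Real.sqrt_le_sqrt ?_) (Real.sqrt_nonneg _)
    simpa using sum_cellMean_sub_sq_le (m := m) (j := j₀) y (fun _ => 0)
  · let c : ℕ → ℝ := fun ℓ => cellMean m n j y (ℓ / m)
    have h2 : a (j + 1) - a j =
        ∑ i, (cellMean m n (j + 1) y (cell m n (j + 1) i) - c (cell m n (j + 1) i)) * v i := by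
      simp only [a, c]
      rw [← Finset.sum_sub_distrib]
      exact Finset.sum_congr rfl fun i _ => by rw [← cell_eq_cell_succ_div hm]; ring
    rw [h2]
    refine (sum_mul_le_of_cell h𝓑 (j + 1) (fun ℓ => cellMean m n (j + 1) y ℓ - c ℓ) hv).trans ?_
    refine mul_le_mul_of_nonneg_left (Real.sqrt_le_sqrt ?_) (Real.sqrt_nonneg _)
    refine (sum_cellMean_sub_sq_le y c).trans_eq ?_
    exact Finset.sum_congr rfl fun i _ => by simp only [c]; rw [← cell_eq_cell_succ_div hm]

theorem card_cell_le {m n j : ℕ} (hm : 0 < m) (ℓ : ℕ) :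
    ((Finset.univ.filter fun i : Fin n => cell m n j i = ℓ).card : ℝ) ≤ n / (m : ℝ) ^ j + 1 := by
  set S := Finset.univ.filter fun i : Fin n => cell m n j i = ℓ with hS
  rcases S.eq_empty_or_nonempty with h | h
  · rw [h]; simp; positivity
  obtain ⟨i₀, hi₀, hmin⟩ := Finset.exists_min_image S id h
  have hsub : S.card ≤ (Finset.Icc (i₀ : ℕ) (i₀ + n / m ^ j)).card := by
    refine Finset.card_le_card_of_injOn (fun i => (i : ℕ)) (fun i hi => ?_)
      (fun i _ i' _ h => Fin.ext h)
    have hle : (i₀ : ℕ) ≤ i := hmin i hi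
    simp only [Finset.coe_Icc, Set.mem_Icc]
    refine ⟨hle, ?_⟩
    have h1 := (Finset.mem_filter.1 hi).2
    rw [← (Finset.mem_filter.1 hi₀).2, cell, cell] at h1
    have hn := i.pos
    have h2 : ((i : ℕ) - i₀) * m ^ j ≤ n := by
      rw [Nat.sub_mul]
      have h3 := Nat.div_add_mod (i * m ^ j) n
      have h4 := Nat.div_add_mod (i₀ * m ^ j) n
      have h5 := Nat.mod_lt (i * m ^ j) hn
      rw [h1] at h3
      omega
    have h3 := (Nat.le_div_iff_mul_le (pow_pos hm j)).2 h2
    omega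
  rw [Nat.card_Icc, add_assoc, Nat.add_sub_cancel_left] at hsub
  have h1 : (S.card : ℝ) ≤ ((n / m ^ j : ℕ) : ℝ) + 1 := by
    exact_mod_cast hsub
  have h2 : ((n / m ^ j : ℕ) : ℝ) ≤ n / (m : ℝ) ^ j := by
    simpa using Nat.cast_div_le (α := ℝ) (m := n) (n := m ^ j)
  linarith

/-! ### Trigonometric polynomials on the grid. -/

/-- The grid point `i / n` on the circle. -/
def gridPt (n : ℕ) (i : Fin n) : UnitAddCircle := (((i : ℝ) / (n : ℝ) : ℝ) : UnitAddCircle)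

/-- The trigonometric polynomial with frequencies in `S` and coefficients `b`. -/
def trigPoly (S : Finset ℤ) (b : ℤ → ℂ) (x : UnitAddCircle) : ℝ := ∑ l ∈ S, trig (b l) l x

theorem continuous_trigPoly (S : Finset ℤ) (b : ℤ → ℂ) : Continuous (trigPoly S b) :=
  continuous_finsetSum _ fun _ _ => continuous_trig _ _

theorem hasDerivAt_trigPoly (S : Finset ℤ) (b : ℤ → ℂ) (x : ℝ) :
    HasDerivAt (fun x : ℝ => trigPoly S b (x : UnitAddCircle))
      (trigPoly S (fun l => b l * symb l) x) x :=
  HasDerivAt.fun_sum fun l _ => hasDerivAt_trig (b l) l x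

theorem coe_trigPoly {S : Finset ℤ} (hS : ∀ l ∈ S, -l ∈ S) {b : ℤ → ℂ}
    (hb : ∀ l, b (-l) = conj (b l)) (x : UnitAddCircle) :
    (trigPoly S b x : ℂ) = ∑ l ∈ S, b l * fourier l x := by
  have h1 : trigPoly S b x = (∑ l ∈ S, b l * fourier l x).re := by
    rw [Complex.re_sum]; rfl
  rw [h1, ← Complex.conj_eq_iff_re, map_sum]
  refine Finset.sum_bij' (fun l _ => -l) (fun l _ => -l) (fun l hl => hS l hl)
    (fun l hl => hS l hl) (fun l _ => neg_neg l) (fun l _ => neg_neg l) fun l _ => ?_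
  rw [map_mul, hb, fourier_neg]

theorem fc_trigPoly {S : Finset ℤ} (hS : ∀ l ∈ S, -l ∈ S) {b : ℤ → ℂ}
    (hb : ∀ l, b (-l) = conj (b l)) (l : ℤ) :
    fc (trigPoly S b) l = if l ∈ S then b l else 0 := by
  have h1 : (fun x => (trigPoly S b x : ℂ)) =
      ∑ l ∈ S, fun x : UnitAddCircle => b l * fourier l x := by
    funext x; rw [coe_trigPoly hS hb, Finset.sum_apply]
  rw [fc, h1, fourierCoeff.sum]
  · have : ∀ l' : ℤ, fourierCoeff (fun x : UnitAddCircle => b l' * fourier l' x) l =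
        if l = l' then b l' else 0 := by
      intro l'
      rw [fourierCoeff.const_mul, fourierCoeff_fourier, Pi.single_apply]; simp
    simp only [Finset.sum_apply, this, Finset.sum_ite_eq]
  · intro l' _
    exact (continuous_const.mul (fourier l').continuous).integrable_of_hasCompactSupport
      (HasCompactSupport.of_compactSpace _)

theorem integral_trigPoly_sq {S : Finset ℤ} (hS : ∀ l ∈ S, -l ∈ S) {b : ℤ → ℂ}
    (hb : ∀ l, b (-l) = conj (b l)) :
    ∫ x, trigPoly S b x ^ 2 = ∑ l ∈ S, ‖b l‖ ^ 2 := by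
  have h1 := hasSum_fc_sq (memLp_of_continuous (continuous_trigPoly S b) 2)
  refine h1.unique ?_
  have h2 : (fun l => ‖fc (trigPoly S b) l‖ ^ 2) = fun l => if l ∈ S then ‖b l‖ ^ 2 else 0 := by
    funext l; rw [fc_trigPoly hS hb]; split_ifs <;> simp
  rw [h2]
  convert hasSum_sum_of_ne_finset_zero (s := S) (f := fun l => if l ∈ S then ‖b l‖ ^ 2 else 0) ?_
    using 1
  · exact Finset.sum_congr rfl fun l hl => by rw [if_pos hl]
  · intro l hl; rw [if_neg hl]
  · infer_instance

theorem sum_fourier_gridPt {n : ℕ} {l : ℤ} (hl : |l| < n) :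
    ∑ i : Fin n, (fourier l (gridPt n i) : ℂ) = if l = 0 then (n : ℂ) else 0 := by
  split_ifs with h
  · subst h; simp
  have hn : (n : ℂ) ≠ 0 := by
    have : (0 : ℤ) < n := (abs_nonneg l).trans_lt hl
    exact_mod_cast this.ne'
  set z : ℂ := Complex.exp (2 * π * Complex.I * (l / n)) with hz
  have h1 : ∀ i : Fin n, (fourier l (gridPt n i) : ℂ) = z ^ (i : ℕ) := by
    intro i
    rw [gridPt, fourier_coe_apply, hz, ← Complex.exp_nat_mul]
    congr 1; push_cast; field_simp
  have hz1 : z ≠ 1 := by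
    intro h1
    obtain ⟨q, hq⟩ := Complex.exp_eq_one_iff.1 h1
    have h2 : (l : ℂ) = q * n := by
      have h3 : (2 * π * Complex.I : ℂ) ≠ 0 := by simp [Real.pi_ne_zero]
      have h4 : (l / n : ℂ) = q := mul_left_cancel₀ h3 (by rw [hq]; ring)
      rw [← h4]; field_simp
    have h3 : l = q * n := by exact_mod_cast h2
    exact h (Int.eq_zero_of_abs_lt_dvd ⟨q, by rw [h3]; ring⟩ hl)
  have hzn : z ^ n = 1 := by
    rw [hz, ← Complex.exp_nat_mul, Complex.exp_eq_one_iff]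
    exact ⟨l, by field_simp⟩
  simp only [h1]
  rw [Fin.sum_univ_eq_sum_range (fun i => z ^ i), geom_sum_eq hz1, hzn]; simp

/-- The condition on `l` keeps every frequency difference below `n` in modulus, so no aliasing
occurs. -/
theorem sum_trigPoly_mul_fourier {n N : ℕ} {S : Finset ℤ} (hS : ∀ l ∈ S, -l ∈ S) {b : ℤ → ℂ}
    (hb : ∀ l, b (-l) = conj (b l)) (hSN : ∀ l ∈ S, |l| < N) {l : ℤ} (hl : |l| + N ≤ n) :
    ∑ i : Fin n, (trigPoly S b (gridPt n i) : ℂ) * fourier (-l) (gridPt n i) =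
      if l ∈ S then n * b l else 0 := by
  simp only [coe_trigPoly hS hb, Finset.sum_mul]
  rw [Finset.sum_comm]
  have h1 : ∀ l' ∈ S, ∑ i : Fin n, b l' * (fourier l' (gridPt n i) : ℂ) * fourier (-l) (gridPt n i)
      = if l = l' then n * b l' else 0 := by
    intro l' hl'
    simp only [mul_assoc, ← fourier_add]
    rw [← Finset.mul_sum, sum_fourier_gridPt]
    · simp only [add_neg_eq_zero, eq_comm (a := l')]
      split_ifs <;> ring
    · have := hSN l' hl'
      have h2 := abs_add_le l' (-l)
      rw [abs_neg] at h2
      omega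
  rw [Finset.sum_congr rfl h1]
  simp

theorem sum_trigPoly_sq {n N : ℕ} (hN : 2 * N ≤ n) {S : Finset ℤ} (hS : ∀ l ∈ S, -l ∈ S)
    {b : ℤ → ℂ} (hb : ∀ l, b (-l) = conj (b l)) (hSN : ∀ l ∈ S, |l| < N) :
    ∑ i : Fin n, trigPoly S b (gridPt n i) ^ 2 = n * ∑ l ∈ S, ‖b l‖ ^ 2 := by
  have h1 : ∀ i : Fin n, (trigPoly S b (gridPt n i) : ℂ) ^ 2 =
      ∑ l ∈ S, conj (b l) * ((trigPoly S b (gridPt n i) : ℂ) * fourier (-l) (gridPt n i)) := by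
    intro i
    have h2 : (trigPoly S b (gridPt n i) : ℂ) = ∑ l ∈ S, conj (b l) * fourier (-l) (gridPt n i) := by
      rw [← Complex.conj_ofReal, coe_trigPoly hS hb, map_sum]
      exact Finset.sum_congr rfl fun l _ => by rw [map_mul, fourier_neg]
    rw [sq]
    nth_rewrite 2 [h2]
    rw [Finset.mul_sum]
    exact Finset.sum_congr rfl fun l _ => by ring
  have h3 : ((∑ i : Fin n, trigPoly S b (gridPt n i) ^ 2 : ℝ) : ℂ) =
      ((n * ∑ l ∈ S, ‖b l‖ ^ 2 : ℝ) : ℂ) := by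
    push_cast
    simp only [h1]
    rw [Finset.sum_comm, Finset.mul_sum]
    refine Finset.sum_congr rfl fun l hl => ?_
    rw [← Finset.mul_sum, sum_trigPoly_mul_fourier hS hb hSN, if_pos hl, ← Complex.conj_mul']
    · ring
    · have := hSN l hl; omega
  exact_mod_cast h3

theorem sq_integral_le {h : ℝ → ℝ} (hh : Continuous h) {a x : ℝ} (hax : a ≤ x) :
    (∫ t in a..x, h t) ^ 2 ≤ (x - a) * ∫ t in a..x, h t ^ 2 := by
  rcases hax.eq_or_lt with rfl | hlt
  · simp
  set I := ∫ t in a..x, h t with hI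
  have hd : 0 < x - a := sub_pos.2 hlt
  have h1 : ∫ t in a..x, (h t - I / (x - a)) ^ 2 =
      (∫ t in a..x, h t ^ 2) - 2 * (I / (x - a)) * I + (x - a) * (I / (x - a)) ^ 2 := by
    have : ∀ t, (h t - I / (x - a)) ^ 2 =
        (h t ^ 2 - 2 * (I / (x - a)) * h t) + (I / (x - a)) ^ 2 := fun t => by ring
    simp only [this]
    rw [intervalIntegral.integral_add, intervalIntegral.integral_sub,
      intervalIntegral.integral_const_mul, intervalIntegral.integral_const, smul_eq_mul]
    all_goals apply Continuous.intervalIntegrable; fun_prop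
  have h2 : 0 ≤ ∫ t in a..x, (h t - I / (x - a)) ^ 2 :=
    intervalIntegral.integral_nonneg hax fun _ _ => sq_nonneg _
  rw [h1] at h2
  have h3 : (∫ t in a..x, h t ^ 2) - 2 * (I / (x - a)) * I + (x - a) * (I / (x - a)) ^ 2 =
      (∫ t in a..x, h t ^ 2) - I ^ 2 / (x - a) := by field_simp; ring
  rw [h3, sub_nonneg, div_le_iff₀ hd] at h2
  linarith

theorem sq_sub_le_integral {g g' : ℝ → ℝ} (hg : ∀ x, HasDerivAt g (g' x) x) (hg' : Continuous g')
    {a x δ : ℝ} (hax : a ≤ x) (hx : x ≤ a + δ) :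
    (g x - g a) ^ 2 ≤ δ * ∫ t in a..(a + δ), g' t ^ 2 := by
  have h1 : ∫ t in a..x, g' t = g x - g a :=
    intervalIntegral.integral_eq_sub_of_hasDerivAt (fun t _ => hg t) (hg'.intervalIntegrable _ _)
  rw [← h1]
  refine (sq_integral_le hg' hax).trans ?_
  have h2 : ∫ t in a..x, g' t ^ 2 ≤ ∫ t in a..(a + δ), g' t ^ 2 := by
    refine intervalIntegral.integral_mono_interval le_rfl hax hx
      (Eventually.of_forall fun t => sq_nonneg _) ((hg'.pow 2).intervalIntegrable _ _)
  exact mul_le_mul (by linarith) h2 (intervalIntegral.integral_nonneg hax fun _ _ => sq_nonneg _)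
    (by linarith)

/-- A discrete Poincaré inequality: compare each grid value with the value at the left end of its
cell by the fundamental theorem of calculus and Cauchy–Schwarz, and count the grid points per cell.
-/
theorem sum_sub_cell_sq_le {m n j : ℕ} (hm : 0 < m) {g g' : ℝ → ℝ}
    (hg : ∀ x, HasDerivAt g (g' x) x) (hg' : Continuous g') :
    ∑ i : Fin n, (g ((i : ℝ) / n) - g ((cell m n j i : ℝ) / (m : ℝ) ^ j)) ^ 2 ≤
      (n / (m : ℝ) ^ j + 1) * (1 / (m : ℝ) ^ j) * ∫ t in (0 : ℝ)..1, g' t ^ 2 := by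
  have hM : (0 : ℝ) < (m : ℝ) ^ j := by positivity
  have hmaps : ∀ i ∈ (Finset.univ : Finset (Fin n)), cell m n j i ∈ Finset.range (m ^ j) :=
    fun i _ => Finset.mem_range.2 (cell_lt hm i)
  rw [← Finset.sum_fiberwise_of_maps_to hmaps]
  let a : ℕ → ℝ := fun ℓ => (ℓ : ℝ) / (m : ℝ) ^ j
  have ha : ∀ ℓ, a (ℓ + 1) = a ℓ + 1 / (m : ℝ) ^ j := fun ℓ => by simp only [a]; push_cast; ring
  have hg2 : Continuous fun t => g' t ^ 2 := hg'.pow 2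
  have hadj : ∫ t in (0 : ℝ)..1, g' t ^ 2 =
      ∑ ℓ ∈ Finset.range (m ^ j), ∫ t in (a ℓ)..(a (ℓ + 1)), g' t ^ 2 := by
    rw [intervalIntegral.sum_integral_adjacent_intervals
      fun k _ => hg2.intervalIntegrable _ _]
    simp only [a]
    push_cast
    rw [zero_div, div_self hM.ne']
  rw [hadj, Finset.mul_sum]
  refine Finset.sum_le_sum fun ℓ _ => ?_
  have hI : 0 ≤ ∫ t in (a ℓ)..(a (ℓ + 1)), g' t ^ 2 :=
    intervalIntegral.integral_nonneg (by rw [ha]; have : 0 < 1 / (m : ℝ) ^ j := by positivity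
                                         linarith) fun _ _ => sq_nonneg _
  calc ∑ i : Fin n with cell m n j i = ℓ,
        (g ((i : ℝ) / n) - g ((cell m n j i : ℝ) / (m : ℝ) ^ j)) ^ 2
      ≤ ∑ i : Fin n with cell m n j i = ℓ,
          1 / (m : ℝ) ^ j * ∫ t in (a ℓ)..(a (ℓ + 1)), g' t ^ 2 := by
        refine Finset.sum_le_sum fun i hi => ?_
        have hi' := (Finset.mem_filter.1 hi).2
        have h1 := (cell_eq_iff hm i).1 hi'
        rw [hi', ha]
        refine sq_sub_le_integral hg hg' h1.1 (h1.2.le.trans_eq ?_)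
        ring
    _ ≤ _ := by
        rw [Finset.sum_const, nsmul_eq_mul, ← mul_assoc]
        gcongr
        exact card_cell_le hm ℓ

/-! ### The dual norm of sampled trigonometric polynomials. -/

theorem sqrt_pow_eq (m j : ℕ) : √((m : ℝ) ^ j) = √(m : ℝ) ^ j := by
  rw [Real.sqrt_eq_iff_eq_sq (by positivity) (by positivity), ← pow_mul, mul_comm, pow_mul,
    Real.sq_sqrt (Nat.cast_nonneg _)]

theorem gridPt_eq (n : ℕ) (i : Fin n) : gridPt n i = (((i : ℝ) / (n : ℝ) : ℝ) : UnitAddCircle) := rfl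

theorem conj_mul_symb {b : ℤ → ℂ} (hb : ∀ l, b (-l) = conj (b l)) (l : ℤ) :
    b (-l) * symb (-l) = conj (b l * symb l) := by
  rw [map_mul, conj_symb, symb_neg, hb]

/-- The cell mean is the best cellwise constant, so it may be replaced by the value at the left
endpoint. Poincaré then applies, and the derivative is bounded through the largest frequency of the
block. -/
theorem sqrt_sum_sub_cellMean_sq_le {m : ℕ} (hm : 2 ≤ m) {n j₀ j : ℕ} (hj : m ^ j ≤ n)
    {b : ℤ → ℂ} (hb : ∀ l, b (-l) = conj (b l)) :
    √(∑ i, (trigPoly (block m j₀) b (gridPt n i) -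
      cellMean m n j (fun i => trigPoly (block m j₀) b (gridPt n i)) (cell m n j i)) ^ 2) ≤
      2 * √n * (2 * π * (m : ℝ) ^ (j₀ + 1)) / (m : ℝ) ^ j * √(∑ l ∈ block m j₀, ‖b l‖ ^ 2) := by
  have hm0 : 0 < m := by omega
  have hM : (0 : ℝ) < (m : ℝ) ^ j := by positivity
  have hMn : (m : ℝ) ^ j ≤ n := by exact_mod_cast hj
  have hS : ∀ l ∈ block m j₀, -l ∈ block m j₀ := fun l hl => neg_mem_block.2 hl
  set Q := ∑ l ∈ block m j₀, ‖b l‖ ^ 2 with hQ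
  have hQ0 : 0 ≤ Q := Finset.sum_nonneg fun _ _ => sq_nonneg _
  have hint : ∫ t in (0 : ℝ)..1, trigPoly (block m j₀) (fun l => b l * symb l) t ^ 2 ≤
      (2 * π * (m : ℝ) ^ (j₀ + 1)) ^ 2 * Q := by
    rw [intervalIntegral_coe (fun x => trigPoly (block m j₀) (fun l => b l * symb l) x ^ 2),
      integral_trigPoly_sq hS (conj_mul_symb hb), hQ, Finset.mul_sum]
    refine Finset.sum_le_sum fun l hl => ?_
    rw [norm_mul, mul_pow, mul_comm, norm_symb]
    gcongr
    exact (lt_of_mem_block hl).le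
  have h0 := sum_sub_cell_sq_le (n := n) (j := j) hm0
    (g := fun x : ℝ => trigPoly (block m j₀) b (x : UnitAddCircle))
    (g' := fun x : ℝ => trigPoly (block m j₀) (fun l => b l * symb l) (x : UnitAddCircle))
    (hasDerivAt_trigPoly (block m j₀) b)
    ((continuous_trigPoly _ _).comp (AddCircle.continuous_mk' 1))
  have h1 := sum_sub_cellMean_sq_le (m := m) (j := j)
    (fun i : Fin n => trigPoly (block m j₀) b (gridPt n i))
    (fun ℓ => trigPoly (block m j₀) b (((ℓ : ℝ) / (m : ℝ) ^ j : ℝ) : UnitAddCircle))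
  replace h1 := h1.trans h0
  refine (Real.sqrt_le_sqrt h1).trans ?_
  rw [Real.sqrt_le_left (by positivity)]
  calc ((n : ℝ) / (m : ℝ) ^ j + 1) * (1 / (m : ℝ) ^ j) *
        ∫ t in (0 : ℝ)..1, trigPoly (block m j₀) (fun l => b l * symb l) t ^ 2
      ≤ ((n : ℝ) / (m : ℝ) ^ j + n / (m : ℝ) ^ j) * (1 / (m : ℝ) ^ j) *
          ((2 * π * (m : ℝ) ^ (j₀ + 1)) ^ 2 * Q) := by
        have h3 : 0 ≤ ∫ t in (0 : ℝ)..1,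
            trigPoly (block m j₀) (fun l => b l * symb l) t ^ 2 :=
          intervalIntegral.integral_nonneg zero_le_one fun _ _ => sq_nonneg _
        gcongr
        rwa [one_le_div hM]
    _ ≤ 4 * n * (2 * π * (m : ℝ) ^ (j₀ + 1)) ^ 2 / ((m : ℝ) ^ j) ^ 2 * Q := by
        have : 0 ≤ n * (2 * π * (m : ℝ) ^ (j₀ + 1)) ^ 2 / ((m : ℝ) ^ j) ^ 2 * Q := by positivity
        have h2 : ((n : ℝ) / (m : ℝ) ^ j + n / (m : ℝ) ^ j) * (1 / (m : ℝ) ^ j) *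
          ((2 * π * (m : ℝ) ^ (j₀ + 1)) ^ 2 * Q) =
          2 * (n * (2 * π * (m : ℝ) ^ (j₀ + 1)) ^ 2 / ((m : ℝ) ^ j) ^ 2 * Q) := by field_simp; ring
        rw [h2]
        have h3 : 4 * n * (2 * π * (m : ℝ) ^ (j₀ + 1)) ^ 2 / ((m : ℝ) ^ j) ^ 2 * Q =
          4 * (n * (2 * π * (m : ℝ) ^ (j₀ + 1)) ^ 2 / ((m : ℝ) ^ j) ^ 2 * Q) := by ring
        rw [h3]; linarith
    _ = _ := by
        rw [mul_pow _ (√Q), div_pow, mul_pow (2 * √(n : ℝ)), mul_pow 2 (√(n : ℝ)),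
          Real.sq_sqrt (Nat.cast_nonneg _), Real.sq_sqrt hQ0]
        norm_num

/-- Level `j` contributes `m^(j/2)` times the Poincaré factor `m^(j₀ - j)` up to constants, a
geometric series dominated by its first level `j₀`. -/
theorem sum_trigPoly_block_mul_le {m : ℕ} {𝓑 : Set (Set ℝ)} (h𝓑 : IsRegular m 𝓑) {n j₀ : ℕ}
    (hn : 2 * m ^ (j₀ + 1) ≤ n) {b : ℤ → ℂ} (hb : ∀ l, b (-l) = conj (b l)) {v : Fin n → ℝ}
    (hv : mrNorm 𝓑 n v ≤ 1) :
    ∑ i, trigPoly (block m j₀) b (gridPt n i) * v i ≤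
      (1 + 16 * π * m * √m) * √n * (√((m : ℝ) ^ j₀) * √(∑ l ∈ block m j₀, ‖b l‖ ^ 2)) := by
  have hm := h𝓑.two_le
  have hm2 : (2 : ℝ) ≤ m := by exact_mod_cast hm
  have hj0n : m ^ j₀ < n := by
    have h1 : m ^ j₀ ≤ m ^ (j₀ + 1) := Nat.pow_le_pow_right (by omega) (by omega)
    have h2 : 0 < m ^ j₀ := pow_pos (by omega) _
    omega
  -- The least level whose cells each contain at most one grid point; all earlier levels still
  -- satisfy `m^j ≤ n`.
  set L := Nat.clog m n with hL
  have hnL : n ≤ m ^ L := Nat.le_pow_clog (by omega) n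
  have hjL : j₀ ≤ L := by
    by_contra h
    have := Nat.pow_le_pow_right (by omega : 0 < m) (not_le.1 h).le
    omega
  have hlt : ∀ j ∈ Finset.Ico j₀ L, m ^ j ≤ n := fun j hj =>
    ((Nat.lt_clog_iff_pow_lt (by omega)).1 (Finset.mem_Ico.1 hj).2).le
  have hS : ∀ l ∈ block m j₀, -l ∈ block m j₀ := fun l hl => neg_mem_block.2 hl
  have hmain := sum_mul_le_of_levels h𝓑 hjL hnL (fun i => trigPoly (block m j₀) b (gridPt n i)) hv
  refine hmain.trans ?_
  rw [sum_trigPoly_sq (N := m ^ (j₀ + 1)) hn hS hb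
    (fun l hl => by have := (mem_block.1 hl).2; exact_mod_cast this),
    Real.sqrt_mul (Nat.cast_nonneg _)]
  set Q := √(∑ l ∈ block m j₀, ‖b l‖ ^ 2) with hQ
  set w := √(m : ℝ) with hw
  have hw0 : 0 < w := Real.sqrt_pos.2 (by linarith)
  have hw2 : w ^ 2 = m := Real.sq_sqrt (by linarith)
  -- Since `√2 ≥ 4/3`, the geometric series has a bound independent of `m`, namely `1 / (1 - 3/4) =
  -- 4` times its first term.
  have hwi : w⁻¹ ≤ 3 / 4 := by
    rw [inv_le_comm₀ hw0 (by norm_num), hw]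
    exact Real.le_sqrt_of_sq_le (by norm_num; linarith)
  have hgeom : ∑ j ∈ Finset.Ico j₀ L, w⁻¹ ^ j ≤ 4 * w⁻¹ ^ j₀ := by
    refine (geom_sum_Ico_le_of_lt_one (by positivity) (by linarith)).trans ?_
    rw [div_le_iff₀ (by linarith)]
    nlinarith [pow_pos (inv_pos.2 hw0) j₀]
  have hsum : ∑ j ∈ Finset.Ico j₀ L, √((m : ℝ) ^ (j + 1)) *
      √(∑ i, (trigPoly (block m j₀) b (gridPt n i) -
        cellMean m n j (fun i => trigPoly (block m j₀) b (gridPt n i)) (cell m n j i)) ^ 2) ≤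
      (4 * π * √n * w * (m : ℝ) ^ (j₀ + 1) * Q) * ∑ j ∈ Finset.Ico j₀ L, w⁻¹ ^ j := by
    rw [Finset.mul_sum]
    refine Finset.sum_le_sum fun j hj => ?_
    refine (mul_le_mul_of_nonneg_left (sqrt_sum_sub_cellMean_sq_le hm (hlt j hj) hb)
      (Real.sqrt_nonneg _)).trans_eq ?_
    rw [sqrt_pow_eq, ← hw, ← hQ]
    have : (m : ℝ) ^ j = w ^ j * w ^ j := by rw [← hw2, ← pow_mul, mul_comm, pow_mul, sq]
    rw [this, pow_succ, inv_pow]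
    field_simp
    ring
  refine (add_le_add le_rfl (hsum.trans (mul_le_mul_of_nonneg_left hgeom (by positivity)))).trans_eq ?_
  rw [sqrt_pow_eq, ← hw]
  have : (m : ℝ) ^ (j₀ + 1) = w ^ j₀ * w ^ j₀ * m := by
    rw [pow_succ, ← hw2, ← pow_mul, mul_comm 2, pow_mul, sq (w ^ j₀)]
  rw [this, inv_pow]
  field_simp
  ring

/-- The frequencies `l ≠ 0` with `|l| < m ^ J`. -/
def freq (m J : ℕ) : Finset ℤ := (Finset.range J).biUnion (block m)

theorem mem_block_log {m : ℕ} (hm : 2 ≤ m) {l : ℤ} (hl : l ≠ 0) :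
    l ∈ block m (Nat.log m l.natAbs) := by
  rw [mem_block, Int.abs_eq_natAbs]
  exact ⟨by exact_mod_cast Nat.pow_log_le_self m (Int.natAbs_ne_zero.2 hl),
    by exact_mod_cast Nat.lt_pow_succ_log_self (by omega) _⟩

theorem eq_log_of_mem_block {m j : ℕ} {l : ℤ} (hl : l ∈ block m j) :
    j = Nat.log m l.natAbs := by
  rw [mem_block, Int.abs_eq_natAbs] at hl
  exact (Nat.log_eq_of_pow_le_of_lt_pow (by exact_mod_cast hl.1) (by exact_mod_cast hl.2)).symm

theorem mem_freq {m : ℕ} (hm : 2 ≤ m) {J : ℕ} {l : ℤ} :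
    l ∈ freq m J ↔ l ≠ 0 ∧ |l| < (m : ℤ) ^ J := by
  rw [freq, Finset.mem_biUnion]
  constructor
  · rintro ⟨j, hj, hl⟩
    have h := mem_block.1 hl
    refine ⟨?_, h.2.trans_le (pow_le_pow_right₀ (by omega) (Finset.mem_range.1 hj))⟩
    rintro rfl
    have : (0 : ℤ) < (m : ℤ) ^ j := pow_pos (by omega) j
    rw [abs_zero] at h
    omega
  · rintro ⟨h0, hl⟩
    refine ⟨_, ?_, mem_block_log hm h0⟩
    rw [Finset.mem_range]
    refine Nat.log_lt_of_lt_pow (Int.natAbs_ne_zero.2 h0) ?_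
    rw [Int.abs_eq_natAbs] at hl
    exact_mod_cast hl

theorem sum_freq {m : ℕ} {M : Type*} [AddCommMonoid M] (J : ℕ) (c : ℤ → M) :
    ∑ l ∈ freq m J, c l = ∑ j ∈ Finset.range J, ∑ l ∈ block m j, c l := by
  refine Finset.sum_biUnion fun i _ j _ hij => Finset.disjoint_left.2 fun l hi hj => hij ?_
  rw [eq_log_of_mem_block hi, ← eq_log_of_mem_block hj]

theorem mrDualNorm_trigPoly_le {m : ℕ} {𝓑 : Set (Set ℝ)} (h𝓑 : IsRegular m 𝓑) {n J : ℕ}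
    (hn : 2 * m ^ J ≤ n) {b : ℤ → ℂ} (hb : ∀ l, b (-l) = conj (b l)) :
    mrDualNorm 𝓑 n (fun i => trigPoly (freq m J) b (gridPt n i) / n) ≤
      ENNReal.ofReal ((1 + 16 * π * m * √m) / √n *
        ∑ j ∈ Finset.range J, √((m : ℝ) ^ j) * √(∑ l ∈ block m j, ‖b l‖ ^ 2)) := by
  have hm := h𝓑.two_le
  rw [mrDualNorm_le_iff (mul_nonneg (by positivity)
    (Finset.sum_nonneg fun _ _ => by positivity))]
  intro v hv
  have hn0 : (0 : ℝ) < n := by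
    have h2 : 0 < m ^ J := pow_pos (by omega) _
    exact_mod_cast (by omega : 0 < n)
  have h1 : ∑ i, trigPoly (freq m J) b (gridPt n i) / n * v i =
      (∑ j ∈ Finset.range J, ∑ i, trigPoly (block m j) b (gridPt n i) * v i) / n := by
    rw [Finset.sum_comm, Finset.sum_div]
    refine Finset.sum_congr rfl fun i _ => ?_
    rw [trigPoly, sum_freq, ← Finset.sum_mul]
    simp only [trigPoly]
    ring
  rw [h1, div_le_iff₀ hn0]
  calc ∑ j ∈ Finset.range J, ∑ i, trigPoly (block m j) b (gridPt n i) * v i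
      ≤ ∑ j ∈ Finset.range J, (1 + 16 * π * m * √m) * √n *
          (√((m : ℝ) ^ j) * √(∑ l ∈ block m j, ‖b l‖ ^ 2)) := by
        refine Finset.sum_le_sum fun j hj => sum_trigPoly_block_mul_le h𝓑 (le_trans ?_ hn) hb hv
        exact Nat.mul_le_mul_left _ (Nat.pow_le_pow_right (by omega) (Finset.mem_range.1 hj))
    _ = _ := by
        rw [← Finset.mul_sum]
        set E := ∑ j ∈ Finset.range J, √((m : ℝ) ^ j) * √(∑ l ∈ block m j, ‖b l‖ ^ 2)
        have hs : 0 < √(n : ℝ) := Real.sqrt_pos.2 hn0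
        rw [div_mul_eq_mul_div, div_mul_eq_mul_div, eq_div_iff hs.ne']
        linear_combination ((1 + 16 * π * m * √m) * E) * Real.mul_self_sqrt hn0.le

theorem sum_range_pow_rpow_le {m : ℕ} (hm : 2 ≤ m) {γ : ℝ} (hγ : 0 < γ) (J : ℕ) :
    ∑ j ∈ Finset.range J, ((m : ℝ) ^ j) ^ γ ≤ ((m : ℝ) ^ γ - 1)⁻¹ * ((m : ℝ) ^ J) ^ γ := by
  have hm1 : (1 : ℝ) < m := by exact_mod_cast hm
  have h1 : 1 < (m : ℝ) ^ γ := Real.one_lt_rpow hm1 hγ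
  have h2 : ∀ j : ℕ, ((m : ℝ) ^ j) ^ γ = ((m : ℝ) ^ γ) ^ j := fun j => by
    rw [← Real.rpow_natCast, ← Real.rpow_mul (by linarith), mul_comm, Real.rpow_mul (by linarith),
      Real.rpow_natCast]
  simp only [h2]
  rw [geom_sum_eq h1.ne', div_eq_inv_mul]
  have : 0 < (m : ℝ) ^ γ - 1 := by linarith
  gcongr
  linarith

/-- Stated for finite sets, so that summability can be deduced from it instead of being assumed. -/
theorem sum_le_of_block_le {m : ℕ} (hm : 2 ≤ m) {c : ℤ → ℝ} (hc : ∀ l, 0 ≤ c l) {C β : ℝ}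
    (hβ : 0 < β) (hC : 0 ≤ C) (h : ∀ j, ∑ l ∈ block m j, c l ≤ C * ((m : ℝ) ^ j) ^ (-β)) (J : ℕ)
    (T : Finset ℤ) (hT : ∀ l ∈ T, (m : ℤ) ^ J ≤ |l|) :
    ∑ l ∈ T, c l ≤ C * (1 - (m : ℝ) ^ (-β))⁻¹ * ((m : ℝ) ^ J) ^ (-β) := by
  have hm1 : (1 : ℝ) < m := by exact_mod_cast hm
  have h1 : (m : ℝ) ^ (-β) < 1 := Real.rpow_lt_one_of_one_lt_of_neg hm1 (by linarith)
  have h2 : ∀ j : ℕ, ((m : ℝ) ^ j) ^ (-β) = ((m : ℝ) ^ (-β)) ^ j := fun j => by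
    rw [← Real.rpow_natCast, ← Real.rpow_mul (by linarith), mul_comm, Real.rpow_mul (by linarith),
      Real.rpow_natCast]
  obtain ⟨L, hL⟩ : ∃ L, ∀ l ∈ T, Nat.log m l.natAbs < L :=
    ⟨T.sup (fun l => Nat.log m l.natAbs) + 1, fun l hl =>
      Nat.lt_succ_of_le (Finset.le_sup (f := fun l : ℤ => Nat.log m l.natAbs) hl)⟩
  have hsub : T ⊆ (Finset.Ico J L).biUnion (block m) := by
    intro l hl
    have hlJ := hT l hl
    have hl0 : l ≠ 0 := by
      rintro rfl
      have : (0 : ℤ) < (m : ℤ) ^ J := pow_pos (by omega) J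
      rw [abs_zero] at hlJ
      omega
    refine Finset.mem_biUnion.2 ⟨_, Finset.mem_Ico.2 ⟨?_, hL l hl⟩, mem_block_log hm hl0⟩
    refine Nat.le_log_of_pow_le (by omega) ?_
    rw [Int.abs_eq_natAbs] at hlJ
    exact_mod_cast hlJ
  calc ∑ l ∈ T, c l ≤ ∑ l ∈ (Finset.Ico J L).biUnion (block m), c l :=
        Finset.sum_le_sum_of_subset_of_nonneg hsub fun l _ _ => hc l
    _ ≤ ∑ j ∈ Finset.Ico J L, ∑ l ∈ block m j, c l := by
        refine (Finset.sum_biUnion fun i _ j _ hij =>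
          Finset.disjoint_left.2 fun l hi hj => hij ?_).le
        rw [eq_log_of_mem_block hi, ← eq_log_of_mem_block hj]
    _ ≤ ∑ j ∈ Finset.Ico J L, C * ((m : ℝ) ^ (-β)) ^ j :=
        Finset.sum_le_sum fun j _ => (h j).trans_eq (by rw [h2])
    _ ≤ C * (((m : ℝ) ^ (-β)) ^ J / (1 - (m : ℝ) ^ (-β))) := by
        rw [← Finset.mul_sum]
        exact mul_le_mul_of_nonneg_left (geom_sum_Ico_le_of_lt_one (by positivity) h1) hC
    _ = _ := by rw [h2, div_eq_inv_mul]; ring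

/-! ### The adjoint of sampling and the distance function in Fourier coefficients. -/

/-- The sums `∑ ω(x) e^{-2 π i l x}` over the grid points `x`. -/
def dualCoef (n : ℕ) (ω : Fin n → ℝ) (l : ℤ) : ℂ := ∑ i, (ω i : ℂ) * fourier (-l) (gridPt n i)

/-- The Fourier coefficients of the adjoint of the sampling operator. -/
def adjCoef (k n : ℕ) (ω : Fin n → ℝ) (l : ℤ) : ℂ :=
  dualCoef n ω l / ((‖symb l‖ ^ (2 * k) : ℝ) : ℂ)

theorem dualCoef_neg (n : ℕ) (ω : Fin n → ℝ) (l : ℤ) :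
    dualCoef n ω (-l) = conj (dualCoef n ω l) := by
  rw [dualCoef, dualCoef, map_sum]
  refine Finset.sum_congr rfl fun i _ => ?_
  rw [map_mul, Complex.conj_ofReal, ← fourier_neg]

theorem norm_dualCoef_le (n : ℕ) (ω : Fin n → ℝ) (l : ℤ) : ‖dualCoef n ω l‖ ≤ ∑ i, |ω i| := by
  refine (norm_sum_le _ _).trans_eq (Finset.sum_congr rfl fun i _ => ?_)
  rw [norm_mul, norm_fourier_apply, mul_one, Complex.norm_real, Real.norm_eq_abs]

theorem norm_symb_neg (l : ℤ) : ‖symb (-l)‖ = ‖symb l‖ := by rw [symb_neg, norm_neg]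

theorem adjCoef_neg (k n : ℕ) (ω : Fin n → ℝ) (l : ℤ) :
    adjCoef k n ω (-l) = conj (adjCoef k n ω l) := by
  rw [adjCoef, adjCoef, map_div₀, Complex.conj_ofReal, dualCoef_neg, norm_symb_neg]

/-- For `k ≥ 1` the denominator vanishes at frequency zero, and the convention for division by zero
gives exactly the mean-zero condition. -/
theorem adjCoef_zero {k : ℕ} (hk : 1 ≤ k) (n : ℕ) (ω : Fin n → ℝ) : adjCoef k n ω 0 = 0 := by
  rw [adjCoef, symb_zero, norm_zero, zero_pow (by omega)]; simp

theorem abs_le_norm_symb (l : ℤ) : |(l : ℝ)| ≤ ‖symb l‖ := by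
  rw [norm_symb]; nlinarith [Real.pi_gt_three, abs_nonneg (l : ℝ)]

theorem one_le_abs_of_ne_zero {l : ℤ} (hl : l ≠ 0) : 1 ≤ |(l : ℝ)| := by
  exact_mod_cast Int.one_le_abs hl

theorem conj_symb_pow_mul (k : ℕ) (l : ℤ) :
    conj (symb l ^ k) * symb l ^ k = ((‖symb l‖ ^ (2 * k) : ℝ) : ℂ) := by
  rw [Complex.conj_mul', norm_pow]; push_cast; ring

theorem symb_pow_neg_conj {b : ℤ → ℂ} (hb : ∀ l, b (-l) = conj (b l)) (j : ℕ) (l : ℤ) :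
    symb (-l) ^ j * b (-l) = conj (symb l ^ j * b l) := by
  rw [map_mul, map_pow, conj_symb, symb_neg, hb]

theorem summable_one_div_int_sq : Summable fun l : ℤ => 1 / (l : ℝ) ^ 2 :=
  Real.summable_one_div_int_pow.2 (by norm_num)

theorem summable_symb_mul_adjCoef {k : ℕ} (hk : 1 ≤ k) (n : ℕ) (ω : Fin n → ℝ) {j : ℕ}
    (hj : j ≤ k) : Summable fun l => ‖symb l ^ j * adjCoef k n ω l‖ ^ 2 := by
  refine Summable.of_nonneg_of_le (fun _ => by positivity) (fun l => ?_)
    (summable_one_div_int_sq.mul_left ((∑ i, |ω i|) ^ 2))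
  rcases eq_or_ne l 0 with rfl | hl
  · rw [adjCoef_zero hk]; simp
  have h1 := one_le_abs_of_ne_zero hl
  have h2 := abs_le_norm_symb l
  have hs : 1 ≤ ‖symb l‖ := h1.trans h2
  have h3 : ‖symb l ^ j * adjCoef k n ω l‖ ≤ (∑ i, |ω i|) * (1 / |(l : ℝ)|) := by
    rw [norm_mul, norm_pow, adjCoef, norm_div, Complex.norm_real, Real.norm_of_nonneg (by positivity)]
    calc ‖symb l‖ ^ j * (‖dualCoef n ω l‖ / ‖symb l‖ ^ (2 * k))
        ≤ ‖symb l‖ ^ k * ((∑ i, |ω i|) / ‖symb l‖ ^ (2 * k)) := by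
          have := norm_dualCoef_le n ω l
          gcongr
      _ = (∑ i, |ω i|) * (1 / ‖symb l‖ ^ k) := by rw [two_mul, pow_add]; field_simp
      _ ≤ _ := by
          have : |(l : ℝ)| ≤ ‖symb l‖ ^ k := h2.trans (le_self_pow₀ hs (by omega))
          have h4 : 0 ≤ ∑ i, |ω i| := Finset.sum_nonneg fun _ _ => abs_nonneg _
          gcongr
  calc ‖symb l ^ j * adjCoef k n ω l‖ ^ 2 ≤ ((∑ i, |ω i|) * (1 / |(l : ℝ)|)) ^ 2 := by gcongr
    _ = _ := by rw [mul_pow, div_pow, sq_abs, one_pow]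

theorem memLp_two_of_hasWeakDeriv {k : ℕ} {f g₁ g₂ : UnitAddCircle → ℝ} (h₁ : HasWeakDeriv k f g₁)
    (h₂ : HasWeakDeriv k f g₂) (h : MemLp g₁ 2) : MemLp g₂ 2 :=
  h.ae_eq (ae_eq_of_fc_eq h₁.integrable_deriv h₂.integrable_deriv
    fun l => by rw [h₁.fc_eq, h₂.fc_eq])

theorem homNorm_eq {k : ℕ} {v g : UnitAddCircle → ℝ} (h : HasWeakDeriv k v g) :
    homNorm k v = eLpNorm g 2 volume := by
  refine le_antisymm (iInf₂_le g h) (le_iInf₂ fun g' hg' => ?_)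
  exact (eLpNorm_congr_ae (ae_eq_of_fc_eq h.integrable_deriv hg'.integrable_deriv
    fun l => by rw [h.fc_eq, hg'.fc_eq])).le

theorem memSobolevNat_of_fc {k : ℕ} {u : UnitAddCircle → ℝ} (hu : MemLp u 2) (h0 : fc u 0 = 0)
    (hs : ∀ j ≤ k, Summable fun l => ‖symb l ^ j * fc u l‖ ^ 2) : MemSobolevNat k 2 u := by
  refine ⟨hu, ?_, fun j hj => ?_⟩
  · rw [fc_zero_eq] at h0; exact_mod_cast h0
  · obtain ⟨g, hg, hgc⟩ := exists_fc_eq _ (symb_pow_neg_conj (fc_neg u) j) (hs j hj)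
    exact ⟨g, hasWeakDeriv_of_fc_eq hu hg hgc, hg⟩

theorem MemSobolevNat.fc_zero {k : ℕ} {p : ℝ≥0∞} {g : UnitAddCircle → ℝ} (h : MemSobolevNat k p g) :
    fc g 0 = 0 := by
  rw [fc_zero_eq, h.mean_zero]; simp

/-- Write the coefficient as that of the `k`-th derivative divided by `symb l ^ k`; both factors are
square summable since `k ≥ 1`. This makes point evaluation meaningful through the Fourier series. -/
theorem summable_fc_of_memSobolevNat {k : ℕ} (hk : 1 ≤ k) {g : UnitAddCircle → ℝ}
    (hg : MemSobolevNat k 2 g) : Summable fun l => ‖fc g l‖ := by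
  obtain ⟨gk, hgk, hgk2⟩ := hg.deriv k le_rfl
  refine Summable.of_nonneg_of_le (fun _ => norm_nonneg _) (fun l => ?_)
    ((hasSum_fc_sq hgk2).summable.add summable_one_div_int_sq)
  rcases eq_or_ne l 0 with rfl | hl
  · rw [hg.fc_zero]; simp
  have h1 := one_le_abs_of_ne_zero hl
  have h2 := abs_le_norm_symb l
  have hs : 1 ≤ ‖symb l‖ := h1.trans h2
  have h3 : |(l : ℝ)| ≤ ‖symb l‖ ^ k := h2.trans (le_self_pow₀ hs (by omega))
  have h4 : ‖fc g l‖ ≤ ‖fc gk l‖ * (1 / |(l : ℝ)|) := by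
    rw [hgk.fc_eq, norm_mul, norm_pow, mul_one_div, le_div_iff₀ (by linarith), mul_comm]
    gcongr
  have h5 : (1 / |(l : ℝ)|) ^ 2 = 1 / (l : ℝ) ^ 2 := by rw [div_pow, sq_abs, one_pow]
  rw [← h5]
  nlinarith [sq_nonneg (‖fc gk l‖ - 1 / |(l : ℝ)|), sq_nonneg (‖fc gk l‖ + 1 / |(l : ℝ)|)]

theorem hasSum_conj_fc_mul_fourier {g : UnitAddCircle → ℝ} (hg : Continuous g)
    (hs : Summable fun l => ‖fc g l‖) (x : UnitAddCircle) :
    HasSum (fun l => conj (fc g l) * fourier (-l) x) (g x : ℂ) := by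
  let G : C(UnitAddCircle, ℂ) := ⟨fun x => (g x : ℂ), Complex.continuous_ofReal.comp hg⟩
  have h1 : Summable (fourierCoeff G) := Summable.of_norm hs
  have h2 := has_pointwise_sum_fourier_series_of_summable h1 x
  have h3 := Complex.hasSum_conj'.2 h2
  have h4 : conj (G x) = (g x : ℂ) := Complex.conj_ofReal _
  rw [h4] at h3
  have h5 : (fun l => conj (fc g l) * fourier (-l) x) =
      fun l => conj (fourierCoeff G l • (fourier l x : ℂ)) := by
    funext l; rw [smul_eq_mul, map_mul, ← fourier_neg]; rfl
  rw [h5]; exact h3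

/-- Parseval expresses the inner product of derivatives as a frequency sum in which the powers of
the symbol cancel. The pointwise Fourier series of `g` expresses the sampled sum in the same way. -/
theorem isSamplingAdjoint_of_fc {k n : ℕ} (hk : 1 ≤ k) {ω : Fin n → ℝ} {u : UnitAddCircle → ℝ}
    (hu : MemLp u 2) (h : ∀ l, fc u l = adjCoef k n ω l) : IsSamplingAdjoint k n ω u := by
  have hmem : MemSobolevNat k 2 u := by
    refine memSobolevNat_of_fc hu (by rw [h, adjCoef_zero hk]) fun j hj => ?_
    simp only [h]
    exact summable_symb_mul_adjCoef hk n ω hj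
  refine ⟨hmem, fun g hgc hg gk uk hgk huk => ?_⟩
  obtain ⟨gk', hgk', hgk2'⟩ := hg.deriv k le_rfl
  obtain ⟨uk', huk', huk2'⟩ := hmem.deriv k le_rfl
  have h1 := hasSum_fc_mul (memLp_two_of_hasWeakDeriv hgk' hgk hgk2')
    (memLp_two_of_hasWeakDeriv huk' huk huk2')
  have h2 : (fun l => conj (fc gk l) * fc uk l) = fun l => conj (fc g l) * dualCoef n ω l := by
    funext l
    rcases eq_or_ne l 0 with rfl | hl
    · rw [hgk.fc_eq, hg.fc_zero]; simp
    · rw [hgk.fc_eq, huk.fc_eq, h, adjCoef, map_mul]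
      have hne : ((‖symb l‖ ^ (2 * k) : ℝ) : ℂ) ≠ 0 := by
        exact_mod_cast pow_ne_zero _ (norm_ne_zero_iff.2 (symb_ne_zero hl))
      calc conj (symb l ^ k) * conj (fc g l) *
            (symb l ^ k * (dualCoef n ω l / ((‖symb l‖ ^ (2 * k) : ℝ) : ℂ)))
          = (conj (symb l ^ k) * symb l ^ k) * conj (fc g l) *
            (dualCoef n ω l / ((‖symb l‖ ^ (2 * k) : ℝ) : ℂ)) := by ring
        _ = _ := by rw [conj_symb_pow_mul]; field_simp
  rw [h2] at h1
  have h3 : HasSum (fun l => ∑ i : Fin n, (ω i : ℂ) * (conj (fc g l) * fourier (-l) (gridPt n i)))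
      (∑ i : Fin n, (ω i : ℂ) * (g (gridPt n i) : ℂ)) :=
    hasSum_sum fun i _ =>
      (hasSum_conj_fc_mul_fourier hgc (summable_fc_of_memSobolevNat hk hg) _).mul_left _
  have h4 : (fun l => ∑ i : Fin n, (ω i : ℂ) * (conj (fc g l) * fourier (-l) (gridPt n i))) =
      fun l => conj (fc g l) * dualCoef n ω l := by
    funext l
    rw [dualCoef, Finset.mul_sum]
    exact Finset.sum_congr rfl fun i _ => by ring
  rw [h4] at h3
  have h5 := h3.unique h1
  have h6 : ∑ i : Fin n, ω i * g (gridPt n i) = ∫ x, gk x * uk x := by exact_mod_cast h5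
  rw [← h6]
  exact Finset.sum_congr rfl fun i _ => mul_comm _ _

theorem exists_isSamplingAdjoint {k n : ℕ} (hk : 1 ≤ k) (ω : Fin n → ℝ) :
    ∃ u, IsSamplingAdjoint k n ω u := by
  obtain ⟨u, hu, huc⟩ := exists_fc_eq _ (adjCoef_neg k n ω)
    (by simpa using summable_symb_mul_adjCoef hk n ω (Nat.zero_le k))
  exact ⟨u, isSamplingAdjoint_of_fc hk hu huc⟩

theorem fc_trig_symb (c : ℂ) (l l' : ℤ) (j : ℕ) :
    fc (trig (c * symb l ^ j) l) l' = symb l' ^ j * fc (trig c l) l' := by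
  induction j with
  | zero => simp
  | succ j ih =>
    rw [pow_succ' (symb l'), mul_assoc, ← ih, pow_succ, ← mul_assoc]
    exact fc_eq_symb_mul_of_hasDerivAt (hasDerivAt_trig _ l)
      ((continuous_trig _ _).comp (AddCircle.continuous_mk' 1)) l'

theorem hasWeakDeriv_trig (c : ℂ) (l : ℤ) (j : ℕ) :
    HasWeakDeriv j (trig c l) (trig (c * symb l ^ j) l) :=
  hasWeakDeriv_of_fc_eq (memLp_of_continuous (continuous_trig _ _) 2)
    (memLp_of_continuous (continuous_trig _ _) 2) fun l' => fc_trig_symb c l l' j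

theorem memSobolevNat_trig (c : ℂ) {l : ℤ} (hl : l ≠ 0) (k : ℕ) : MemSobolevNat k 2 (trig c l) := by
  refine ⟨memLp_of_continuous (continuous_trig _ _) 2, ?_, fun j _ =>
    ⟨_, hasWeakDeriv_trig c l j, memLp_of_continuous (continuous_trig _ _) 2⟩⟩
  have h := fc_trig_symb (c / symb l) l 0 1
  rw [pow_one, pow_one, symb_zero, zero_mul, div_mul_cancel₀ _ (symb_ne_zero hl), fc_zero_eq] at h
  exact_mod_cast h

/-- Testing against single nonconstant characters determines every coefficient, so the infimum over
`u` in the distance function ranges over one almost-everywhere class. -/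
theorem IsSamplingAdjoint.fc_eq {k n : ℕ} (hk : 1 ≤ k) {ω : Fin n → ℝ} {u : UnitAddCircle → ℝ}
    (h : IsSamplingAdjoint k n ω u) (l : ℤ) : fc u l = adjCoef k n ω l := by
  rcases eq_or_ne l 0 with rfl | hl
  · rw [h.mem.fc_zero, adjCoef_zero hk]
  obtain ⟨uk, huk, -⟩ := h.mem.deriv k le_rfl
  have key : dualCoef n ω l = conj (symb l ^ k) * fc uk l := by
    refine eq_of_forall_re_mul fun c => ?_
    have h1 := h.inner_eq (trig c (-l)) (continuous_trig _ _)
      (memSobolevNat_trig c (neg_ne_zero.2 hl) k) _ uk (hasWeakDeriv_trig c (-l) k) huk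
    simp only [mul_comm (trig _ _ _) (uk _)] at h1
    rw [integral_mul_trig huk.integrable_deriv, neg_neg, mul_assoc] at h1
    rw [map_pow, conj_symb, ← symb_neg, ← h1, dualCoef, Finset.mul_sum, Complex.re_sum]
    refine Finset.sum_congr rfl fun i _ => ?_
    rw [← gridPt_eq, trig, mul_left_comm, Complex.re_ofReal_mul, mul_comm]
  rw [adjCoef, key, huk.fc_eq, ← mul_assoc, conj_symb_pow_mul]
  have hne : ((‖symb l‖ ^ (2 * k) : ℝ) : ℂ) ≠ 0 := by
    exact_mod_cast pow_ne_zero _ (norm_ne_zero_iff.2 (symb_ne_zero hl))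
  field_simp

/-- The error `‖D^k Sₙ^* ω - D^k f‖_{L²}` in terms of Fourier coefficients. -/
def adjErr (k n : ℕ) (f : UnitAddCircle → ℝ) (ω : Fin n → ℝ) : ℝ≥0∞ :=
  (∑' l, ENNReal.ofReal (‖symb l ^ k * (adjCoef k n ω l - fc f l)‖ ^ 2)) ^ (1 / 2 : ℝ)

theorem IsSamplingAdjoint.homNorm_sub_eq {k n : ℕ} (hk : 1 ≤ k) {ω : Fin n → ℝ}
    {u f : UnitAddCircle → ℝ} (h : IsSamplingAdjoint k n ω u) (hf : MemLp f 2)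
    (hfs : Summable fun l => ‖symb l ^ k * fc f l‖ ^ 2) :
    homNorm k (u - f) = adjErr k n f ω := by
  obtain ⟨uk, huk, huk2⟩ := h.mem.deriv k le_rfl
  obtain ⟨fk, hfk, hfkc⟩ := exists_fc_eq _ (symb_pow_neg_conj (fc_neg f) k) hfs
  have hi : ∀ {F : UnitAddCircle → ℝ}, MemLp F 2 → Integrable F := fun hF =>
    hF.integrable (by norm_num)
  have hc : ∀ l, fc (fun x => uk x - fk x) l = symb l ^ k * (adjCoef k n ω l - fc f l) := by
    intro l
    rw [fc_sub (hi huk2) (hi hfk), huk.fc_eq, h.fc_eq hk, hfkc, mul_sub]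
  have hw : HasWeakDeriv k (u - f) (fun x => uk x - fk x) := by
    refine hasWeakDeriv_of_fc_eq (h.mem.memLp.sub hf) (huk2.sub hfk) fun l => ?_
    rw [hc, ← h.fc_eq hk, ← fc_sub (hi h.mem.memLp) (hi hf)]; rfl
  have hm : MemLp (fun x => uk x - fk x) 2 := huk2.sub hfk
  rw [homNorm_eq hw, eLpNorm_two_eq hm, adjErr, Real.sqrt_eq_rpow,
    ← ENNReal.ofReal_rpow_of_nonneg (tsum_nonneg fun _ => by positivity) (by norm_num),
    ENNReal.ofReal_tsum_of_nonneg (fun _ => by positivity) (hasSum_fc_sq hm).summable]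
  simp only [hc]

theorem distFun_eq {𝓑 : Set (Set ℝ)} {k n : ℕ} (hk : 1 ≤ k) {f : UnitAddCircle → ℝ}
    (hf : MemLp f 2) (hfs : Summable fun l => ‖symb l ^ k * fc f l‖ ^ 2) (t : ℝ≥0) :
    distFun 𝓑 k n f t = ⨅ (ω : Fin n → ℝ) (_ : mrDualNorm 𝓑 n ω ≤ (t : ℝ≥0∞)), adjErr k n f ω := by
  refine iInf_congr fun ω => iInf_congr fun _ => ?_
  refine le_antisymm ?_ (le_iInf₂ fun u hu => (hu.homNorm_sub_eq hk hf hfs).ge)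
  obtain ⟨u, hu⟩ := exists_isSamplingAdjoint hk ω
  exact (iInf₂_le u hu).trans (hu.homNorm_sub_eq hk hf hfs).le

/-! ### Existence of the minimum over `t`. -/

theorem mrNorm_single_le (𝓑 : Set (Set ℝ)) (n : ℕ) (i : Fin n) {c : ℝ} (hc : |c| ≤ 1) :
    mrNorm 𝓑 n (Pi.single i c) ≤ 1 := by
  refine Real.iSup_le (fun B => ?_) zero_le_one
  rw [Finset.sum_pi_single']
  split_ifs with h
  · have h1 : 1 ≤ √((gridIn n B).card : ℝ) := by
      rw [Real.one_le_sqrt]; exact_mod_cast Finset.card_pos.2 ⟨i, h⟩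
    exact (div_le_one (by linarith)).2 (hc.trans h1)
  · simp

/-- Testing with a signed unit vector shows that the dual norm dominates the sup norm, which gives
coercivity. -/
theorem abs_le_mrDualNorm (𝓑 : Set (Set ℝ)) (n : ℕ) (ω : Fin n → ℝ) (i : Fin n) :
    ENNReal.ofReal |ω i| ≤ mrDualNorm 𝓑 n ω := by
  refine le_trans ?_ (le_iSup₂ (f := fun (v : Fin n → ℝ) (_ : mrNorm 𝓑 n v ≤ 1) =>
    ENNReal.ofReal (∑ i, ω i * v i)) (Pi.single i (SignType.sign (ω i) : ℝ))
    (mrNorm_single_le 𝓑 n i ?_))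
  · refine ENNReal.ofReal_le_ofReal (le_of_eq ?_)
    rw [Finset.sum_eq_single i]
    · rw [Pi.single_eq_same, self_mul_sign]
    · intro j _ hj; rw [Pi.single_eq_of_ne hj, mul_zero]
    · simp
  · rcases lt_trichotomy (ω i) 0 with h | h | h <;> simp [h]

theorem lowerSemicontinuous_mrDualNorm (𝓑 : Set (Set ℝ)) (n : ℕ) :
    LowerSemicontinuous (mrDualNorm 𝓑 n) := by
  refine lowerSemicontinuous_biSup fun v _ => Continuous.lowerSemicontinuous ?_
  exact ENNReal.continuous_ofReal.comp (by fun_prop)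

/-- Each term is continuous in `ω`, and a sum of nonnegative extended reals is a supremum of finite
sums, so convergence of the series plays no role. -/
theorem lowerSemicontinuous_adjErr (k n : ℕ) (f : UnitAddCircle → ℝ) :
    LowerSemicontinuous (adjErr k n f) := by
  refine Continuous.comp_lowerSemicontinuous (ENNReal.continuous_rpow_const)
    (lowerSemicontinuous_tsum fun l => Continuous.lowerSemicontinuous ?_)
    (ENNReal.monotone_rpow_of_nonneg (by norm_num))
  refine ENNReal.continuous_ofReal.comp ?_
  unfold adjCoef dualCoef
  fun_prop

theorem adjCoef_zero_right (k n : ℕ) (l : ℤ) : adjCoef k n (0 : Fin n → ℝ) l = 0 := by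
  simp [adjCoef, dualCoef]

theorem adjErr_zero_lt_top {k n : ℕ} {f : UnitAddCircle → ℝ}
    (hfs : Summable fun l => ‖symb l ^ k * fc f l‖ ^ 2) : adjErr k n f 0 < ∞ := by
  refine (ENNReal.rpow_lt_top_iff_of_pos (by norm_num)).2 ?_
  simp only [adjCoef_zero_right, zero_sub, mul_neg, norm_neg]
  exact hfs.tsum_ofReal_lt_top

/-- Minimising over `t` and then over `ω` in a dual ball is the same as minimising error plus
penalty over `ω` alone, the optimal `t` being the dual norm of `ω`. The direct method applies to the
latter problem. -/
theorem exists_isLeast {𝓑 : Set (Set ℝ)} {k n : ℕ} (hk : 1 ≤ k) {f : UnitAddCircle → ℝ}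
    (hf : MemLp f 2) (hfs : Summable fun l => ‖symb l ^ k * fc f l‖ ^ 2) {c : ℝ} (hc : 0 < c) :
    ∃ y : ℝ≥0, IsLeast (Set.range fun t : ℝ≥0 =>
      distFun 𝓑 k n f t + ENNReal.ofReal (c * (t : ℝ) ^ (1 / 2 : ℝ))) (y : ℝ≥0∞) := by
  let Φ : (Fin n → ℝ) → ℝ≥0∞ := fun ω =>
    adjErr k n f ω + ENNReal.ofReal c * mrDualNorm 𝓑 n ω ^ (1 / 2 : ℝ)
  have hΦ : LowerSemicontinuous Φ :=
    (lowerSemicontinuous_adjErr k n f).add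
      (Continuous.comp_lowerSemicontinuous
        (g := fun x : ℝ≥0∞ => ENNReal.ofReal c * x ^ (1 / 2 : ℝ))
        ((ENNReal.continuous_const_mul ENNReal.ofReal_ne_top).comp ENNReal.continuous_rpow_const)
        (lowerSemicontinuous_mrDualNorm 𝓑 n)
        fun x y hxy => mul_le_mul_right (ENNReal.rpow_le_rpow hxy (by norm_num)) _)
  have hA := adjErr_zero_lt_top (n := n) hfs
  set A := adjErr k n f 0 with hAdef
  have hΦ0 : Φ 0 = A := by
    have : mrDualNorm 𝓑 n 0 = 0 := by simp [mrDualNorm]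
    simp only [Φ, this]
    rw [ENNReal.zero_rpow_of_pos (by norm_num), mul_zero, add_zero]
  -- Outside this ball the penalty `c √R` alone exceeds the value `A` of the functional at zero.
  set R : ℝ := (A.toReal / c) ^ 2 + 1 with hR
  have hR0 : 0 < R := by positivity
  obtain ⟨ω₀, -, hmin⟩ := LowerSemicontinuousOn.exists_isMinOn
    (s := Metric.closedBall (0 : Fin n → ℝ) R) ⟨0, by simp [hR0.le]⟩
    (isCompact_closedBall _ _) (hΦ.lowerSemicontinuousOn _)
  have hglob : ∀ ω, Φ ω₀ ≤ Φ ω := by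
    intro ω
    by_cases hω : ω ∈ Metric.closedBall (0 : Fin n → ℝ) R
    · exact hmin hω
    refine (hmin (show (0 : Fin n → ℝ) ∈ Metric.closedBall 0 R by simp [hR0.le])).trans ?_
    rw [hΦ0]
    rw [mem_closedBall_zero_iff, pi_norm_le_iff_of_nonneg hR0.le] at hω
    push Not at hω
    obtain ⟨i, hi⟩ := hω
    have h1 : ENNReal.ofReal R ≤ mrDualNorm 𝓑 n ω :=
      (ENNReal.ofReal_le_ofReal hi.le).trans (abs_le_mrDualNorm 𝓑 n ω i)
    refine le_trans ?_ le_add_self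
    calc A = ENNReal.ofReal A.toReal := (ENNReal.ofReal_toReal hA.ne).symm
      _ ≤ ENNReal.ofReal c * ENNReal.ofReal R ^ (1 / 2 : ℝ) := by
          rw [ENNReal.ofReal_rpow_of_pos hR0, ← ENNReal.ofReal_mul hc.le]
          refine ENNReal.ofReal_le_ofReal ?_
          rw [← div_le_iff₀' hc, ← Real.sqrt_eq_rpow]
          exact Real.le_sqrt_of_sq_le (by linarith)
      _ ≤ _ := by gcongr
  have hfin : Φ ω₀ < ∞ := (hglob 0).trans_lt (by rw [hΦ0]; exact hA)
  have hdual : mrDualNorm 𝓑 n ω₀ ≠ ∞ := by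
    intro h
    have : Φ ω₀ = ∞ := by
      simp only [Φ, h]
      rw [ENNReal.top_rpow_of_pos (by norm_num), ENNReal.mul_top (by simpa using hc), add_top]
    exact hfin.ne this
  have hterm : ∀ t : ℝ≥0, ENNReal.ofReal (c * (t : ℝ) ^ (1 / 2 : ℝ)) =
      ENNReal.ofReal c * (t : ℝ≥0∞) ^ (1 / 2 : ℝ) := by
    intro t
    rw [ENNReal.ofReal_mul hc.le, ← ENNReal.ofReal_rpow_of_nonneg t.coe_nonneg (by norm_num),
      ENNReal.ofReal_coe_nnreal]
  have hlow : ∀ t : ℝ≥0, Φ ω₀ ≤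
      distFun 𝓑 k n f t + ENNReal.ofReal (c * (t : ℝ) ^ (1 / 2 : ℝ)) := by
    intro t
    rw [distFun_eq hk hf hfs, hterm, ← tsub_le_iff_right]
    refine le_iInf₂ fun ω hω => ?_
    rw [tsub_le_iff_right]
    refine (hglob ω).trans ?_
    simp only [Φ]
    gcongr
  refine ⟨(Φ ω₀).toNNReal, ?_⟩
  rw [ENNReal.coe_toNNReal hfin.ne]
  refine ⟨⟨(mrDualNorm 𝓑 n ω₀).toNNReal, le_antisymm ?_ (hlow _)⟩, ?_⟩
  · dsimp only
    rw [hterm, ENNReal.coe_toNNReal hdual, distFun_eq hk hf hfs, ENNReal.coe_toNNReal hdual]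
    simp only [Φ]
    gcongr
    exact iInf₂_le (f := fun ω (_ : mrDualNorm 𝓑 n ω ≤ mrDualNorm 𝓑 n ω₀) => adjErr k n f ω)
      ω₀ le_rfl
  · rintro _ ⟨t, rfl⟩
    exact hlow t

/-! ### Error of the sampled, truncated `(-1)^k D^{2k} f`. -/

theorem pow_rpow_mul_natCast {x : ℝ} (hx : 0 < x) (a : ℝ) (i : ℕ) : (x ^ a) ^ i = x ^ (a * i) := by
  rw [Real.rpow_mul hx.le, Real.rpow_natCast]

theorem norm_symb_le_of_mem_block {m j : ℕ} {l : ℤ} (hl : l ∈ block m j) :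
    ‖symb l‖ ≤ 2 * π * m * (m : ℝ) ^ j := by
  rw [norm_symb, mul_assoc _ (m : ℝ), ← pow_succ']
  exact mul_le_mul_of_nonneg_left (lt_of_mem_block hl).le (by positivity)

section Rate

variable {m : ℕ} {k : ℕ} {f : UnitAddCircle → ℝ} {C s' : ℝ}

theorem block_symb_mul_fc_le (hm : 2 ≤ m)
    (hC : ∀ j, ∑ l ∈ block m j, ‖fc f l‖ ^ 2 ≤ C * ((m : ℝ) ^ j) ^ (-(2 * (k + s')))) (i j : ℕ) :
    ∑ l ∈ block m j, (‖symb l‖ ^ i * ‖fc f l‖) ^ 2 ≤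
      ((2 * π * m) ^ i) ^ 2 * C * ((m : ℝ) ^ j) ^ (2 * (i - k - s')) := by
  have hm0 : (0 : ℝ) < m := by exact_mod_cast (by omega : 0 < m)
  set N : ℝ := (m : ℝ) ^ j with hNdef
  have hN : 0 < N := by positivity
  calc ∑ l ∈ block m j, (‖symb l‖ ^ i * ‖fc f l‖) ^ 2
      ≤ ∑ l ∈ block m j, ((2 * π * m * N) ^ i) ^ 2 * ‖fc f l‖ ^ 2 := by
        refine Finset.sum_le_sum fun l hl => ?_
        rw [mul_pow]
        gcongr
        exact norm_symb_le_of_mem_block hl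
    _ ≤ ((2 * π * m * N) ^ i) ^ 2 * (C * N ^ (-(2 * (k + s')))) := by
        rw [← Finset.mul_sum]
        exact mul_le_mul_of_nonneg_left (hC j) (by positivity)
    _ = _ := by
        have h1 : N ^ (2 * (i - k - s')) = (N ^ i) ^ 2 * N ^ (-(2 * (k + s'))) := by
          rw [← pow_mul, ← Real.rpow_natCast, ← Real.rpow_add hN]
          congr 1; push_cast; ring
        rw [h1]; ring

theorem exists_tail_le (hm : 2 ≤ m) (hC0 : 0 ≤ C) (hs' : 0 < s')
    (hC : ∀ j, ∑ l ∈ block m j, ‖fc f l‖ ^ 2 ≤ C * ((m : ℝ) ^ j) ^ (-(2 * (k + s')))) :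
    ∃ C₁ : ℝ, 0 ≤ C₁ ∧ ∀ (J : ℕ) (T : Finset ℤ), (∀ l ∈ T, (m : ℤ) ^ J ≤ |l|) →
      ∑ l ∈ T, ‖symb l ^ k * fc f l‖ ^ 2 ≤ C₁ * ((m : ℝ) ^ J) ^ (-(2 * s')) := by
  have hm1 : (1 : ℝ) < m := by exact_mod_cast hm
  have h1 : (m : ℝ) ^ (-(2 * s')) < 1 := Real.rpow_lt_one_of_one_lt_of_neg hm1 (by linarith)
  refine ⟨((2 * π * m) ^ k) ^ 2 * C * (1 - (m : ℝ) ^ (-(2 * s')))⁻¹,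
    mul_nonneg (by positivity) (inv_nonneg.2 (by linarith)), fun J T hT => ?_⟩
  refine sum_le_of_block_le hm (fun _ => sq_nonneg _) (by linarith) (by positivity)
    (fun j => ?_) J T hT
  refine le_trans (le_of_eq ?_) ((block_symb_mul_fc_le hm hC k j).trans_eq ?_)
  · exact Finset.sum_congr rfl fun l _ => by rw [norm_mul, norm_pow]
  · congr 2; ring

theorem summable_symb_mul_fc (hm : 2 ≤ m) (hk : 1 ≤ k) (hC0 : 0 ≤ C) (hs' : 0 < s')
    (hC : ∀ j, ∑ l ∈ block m j, ‖fc f l‖ ^ 2 ≤ C * ((m : ℝ) ^ j) ^ (-(2 * (k + s')))) :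
    Summable fun l => ‖symb l ^ k * fc f l‖ ^ 2 := by
  obtain ⟨C₁, -, h⟩ := exists_tail_le hm hC0 hs' hC
  refine summable_of_sum_le (c := C₁) (fun _ => sq_nonneg _) fun T => ?_
  have h1 := h 0 (T.erase 0) fun l hl => by
    rw [pow_zero]; exact Int.one_le_abs (Finset.ne_of_mem_erase hl)
  rw [pow_zero, Real.one_rpow, mul_one] at h1
  rwa [Finset.sum_erase _ (by simp [symb_zero, show k ≠ 0 by omega])] at h1

theorem summable_fc_of_summable_symb_mul (h0 : fc f 0 = 0)
    (h : Summable fun l => ‖symb l ^ k * fc f l‖ ^ 2) : Summable fun l => ‖fc f l‖ ^ 2 := by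
  refine Summable.of_nonneg_of_le (fun _ => sq_nonneg _) (fun l => ?_) h
  rcases eq_or_ne l 0 with rfl | hl
  · rw [h0]; simp
  have h1 : 1 ≤ ‖symb l‖ ^ k := one_le_pow₀ ((one_le_abs_of_ne_zero hl).trans (abs_le_norm_symb l))
  rw [norm_mul, norm_pow]
  gcongr
  exact le_mul_of_one_le_left (norm_nonneg _) h1

/-- The Fourier coefficients of `(-1)^k D^{2k} f`. -/
def laplCoef (k : ℕ) (f : UnitAddCircle → ℝ) (l : ℤ) : ℂ :=
  ((‖symb l‖ ^ (2 * k) : ℝ) : ℂ) * fc f l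

theorem laplCoef_neg (k : ℕ) (f : UnitAddCircle → ℝ) (l : ℤ) :
    laplCoef k f (-l) = conj (laplCoef k f l) := by
  rw [laplCoef, laplCoef, map_mul, Complex.conj_ofReal, fc_neg, norm_symb_neg]

theorem norm_laplCoef (k : ℕ) (f : UnitAddCircle → ℝ) (l : ℤ) :
    ‖laplCoef k f l‖ = ‖symb l‖ ^ (2 * k) * ‖fc f l‖ := by
  rw [laplCoef, norm_mul, Complex.norm_real, Real.norm_of_nonneg (by positivity)]

/-- The block sizes grow like `m^(j(1/2+k-s'))`. The bound `s' ≤ k` makes this exponent positive, so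
the highest block dominates. -/
theorem exists_sum_sqrt_le (hm : 2 ≤ m) (hC0 : 0 ≤ C) (hs'k : s' ≤ k)
    (hC : ∀ j, ∑ l ∈ block m j, ‖fc f l‖ ^ 2 ≤ C * ((m : ℝ) ^ j) ^ (-(2 * (k + s')))) :
    ∃ C₂ : ℝ, 0 ≤ C₂ ∧ ∀ J : ℕ,
      ∑ j ∈ Finset.range J, √((m : ℝ) ^ j) * √(∑ l ∈ block m j, ‖laplCoef k f l‖ ^ 2) ≤
        C₂ * ((m : ℝ) ^ J) ^ (1 / 2 + k - s') := by
  have hm1 : (1 : ℝ) < m := by exact_mod_cast hm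
  have hγ : 0 < 1 / 2 + k - s' := by linarith
  have h1 : 1 < (m : ℝ) ^ (1 / 2 + k - s') := Real.one_lt_rpow hm1 hγ
  refine ⟨(2 * π * m) ^ (2 * k) * √C * ((m : ℝ) ^ (1 / 2 + k - s') - 1)⁻¹,
    mul_nonneg (by positivity) (inv_nonneg.2 (by linarith)), fun J => ?_⟩
  rw [mul_assoc]
  refine le_trans ?_ (mul_le_mul_of_nonneg_left (sum_range_pow_rpow_le hm hγ J) (by positivity))
  rw [Finset.mul_sum]
  refine Finset.sum_le_sum fun j _ => ?_
  set N : ℝ := (m : ℝ) ^ j with hNdef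
  have hN : 0 < N := by positivity
  have h2 : √(∑ l ∈ block m j, ‖laplCoef k f l‖ ^ 2) ≤
      (2 * π * m) ^ (2 * k) * √C * N ^ (k - s') := by
    refine Real.sqrt_le_left (by positivity) |>.2 ?_
    simp only [norm_laplCoef]
    refine (block_symb_mul_fc_le hm hC (2 * k) j).trans_eq ?_
    rw [mul_pow _ (N ^ (k - s' : ℝ)), mul_pow _ (√C), Real.sq_sqrt hC0, ← Real.rpow_natCast (N ^ (k - s' : ℝ)),
      ← Real.rpow_mul hN.le]
    congr 2; push_cast; ring
  calc √N * √(∑ l ∈ block m j, ‖laplCoef k f l‖ ^ 2)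
      ≤ N ^ (1 / 2 : ℝ) * ((2 * π * m) ^ (2 * k) * √C * N ^ (k - s')) := by
        rw [Real.sqrt_eq_rpow N]; gcongr
    _ = _ := by
        rw [show (1 / 2 + k - s' : ℝ) = 1 / 2 + (k - s') by ring, Real.rpow_add hN]; ring

/-- A block of size `N` has `O(N)` terms of size at most `N^(-2k)`; the series converges since `2k >
1`. This controls the aliases. -/
theorem exists_symb_tail_le (hm : 2 ≤ m) (hk : 1 ≤ k) :
    ∃ C₄ : ℝ, 0 ≤ C₄ ∧ ∀ (n : ℕ) (T : Finset ℤ), 2 ≤ n → (∀ l ∈ T, (n : ℤ) ≤ 2 * |l|) →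
      ∑ l ∈ T, (‖symb l‖ ^ (2 * k))⁻¹ ≤ C₄ * (n : ℝ) ^ (-(2 * k - 1 : ℝ)) := by
  have hm1 : (1 : ℝ) < m := by exact_mod_cast hm
  have hm0 : (0 : ℝ) < m := by linarith
  have hk1 : (1 : ℝ) ≤ k := by exact_mod_cast hk
  set β : ℝ := 2 * k - 1 with hβ
  have hβ0 : 0 < β := by rw [hβ]; linarith
  have h1 : (m : ℝ) ^ (-β) < 1 := Real.rpow_lt_one_of_one_lt_of_neg hm1 (by linarith)
  refine ⟨2 * m * (1 - (m : ℝ) ^ (-β))⁻¹ * (2 * m) ^ β,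
    mul_nonneg (mul_nonneg (by positivity) (inv_nonneg.2 (by linarith))) (by positivity),
    fun n T hn hT => ?_⟩
  have hn2 : n / 2 ≠ 0 := by omega
  set J := Nat.log m (n / 2) with hJ
  have hJ1 : m ^ J ≤ n / 2 := Nat.pow_log_le_self m hn2
  have hJ2 : n / 2 < m ^ (J + 1) := Nat.lt_pow_succ_log_self (by omega) _
  have h2 := sum_le_of_block_le hm (c := fun l => (‖symb l‖ ^ (2 * k))⁻¹)
    (fun _ => by positivity) (C := 2 * m) hβ0 (by positivity) (fun j => ?_) J T (fun l hl => ?_)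
  · refine h2.trans ?_
    rw [mul_assoc _ ((2 * m : ℝ) ^ β)]
    refine mul_le_mul_of_nonneg_left ?_ (mul_nonneg (by positivity) (inv_nonneg.2 (by linarith)))
    have h3 : (n : ℝ) / (2 * m) ≤ (m : ℝ) ^ J := by
      rw [div_le_iff₀ (by positivity)]
      have : n ≤ m ^ J * (2 * m) := by rw [pow_succ] at hJ2; nlinarith [Nat.div_add_mod n 2, Nat.mod_lt n two_pos]
      exact_mod_cast this
    have hn0 : (0 : ℝ) < n := by exact_mod_cast (by omega : 0 < n)
    calc ((m : ℝ) ^ J) ^ (-β) ≤ ((n : ℝ) / (2 * m)) ^ (-β) :=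
          Real.rpow_le_rpow_of_nonpos (by positivity) h3 (by linarith)
      _ = (2 * m) ^ β * (n : ℝ) ^ (-β) := by
          rw [Real.div_rpow hn0.le (by positivity), Real.rpow_neg (by positivity : (0:ℝ) ≤ 2 * m),
            div_inv_eq_mul, mul_comm]
  · set N : ℝ := (m : ℝ) ^ j with hNdef
    have hN : 0 < N := by positivity
    calc ∑ l ∈ block m j, (‖symb l‖ ^ (2 * k))⁻¹ ≤ ∑ l ∈ block m j, (N ^ (2 * k))⁻¹ := by
          refine Finset.sum_le_sum fun l hl => ?_
          gcongr
          exact (le_of_mem_block hl).trans (abs_le_norm_symb l)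
      _ = (block m j).card * (N ^ (2 * k))⁻¹ := by rw [Finset.sum_const, nsmul_eq_mul]
      _ ≤ 2 * m * N * (N ^ (2 * k))⁻¹ := by
          gcongr
          exact card_block_le m j
      _ = 2 * m * N ^ (-β) := by
          rw [hβ, neg_sub, Real.rpow_sub hN, Real.rpow_one,
            show (2 * k : ℝ) = ((2 * k : ℕ) : ℝ) by push_cast; ring, Real.rpow_natCast]
          field_simp
  · have h3 := hT l hl
    have h4 : ((m ^ J : ℕ) : ℤ) ≤ ((n / 2 : ℕ) : ℤ) := by exact_mod_cast hJ1
    push_cast at h4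
    omega

/-- The grid function obtained by sampling `(-1)^k D^{2k} f` with frequencies below `m ^ J`. -/
def approxGrid (m k n J : ℕ) (f : UnitAddCircle → ℝ) (i : Fin n) : ℝ :=
  trigPoly (freq m J) (laplCoef k f) (gridPt n i) / n

theorem neg_mem_freq (hm : 2 ≤ m) {J : ℕ} {l : ℤ} (hl : l ∈ freq m J) : -l ∈ freq m J := by
  rw [mem_freq hm] at hl ⊢; simpa using hl

theorem dualCoef_approxGrid (hm : 2 ≤ m) {n J : ℕ} {l : ℤ} (hl : |l| + (m ^ J : ℕ) ≤ n) :
    dualCoef n (approxGrid m k n J f) l = if l ∈ freq m J then laplCoef k f l else 0 := by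
  have hn : (n : ℂ) ≠ 0 := by
    have h1 : 0 < m ^ J := pow_pos (by omega) J
    have h2 := abs_nonneg l
    have : n ≠ 0 := by omega
    exact_mod_cast this
  have h1 := sum_trigPoly_mul_fourier (n := n) (N := m ^ J) (S := freq m J)
    (fun l hl => neg_mem_freq hm hl) (laplCoef_neg k f)
    (fun l hl => by have := ((mem_freq hm).1 hl).2; exact_mod_cast this) hl
  have h2 : dualCoef n (approxGrid m k n J f) l =
      (∑ i : Fin n, (trigPoly (freq m J) (laplCoef k f) (gridPt n i) : ℂ) *
        fourier (-l) (gridPt n i)) / n := by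
    rw [dualCoef, Finset.sum_div]
    refine Finset.sum_congr rfl fun i _ => ?_
    rw [approxGrid]; push_cast; ring
  rw [h2, h1]
  split_ifs
  · field_simp
  · simp

/-- Cauchy–Schwarz on the grid and discrete Parseval. The weights `√(m^j) ≥ 1` are inserted
wastefully so that one quantity bounds both the aliases and the dual norm. -/
theorem sum_abs_approxGrid_le (hm : 2 ≤ m) {n J : ℕ} (hn : 2 * m ^ J ≤ n) :
    ∑ i, |approxGrid m k n J f i| ≤
      ∑ j ∈ Finset.range J, √((m : ℝ) ^ j) * √(∑ l ∈ block m j, ‖laplCoef k f l‖ ^ 2) := by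
  have hm1 : (1 : ℝ) ≤ m := by exact_mod_cast (by omega : 1 ≤ m)
  have hn0 : (0 : ℝ) < n := by
    have h1 : 0 < m ^ J := pow_pos (by omega) J
    exact_mod_cast (by omega : 0 < n)
  set E := ∑ j ∈ Finset.range J, √((m : ℝ) ^ j) * √(∑ l ∈ block m j, ‖laplCoef k f l‖ ^ 2) with hE
  have hE0 : 0 ≤ E := Finset.sum_nonneg fun _ _ => by positivity
  have hQ : ∑ l ∈ freq m J, ‖laplCoef k f l‖ ^ 2 ≤ E ^ 2 := by
    rw [sum_freq]
    refine le_trans (Finset.sum_le_sum fun j _ => ?_)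
      (Finset.sum_sq_le_sq_sum_of_nonneg (fun _ _ => by positivity))
    rw [mul_pow, Real.sq_sqrt (by positivity), Real.sq_sqrt (by positivity)]
    exact le_mul_of_one_le_left (by positivity) (one_le_pow₀ hm1)
  have h1 := sum_trigPoly_sq (n := n) (N := m ^ J) hn (S := freq m J)
    (fun l hl => neg_mem_freq hm hl) (laplCoef_neg k f)
    (fun l hl => by have := ((mem_freq hm).1 hl).2; exact_mod_cast this)
  have h2 : (∑ i, |approxGrid m k n J f i|) ^ 2 ≤ E ^ 2 := by
    calc (∑ i, |approxGrid m k n J f i|) ^ 2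
        ≤ (Finset.univ : Finset (Fin n)).card * ∑ i, |approxGrid m k n J f i| ^ 2 :=
          sq_sum_le_card_mul_sum_sq
      _ = ∑ l ∈ freq m J, ‖laplCoef k f l‖ ^ 2 := by
          simp only [sq_abs, approxGrid, div_pow]
          rw [← Finset.sum_div, h1, Finset.card_univ, Fintype.card_fin]
          field_simp
      _ ≤ E ^ 2 := hQ
  exact (pow_le_pow_iff_left₀ (Finset.sum_nonneg fun _ _ => abs_nonneg _) hE0 two_ne_zero).1 h2

/-- Frequencies below `m^J` contribute nothing, those up to `n/2` only the tail of `f`, and those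
beyond both the tail and aliases bounded uniformly by the `ℓ¹` norm of the grid function. -/
theorem exists_adjErr_le (hm : 2 ≤ m) (hk : 1 ≤ k) (hC0 : 0 ≤ C) (hs' : 0 < s') (hs'k : s' ≤ k)
    (h0 : fc f 0 = 0)
    (hC : ∀ j, ∑ l ∈ block m j, ‖fc f l‖ ^ 2 ≤ C * ((m : ℝ) ^ j) ^ (-(2 * (k + s')))) :
    ∃ C₅ : ℝ, 0 ≤ C₅ ∧ ∀ n J : ℕ, 2 * m ^ J ≤ n →
      adjErr k n f (approxGrid m k n J f) ≤ ENNReal.ofReal (C₅ * (((m : ℝ) ^ J) ^ (-s') +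
        ((m : ℝ) ^ J) ^ (1 / 2 + k - s') * (n : ℝ) ^ (-(k - 1 / 2 : ℝ)))) := by
  have hm0 : (0 : ℝ) < m := by exact_mod_cast (by omega : 0 < m)
  obtain ⟨C₁, hC₁, htail⟩ := exists_tail_le hm hC0 hs' hC
  obtain ⟨C₂, hC₂, hE⟩ := exists_sum_sqrt_le hm hC0 hs'k hC
  obtain ⟨C₄, hC₄, htail'⟩ := exists_symb_tail_le (k := k) hm hk
  refine ⟨√(2 * C₁) + √(2 * C₄) * C₂, by positivity, fun n J hn => ?_⟩
  have hM1 : 0 < m ^ J := pow_pos (by omega) J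
  have hn2 : 2 ≤ n := by omega
  have hn0 : (0 : ℝ) < n := by exact_mod_cast (by omega : 0 < n)
  set M : ℝ := (m : ℝ) ^ J with hMdef
  have hM : 0 < M := by positivity
  set B : ℝ := C₂ * M ^ (1 / 2 + k - s') with hB
  have hB0 : 0 ≤ B := by positivity
  have hdual : ∀ l, ‖dualCoef n (approxGrid m k n J f) l‖ ≤ B := fun l =>
    ((norm_dualCoef_le n _ l).trans (sum_abs_approxGrid_le hm hn)).trans (hE J)
  have hterm : ∀ l, ‖symb l ^ k * (adjCoef k n (approxGrid m k n J f) l - fc f l)‖ ^ 2 ≤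
      2 * (if (m : ℤ) ^ J ≤ |l| then ‖symb l ^ k * fc f l‖ ^ 2 else 0) +
      2 * B ^ 2 * (if (n : ℤ) ≤ 2 * |l| then (‖symb l‖ ^ (2 * k))⁻¹ else 0) := by
    intro l
    have hnn : 0 ≤ 2 * (if (m : ℤ) ^ J ≤ |l| then ‖symb l ^ k * fc f l‖ ^ 2 else 0) +
      2 * B ^ 2 * (if (n : ℤ) ≤ 2 * |l| then (‖symb l‖ ^ (2 * k))⁻¹ else 0) := by
      split_ifs <;> positivity
    rcases eq_or_ne l 0 with rfl | hl
    · have hz : ‖symb 0 ^ k * (adjCoef k n (approxGrid m k n J f) 0 - fc f 0)‖ ^ 2 = 0 := by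
        rw [adjCoef_zero hk, h0]; simp
      rw [hz]; exact hnn
    have hsl : ‖symb l‖ ≠ 0 := norm_ne_zero_iff.2 (symb_ne_zero hl)
    have hne : ((‖symb l‖ ^ (2 * k) : ℝ) : ℂ) ≠ 0 := by exact_mod_cast pow_ne_zero _ hsl
    have hnZ : (2 : ℤ) * (m : ℤ) ^ J ≤ n := by exact_mod_cast hn
    -- Since `m^J ≤ n/2`, every frequency below `n/2` satisfies the no-aliasing condition of
    -- `dualCoef_approxGrid`.
    rcases lt_or_ge |l| ((m : ℤ) ^ J) with hlt | hge
    · have h1 : adjCoef k n (approxGrid m k n J f) l = fc f l := by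
        rw [adjCoef, dualCoef_approxGrid hm (by push_cast; omega), if_pos ((mem_freq hm).2 ⟨hl, hlt⟩),
          laplCoef, mul_div_cancel_left₀ _ hne]
      rw [h1, sub_self, mul_zero, norm_zero, zero_pow two_ne_zero]; exact hnn
    · rw [if_pos hge]
      have h2 : ‖symb l ^ k * adjCoef k n (approxGrid m k n J f) l‖ ^ 2 ≤
          B ^ 2 * (if (n : ℤ) ≤ 2 * |l| then (‖symb l‖ ^ (2 * k))⁻¹ else 0) := by
        split_ifs with h3
        · rw [adjCoef, norm_mul, norm_div, norm_pow, Complex.norm_real,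
            Real.norm_of_nonneg (by positivity)]
          have h4 : (‖symb l‖ ^ k * (‖dualCoef n (approxGrid m k n J f) l‖ /
              ‖symb l‖ ^ (2 * k))) ^ 2 = ‖dualCoef n (approxGrid m k n J f) l‖ ^ 2 *
                (‖symb l‖ ^ (2 * k))⁻¹ := by
            rw [two_mul, pow_add]; field_simp
          rw [h4]
          have := hdual l
          gcongr
        · rw [adjCoef, dualCoef_approxGrid hm (by push_cast; omega), if_neg]
          · simp
          · rw [mem_freq hm]; omega
      rw [mul_sub]
      have h3 := norm_sub_le (symb l ^ k * adjCoef k n (approxGrid m k n J f) l) (symb l ^ k * fc f l)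
      have h4 := pow_le_pow_left₀ (norm_nonneg _) h3 2
      nlinarith [sq_nonneg (‖symb l ^ k * adjCoef k n (approxGrid m k n J f) l‖ -
        ‖symb l ^ k * fc f l‖)]
  have hsum : ∀ T : Finset ℤ,
      ∑ l ∈ T, ‖symb l ^ k * (adjCoef k n (approxGrid m k n J f) l - fc f l)‖ ^ 2 ≤
        2 * (C₁ * M ^ (-(2 * s'))) + 2 * B ^ 2 * (C₄ * (n : ℝ) ^ (-(2 * k - 1 : ℝ))) := by
    intro T
    refine (Finset.sum_le_sum fun l _ => hterm l).trans ?_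
    rw [Finset.sum_add_distrib, ← Finset.mul_sum, ← Finset.mul_sum, ← Finset.sum_filter,
      ← Finset.sum_filter]
    gcongr
    · exact htail J _ fun l hl => (Finset.mem_filter.1 hl).2
    · exact htail' n _ hn2 fun l hl => (Finset.mem_filter.1 hl).2
  have hbound : 2 * (C₁ * M ^ (-(2 * s'))) + 2 * B ^ 2 * (C₄ * (n : ℝ) ^ (-(2 * k - 1 : ℝ))) ≤
      ((√(2 * C₁) + √(2 * C₄) * C₂) * (M ^ (-s') +
        M ^ (1 / 2 + k - s') * (n : ℝ) ^ (-(k - 1 / 2 : ℝ)))) ^ 2 := by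
    have e1 : M ^ (-(2 * s')) = (M ^ (-s')) ^ 2 := by
      rw [pow_rpow_mul_natCast hM]; congr 1; push_cast; ring
    have e2 : (n : ℝ) ^ (-(2 * k - 1 : ℝ)) = ((n : ℝ) ^ (-(k - 1 / 2 : ℝ))) ^ 2 := by
      rw [pow_rpow_mul_natCast hn0]; congr 1; push_cast; ring
    rw [e1, e2, hB]
    set a := M ^ (-s')
    set b := M ^ (1 / 2 + k - s')
    set c := (n : ℝ) ^ (-(k - 1 / 2 : ℝ))
    have ha : 0 ≤ a := by positivity
    have hb : 0 ≤ b := by positivity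
    have hc : 0 ≤ c := by positivity
    have e3 : 2 * (C₁ * a ^ 2) + 2 * (C₂ * b) ^ 2 * (C₄ * c ^ 2) =
        (√(2 * C₁) * a) ^ 2 + (√(2 * C₄) * C₂ * (b * c)) ^ 2 := by
      have q1 := Real.sq_sqrt (by positivity : 0 ≤ 2 * C₁)
      have q4 := Real.sq_sqrt (by positivity : 0 ≤ 2 * C₄)
      linear_combination (-(a ^ 2)) * q1 - C₂ ^ 2 * (b * c) ^ 2 * q4
    rw [e3]
    have p1 : 0 ≤ √(2 * C₁) * a := by positivity
    have p2 : 0 ≤ √(2 * C₄) * C₂ * (b * c) := by positivity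
    calc (√(2 * C₁) * a) ^ 2 + (√(2 * C₄) * C₂ * (b * c)) ^ 2
        ≤ (√(2 * C₁) * a + √(2 * C₄) * C₂ * (b * c)) ^ 2 := by nlinarith
      _ ≤ _ := by
          gcongr
          have p3 : 0 ≤ √(2 * C₁) * (b * c) := by positivity
          have p4 : 0 ≤ √(2 * C₄) * C₂ * a := by positivity
          linarith
  rw [adjErr]
  have hfin : ∑' l, ENNReal.ofReal
      (‖symb l ^ k * (adjCoef k n (approxGrid m k n J f) l - fc f l)‖ ^ 2) ≤
      ENNReal.ofReal (((√(2 * C₁) + √(2 * C₄) * C₂) * (M ^ (-s') +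
        M ^ (1 / 2 + k - s') * (n : ℝ) ^ (-(k - 1 / 2 : ℝ)))) ^ 2) := by
    rw [ENNReal.tsum_eq_iSup_sum]
    refine iSup_le fun T => ?_
    rw [← ENNReal.ofReal_sum_of_nonneg fun _ _ => sq_nonneg _]
    exact ENNReal.ofReal_le_ofReal ((hsum T).trans hbound)
  refine (ENNReal.rpow_le_rpow hfin (by norm_num)).trans_eq ?_
  rw [ENNReal.ofReal_rpow_of_nonneg (by positivity) (by norm_num), ← Real.sqrt_eq_rpow,
    Real.sqrt_sq (by positivity)]

end Rate

/-! ### Choice of the cutoff and the rate. -/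

theorem excess_nonneg (p : ℝ≥0∞) : 0 ≤ excess p := le_max_right _ _

theorem excess_le_half {p : ℝ≥0∞} (hp : 1 ≤ p) : excess p ≤ 1 / 2 := by
  refine max_le ?_ (by norm_num)
  have h : (p⁻¹).toReal ≤ ((1 : ℝ≥0∞)⁻¹).toReal :=
    ENNReal.toReal_mono (by norm_num) (ENNReal.inv_le_inv.2 hp)
  rw [inv_one, ENNReal.toReal_one] at h
  linarith

theorem isLeast_le_of_adjErr_le {𝓑 : Set (Set ℝ)} {k n : ℕ} (hk : 1 ≤ k) {f : UnitAddCircle → ℝ}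
    (hf : MemLp f 2) (hfs : Summable fun l => ‖symb l ^ k * fc f l‖ ^ 2) {c : ℝ} {y : ℝ≥0}
    (hy : IsLeast (Set.range fun t : ℝ≥0 =>
      distFun 𝓑 k n f t + ENNReal.ofReal (c * (t : ℝ) ^ (1 / 2 : ℝ))) (y : ℝ≥0∞))
    {ω : Fin n → ℝ} {a t : ℝ} (hc : 0 ≤ c) (ha : 0 ≤ a) (ht : 0 ≤ t)
    (hωa : adjErr k n f ω ≤ ENNReal.ofReal a) (hωt : mrDualNorm 𝓑 n ω ≤ ENNReal.ofReal t) :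
    (y : ℝ) ≤ a + c * t ^ (1 / 2 : ℝ) := by
  lift t to ℝ≥0 using ht
  have h1 := hy.2 ⟨t, rfl⟩
  have h2 : distFun 𝓑 k n f t ≤ ENNReal.ofReal a := by
    rw [distFun_eq hk hf hfs]
    refine (iInf₂_le ω ?_).trans hωa
    rwa [ENNReal.ofReal_coe_nnreal] at hωt
  have h3 : (y : ℝ≥0∞) ≤ ENNReal.ofReal (a + c * t ^ (1 / 2 : ℝ)) := by
    rw [ENNReal.ofReal_add ha (by positivity)]
    exact h1.trans (add_le_add h2 le_rfl)
  rw [← ENNReal.ofReal_coe_nnreal] at h3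
  exact (ENNReal.ofReal_le_ofReal_iff (by positivity)).1 h3

/-- `X` is the real cutoff equating tail and penalty; `M` is an `m`-adic cutoff within a factor `m`
below it, which costs only the constant `m^s'`. -/
theorem rate_arith {m k : ℕ} (hm : 2 ≤ m) (hk : 1 ≤ k) {s' r n l X M : ℝ} (hs' : 0 < s')
    (hs'k : s' ≤ k) (hn : 0 < n) (hl : 1 ≤ l) (hr : 0 ≤ r)
    (hX1 : 1 ≤ X) (hX : X = (n * l ^ (-(2 * r))) ^ (1 / (2 * s' + 2 * k + 1)))
    (hM : 0 < M) (hMX : M ≤ X) (hXM : X ≤ m * M) :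
    M ^ (-s') ≤ m ^ s' * X ^ (-s') ∧
    M ^ (1 / 2 + k - s') * n ^ (-(k - 1 / 2 : ℝ)) ≤ X ^ (-s') ∧
    l ^ (r / 2) * (n ^ (-(1 / 2) : ℝ) * M ^ (1 / 2 + k - s')) ^ (1 / 2 : ℝ) ≤ X ^ (-s') ∧
    X ^ (-s') = n ^ (-(s' / (2 * s' + 2 * k + 1))) * l ^ (2 * r * (s' / (2 * s' + 2 * k + 1))) := by
  have hm0 : (0 : ℝ) < m := by exact_mod_cast (by omega : 0 < m)
  have hk1 : (1 : ℝ) ≤ k := by exact_mod_cast hk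
  have hX0 : 0 < X := by linarith
  have hl0 : 0 < l := by linarith
  set D : ℝ := 2 * s' + 2 * k + 1 with hD
  have hD0 : 0 < D := by rw [hD]; linarith
  have hXD : X ^ D = n * l ^ (-(2 * r)) := by
    rw [hX, ← Real.rpow_mul (by positivity), one_div_mul_cancel hD0.ne', Real.rpow_one]
  have hXn : X ^ D ≤ n := by
    rw [hXD]
    exact mul_le_of_le_one_right hn.le (Real.rpow_le_one_of_one_le_of_nonpos hl (by linarith))
  have hγ : 0 ≤ 1 / 2 + k - s' := by linarith
  have hMγ : M ^ (1 / 2 + k - s') ≤ X ^ (1 / 2 + k - s') := Real.rpow_le_rpow hM.le hMX hγ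
  refine ⟨?_, ?_, ?_, ?_⟩
  · have h1 : X / m ≤ M := by rwa [div_le_iff₀' hm0]
    refine (Real.rpow_le_rpow_of_nonpos (by positivity) h1 (by linarith)).trans_eq ?_
    rw [Real.div_rpow hX0.le hm0.le, Real.rpow_neg hm0.le, div_inv_eq_mul, mul_comm]
  · calc M ^ (1 / 2 + k - s') * n ^ (-(k - 1 / 2 : ℝ))
        ≤ X ^ (1 / 2 + k - s') * (X ^ D) ^ (-(k - 1 / 2 : ℝ)) := by
          have := Real.rpow_le_rpow_of_nonpos (by positivity) hXn
            (by linarith : (-(k - 1 / 2 : ℝ)) ≤ 0)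
          gcongr
      _ = X ^ (1 / 2 + k - s' + D * (-(k - 1 / 2 : ℝ))) := by
          rw [← Real.rpow_mul hX0.le, ← Real.rpow_add hX0]
      _ ≤ X ^ (-s') := by
          -- The exponent inequality amounts to `k + 1/2 ≤ D (k - 1/2)`, which follows from `D ≥ 2k
          -- + 1` and `k ≥ 1`.
          refine Real.rpow_le_rpow_of_exponent_le hX1 ?_
          rw [hD]
          nlinarith
  · have h1 : l ^ (r / 2) = (X ^ D) ^ (-(1 / 4) : ℝ) * n ^ (1 / 4 : ℝ) := by
      rw [hXD, Real.mul_rpow hn.le (by positivity), ← Real.rpow_mul hl0.le, mul_right_comm,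
        ← Real.rpow_add hn, show (-(1 / 4) + 1 / 4 : ℝ) = 0 by ring, Real.rpow_zero, one_mul]
      congr 1; ring
    rw [h1]
    calc (X ^ D) ^ (-(1 / 4) : ℝ) * n ^ (1 / 4 : ℝ) *
          (n ^ (-(1 / 2) : ℝ) * M ^ (1 / 2 + k - s')) ^ (1 / 2 : ℝ)
        ≤ (X ^ D) ^ (-(1 / 4) : ℝ) * n ^ (1 / 4 : ℝ) *
          (n ^ (-(1 / 2) : ℝ) * X ^ (1 / 2 + k - s')) ^ (1 / 2 : ℝ) := by gcongr
      _ = X ^ (-s') := by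
          rw [Real.mul_rpow (by positivity) (by positivity), ← Real.rpow_mul hn.le,
            ← Real.rpow_mul hX0.le, ← Real.rpow_mul hX0.le]
          have h2 : n ^ (1 / 4 : ℝ) * n ^ (-(1 / 2) * (1 / 2) : ℝ) = 1 := by
            rw [← Real.rpow_add hn]; norm_num
          calc X ^ (D * (-(1 / 4))) * n ^ (1 / 4 : ℝ) * (n ^ (-(1 / 2) * (1 / 2) : ℝ) *
                X ^ ((1 / 2 + k - s') * (1 / 2)))
              = (n ^ (1 / 4 : ℝ) * n ^ (-(1 / 2) * (1 / 2) : ℝ)) *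
                (X ^ (D * (-(1 / 4))) * X ^ ((1 / 2 + k - s') * (1 / 2))) := by ring
            _ = X ^ (-s') := by
                rw [h2, one_mul, ← Real.rpow_add hX0]
                congr 1; rw [hD]; ring
  · rw [hX, ← Real.rpow_mul (by positivity), Real.mul_rpow hn.le (by positivity),
      ← Real.rpow_mul hl0.le]
    congr 2
    · field_simp
    · field_simp

theorem isBigO_of_isLeast {m : ℕ} {𝓑 : Set (Set ℝ)} (h𝓑 : IsRegular m 𝓑) {k : ℕ} (hk : 1 ≤ k)
    {s' r C : ℝ} (hs' : 1 / 2 ≤ s') (hs'k : s' ≤ k) (hr : 0 ≤ r) {f : UnitAddCircle → ℝ}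
    (hf : Integrable f) (h0 : fc f 0 = 0) (hC0 : 0 ≤ C)
    (hC : ∀ j, ∑ l ∈ block m j, ‖fc f l‖ ^ 2 ≤ C * ((m : ℝ) ^ j) ^ (-(2 * (k + s')))) :
    ∃ c : ℕ → ℝ≥0,
      (∀ n : ℕ, 2 ≤ n →
        IsLeast (Set.range fun t : ℝ≥0 => distFun 𝓑 k n f t +
          ENNReal.ofReal (Real.log n ^ (r / 2) * (t : ℝ) ^ (1 / 2 : ℝ))) (c n : ℝ≥0∞)) ∧
      (fun n : ℕ => (c n : ℝ)) =O[atTop] fun n : ℕ =>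
        (n : ℝ) ^ (-(s' / (2 * s' + 2 * k + 1))) *
          Real.log n ^ (2 * r * (s' / (2 * s' + 2 * k + 1))) := by
  have hm := h𝓑.two_le
  have hs0 : 0 < s' := by linarith
  have hm1 : (1 : ℝ) < m := by exact_mod_cast hm
  have hk1 : (1 : ℝ) ≤ k := by exact_mod_cast hk
  have hfs := summable_symb_mul_fc hm hk hC0 hs0 hC
  have hf2 := memLp_two_of_fc hf (summable_fc_of_summable_symb_mul h0 hfs)
  have hex : ∀ n : ℕ, ∃ y : ℝ≥0, 2 ≤ n →
      IsLeast (Set.range fun t : ℝ≥0 => distFun 𝓑 k n f t +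
        ENNReal.ofReal (Real.log n ^ (r / 2) * (t : ℝ) ^ (1 / 2 : ℝ))) (y : ℝ≥0∞) := by
    intro n
    by_cases hn : 2 ≤ n
    · have hlog : 0 < Real.log n := Real.log_pos (by exact_mod_cast hn)
      obtain ⟨y, hy⟩ := exists_isLeast (𝓑 := 𝓑) (n := n) hk hf2 hfs
        (Real.rpow_pos_of_pos hlog (r / 2))
      exact ⟨y, fun _ => hy⟩
    · exact ⟨0, fun h => absurd h hn⟩
  choose c hc using hex
  refine ⟨c, hc, ?_⟩
  obtain ⟨C₅, hC₅, herr⟩ := exists_adjErr_le hm hk hC0 hs0 hs'k h0 hC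
  obtain ⟨C₂, hC₂, hE⟩ := exists_sum_sqrt_le hm hC0 hs'k hC
  set K : ℝ := (1 + 16 * π * m * √m) * C₂ with hK
  have hK0 : 0 ≤ K := by positivity
  set D : ℝ := 2 * s' + 2 * k + 1 with hD
  -- From `s' ≥ 1/2` and `k ≥ 1`. It yields `X² ≤ X^D ≤ n`, so the cutoff respects the limit `2X ≤
  -- n` as soon as `n ≥ 4`.
  have hD4 : 4 ≤ D := by rw [hD]; linarith
  refine IsBigO.of_bound (C₅ * (m ^ s' + 1) + K ^ (1 / 2 : ℝ)) ?_
  have hev : ∀ᶠ n : ℕ in atTop, Real.log n ^ (2 * r) ≤ n := by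
    have h1 := (isLittleO_log_rpow_rpow_atTop (2 * r) one_pos).bound one_pos
    filter_upwards [tendsto_natCast_atTop_atTop.eventually h1] with n hn
    simpa [Real.norm_eq_abs] using (le_abs_self _).trans hn
  have hev2 : ∀ᶠ n : ℕ in atTop, 1 ≤ Real.log n :=
    (Real.tendsto_log_atTop.comp tendsto_natCast_atTop_atTop).eventually (eventually_ge_atTop 1)
  filter_upwards [hev, hev2, eventually_ge_atTop 4] with n hn1 hl hn4
  have hn0 : (0 : ℝ) < n := by exact_mod_cast (by omega : 0 < n)
  have hn4' : (4 : ℝ) ≤ n := by exact_mod_cast hn4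
  set l := Real.log n with hldef
  have hl0 : 0 < l := by linarith
  set X : ℝ := ((n : ℝ) * l ^ (-(2 * r))) ^ (1 / D) with hX
  have hbase : 1 ≤ (n : ℝ) * l ^ (-(2 * r)) := by
    rw [Real.rpow_neg hl0.le, ← div_eq_mul_inv, one_le_div (by positivity)]
    exact hn1
  have hX1 : 1 ≤ X := Real.one_le_rpow hbase (by positivity)
  have hXn : 2 * X ≤ n := by
    rcases le_total X 2 with h | h
    · linarith
    · have h1 : X ^ (2 : ℕ) ≤ X ^ D := by
        rw [← Real.rpow_natCast]
        exact Real.rpow_le_rpow_of_exponent_le hX1 (by push_cast; linarith)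
      have h2 : X ^ D ≤ n := by
        rw [hX, ← Real.rpow_mul (by positivity), one_div_mul_cancel (by linarith), Real.rpow_one]
        exact mul_le_of_le_one_right hn0.le (Real.rpow_le_one_of_one_le_of_nonpos hl (by linarith))
      nlinarith
  obtain ⟨J, hJ1, hJ2⟩ := exists_nat_pow_near hX1 hm1
  have hJn : 2 * m ^ J ≤ n := by
    have : (2 : ℝ) * (m : ℝ) ^ J ≤ n := by linarith
    exact_mod_cast this
  set M : ℝ := (m : ℝ) ^ J with hMdef
  have hM0 : 0 < M := by positivity
  obtain ⟨b1, b2, b3, b4⟩ := rate_arith hm hk hs0 hs'k hn0 hl hr hX1 hX hM0 hJ1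
    (by rw [pow_succ'] at hJ2; exact hJ2.le)
  have hdual : mrDualNorm 𝓑 n (approxGrid m k n J f) ≤
      ENNReal.ofReal (K * ((n : ℝ) ^ (-(1 / 2) : ℝ) * M ^ (1 / 2 + k - s'))) := by
    refine (mrDualNorm_trigPoly_le h𝓑 hJn (laplCoef_neg k f)).trans (ENNReal.ofReal_le_ofReal ?_)
    calc (1 + 16 * π * m * √m) / √(n : ℝ) * ∑ j ∈ Finset.range J, √((m : ℝ) ^ j) *
          √(∑ l ∈ block m j, ‖laplCoef k f l‖ ^ 2)
        ≤ (1 + 16 * π * m * √m) / √(n : ℝ) * (C₂ * M ^ (1 / 2 + k - s')) :=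
          mul_le_mul_of_nonneg_left (hE J) (by positivity)
      _ = _ := by
          rw [Real.rpow_neg hn0.le, ← Real.sqrt_eq_rpow, hK]; ring
  have hmain := isLeast_le_of_adjErr_le hk hf2 hfs (hc n (by omega)) (by positivity)
    (by positivity) (by positivity) (herr n J hJn) hdual
  rw [Real.mul_rpow hK0 (by positivity), mul_left_comm] at hmain
  rw [Real.norm_of_nonneg (c n).coe_nonneg, ← b4, Real.norm_of_nonneg (by positivity)]
  refine hmain.trans ?_
  calc C₅ * (M ^ (-s') + M ^ (1 / 2 + k - s') * (n : ℝ) ^ (-(k - 1 / 2 : ℝ))) +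
        K ^ (1 / 2 : ℝ) * (l ^ (r / 2) *
          ((n : ℝ) ^ (-(1 / 2) : ℝ) * M ^ (1 / 2 + k - s')) ^ (1 / 2 : ℝ))
      ≤ C₅ * (m ^ s' * X ^ (-s') + X ^ (-s')) + K ^ (1 / 2 : ℝ) * X ^ (-s') := by gcongr
    _ = _ := by ring

end Multiscale

end

theorem mainTheorem4 (m : ℕ) (𝓑 : Set (Set ℝ)) (h𝓑 : Multiscale.IsRegular m 𝓑)
    (k : ℕ) (s r : ℝ) (hs : 1 ≤ s) (hsk : s ≤ k) (hr : 1 / 2 ≤ r)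
    (p : ℝ≥0∞) (hp : 1 ≤ p) (f : UnitAddCircle → ℝ)
    (hf : (∃ p' : ℝ≥0∞, 1 ≤ p' ∧ Multiscale.MemBesov (k + s) p p' f) ∨
      Multiscale.MemSobolev (k + s) p f) :
    ∃ c : ℕ → ℝ≥0,
      (∀ n : ℕ, 2 ≤ n →
        IsLeast (Set.range fun t : ℝ≥0 =>
          Multiscale.distFun 𝓑 k n f t +
            ENNReal.ofReal (Real.log n ^ (r / 2) * (t : ℝ) ^ (1 / 2 : ℝ)))
          (c n : ℝ≥0∞)) ∧
      (fun n : ℕ => (c n : ℝ)) =O[atTop] fun n : ℕ =>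
        (n : ℝ) ^ (-Multiscale.rateExp k s p) *
          Real.log n ^ (2 * r * Multiscale.rateExp k s p) := by
  have hk : 1 ≤ k := by exact_mod_cast hs.trans hsk
  have he0 := Multiscale.excess_nonneg p
  have he1 := Multiscale.excess_le_half hp
  have hσ : 0 ≤ (k : ℝ) + s := by positivity
  -- Integrability, zero mean and block decay are all that is retained of `f`; from here on the
  -- Besov and Sobolev cases coincide.
  obtain ⟨hfi, h0, C, hC0, hC⟩ : Integrable f ∧ Multiscale.fc f 0 = 0 ∧ ∃ C : ℝ, 0 < C ∧
      ∀ j, ∑ l ∈ Multiscale.block m j, ‖Multiscale.fc f l‖ ^ 2 ≤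
        C * ((m : ℝ) ^ j) ^ (-(2 * ((k : ℝ) + s - Multiscale.excess p))) := by
    rcases hf with ⟨p', hp', hB⟩ | hW
    · exact ⟨hB.memLp.integrable hp, by rw [Multiscale.fc_zero_eq, hB.mean_zero]; simp,
        hB.block_bound h𝓑.two_le hσ hp hp'⟩
    · exact ⟨hW.floor.memLp.integrable hp, hW.floor.fc_zero, hW.block_bound h𝓑.two_le hσ hp⟩
  simp only [add_sub_assoc] at hC
  have hD : Multiscale.rateExp k s p = (s - Multiscale.excess p) /
      (2 * (s - Multiscale.excess p) + 2 * k + 1) := by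
    rw [Multiscale.rateExp]; congr 1; ring
  rw [hD]
  exact Multiscale.isBigO_of_isLeast h𝓑 hk (by linarith) (by linarith) (by linarith) hfi h0 hC0.le hC
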